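/- **Setting.** Let $\Gamma$ be a finite connected metric graph (multiple edges and loops allowed) with vertex set $\mathcal V$, edge set $\mathcal E$, $E=|\mathcal E|\ge 1$, and edge lengths $\mathbf l=(l_e)$, $l_e>0$. Neumann (Kirchhoff) conditions are imposed at all vertices, except that Dirichlet conditions are allowed at some vertices of degree one. Assume $\Gamma$ is not a circle or a polygon, i.e. not all vertices have degree $2$ (a loop counts twice in the degree). Such $\Gamma$ is a *nontrivial standard graph*. Every edge gives two directed edges $e,\hat e$. Let $S$ be the $2E\times 2E$ matrix with, for $e$ terminating at $v$, $S_{\hat e,e}=\frac{2}{\deg v}-1$ (or $-1$ if $v$ is a Dirichlet vertex), $S_{e',e}=\frac2{\deg v}$ if $e'\ne\hat e$ originates at $v$, and $S_{e',e}=0$ otherwise. Fix a set $\mathcal C$ of $\beta=E-|\mathcal V|+1$ edges whose removal does not disconnect $\Gamma$. For $\mathbf x\in\mathbb T^E=\mathbb R^E/(2\pi\mathbb Z)^E$ and fluxes $\boldsymbol\alpha\in\mathbb R^{\mathcal C}$ put $$F(\mathbf x;\boldsymbol\alpha)=\det\bigl(I-e^{i\hat{\boldsymbol\alpha}}e^{i\hat{\mathbf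 x}}S\bigr),$$ where $\hat{\mathbf x}$ is diagonal with entry $x_e$ for both directions of $e$, and $\hat{\boldsymbol\alpha}$ is diagonal with entries $\pm\alpha_e$ for the two directions of $e\in\mathcal C$ and $0$ for the other edges. Let $\Sigma^{reg}=\{\mathbf x\in\mathbb T^E: F(\mathbf x;0)=0,\ \nabla_{\mathbf x}F(\mathbf x;0)\neq0\}$ and let $\Sigma^g$ be the set of $\mathbf x\in\Sigma^{reg}$ such that, for $\mathbf a\neq0$ spanning the kernel of $I-e^{i\hat{\mathbf x}}S$, one has $e^{-ix_e}a_e+a_{\hat e}\ne0$ for every directed edge $e$ originating at a vertex without Dirichlet condition. The Barra–Gaspard measure on $\Sigma^g$ is $$d\mu_{\mathbf l}=\frac{|\hat n\cdot\mathbf l|\,d\sigma}{\int_{\Sigma^g}|\hat n\cdot\mathbf l|\,d\sigma},$$ with $\hat n$ the unit normal to $\Sigma^g$ and $d\sigma$ the Euclidean surface measure. An *edge separation* of $\Gamma$ is an ordered sequence $[\Gamma_1,\dots,\Gamma_n]$ of connected subgraphs with union $\Gamma$ such that, for each $j\ge2$, $\Gamma_j$ has exactly one vertex in common with $\Gamma_1\cup\dots\cup\Gamma_{j-1}$,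 and this vertex has degree one in $\Gamma_j$. Let $\beta^{(b)}$ be the first Betti number of $\Gamma_b$ and $\boldsymbol\alpha_b$ the fluxes on the edges of $\mathcal C$ lying in $\Gamma_b$. The *local surplus* of $\Gamma_b$ at $\mathbf x\in\Sigma^g$ is the number $\sigma^{(b)}(\mathbf x)$ of negative eigenvalues, counted with multiplicity, of $$-\frac{H_{\boldsymbol\alpha_b}(F)(\mathbf x;0)}{\nabla_{\mathbf x}F(\mathbf x;0)\cdot\mathbf l},$$ where $H_{\boldsymbol\alpha_b}(F)$ is the Hessian with respect to $\boldsymbol\alpha_b$. **Theorem.** Let $\Gamma$ be a nontrivial standard graph with an edge separation $[\Gamma_1,\dots,\Gamma_n]$ and let $1\le b\le n$. Then $\mu_{\mathbf l}$ is a probability measure, the local surpluses are random variables $\sigma^{(j)}:\Sigma^g\to\{0,\dots,\beta^{(j)}\}$ on $(\Sigma^g,\mu_{\mathbf l})$, and, writing $\boldsymbol\sigma_{\hat b}=(\sigma^{(j)})_{j\ne b}$, $$P\bigl(\sigma^{(b)}=s\mid\boldsymbol\sigma_{\hat b}\bigr)=P\bigl(\sigma^{(b)}=\beta^{(b)}-s\mid\boldsymbol\sigma_{\hat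 b}\bigr),\qquad 0\le s\le\beta^{(b)},$$ that is, the two conditional probabilities given $\{\boldsymbol\sigma_{\hat b}=t\}$ agree for every value $t$ of positive probability. In particular, if $\beta^{(b)}=1$, then $$P\bigl(\sigma^{(b)}=0\mid\boldsymbol\sigma_{\hat b}\bigr)=P\bigl(\sigma^{(b)}=1\mid\boldsymbol\sigma_{\hat b}\bigr)=\tfrac12,$$ and $\sigma^{(b)}$ is a Bernoulli variable with parameter $\frac12$ independent of $\boldsymbol\sigma_{\hat b}$. -/

import Mathlib

open MeasureTheory ProbabilityTheory

noncomputable section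

/-- A finite metric graph with vertex set `V` and edge set `E` (multiple edges and loops are
allowed), together with the set of vertices carrying the Dirichlet condition; all the other
vertices carry the Neumann (Kirchhoff) condition.  Every edge `e` is the interval `[0, len e]`,
running from `init e` to `term e`; this orientation is an arbitrary choice. -/
structure QuantumGraph (V E : Type*) where
  init : E → V
  term : E → V
  len : E → ℝ
  len_pos : ∀ e, 0 < len e
  dirichlet : Finset V

namespace QuantumGraph

variable {V E : Type*} (G : QuantumGraph V E)

/-! ### Graphs, subgraphs, separations -/

/-- The directed edges are `E × Bool`: `(e, true)` is `e` travelled along its chosen orientation,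
`(e, false)` is its reversal.  `rev` is the hat `e ↦ ê`. -/
def rev (d : E × Bool) : E × Bool := (d.1, !d.2)

/-- The vertex at which a directed edge originates. -/
def origin (d : E × Bool) : V := if d.2 then G.init d.1 else G.term d.1

/-- The vertex at which a directed edge terminates. -/
def terminus (d : E × Bool) : V := G.origin (rev d)

/-- The graph with vertex set `W` and edge set `A` is connected (in particular `W ≠ ∅`). -/
def ConnectedOn (W : Set V) (A : Set E) : Prop :=
  (SimpleGraph.fromRel (fun u v : W => ∃ e ∈ A, G.init e = u ∧ G.term e = v)).Connected

/-- A subgraph: a set of vertices and a set of edges whose endpoints are among these vertices. -/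
structure Subgraph where
  verts : Finset V
  edges : Finset E
  init_mem : ∀ e ∈ edges, G.init e ∈ verts
  term_mem : ∀ e ∈ edges, G.term e ∈ verts

/-- First Betti number `E - V + 1` of a connected subgraph (for which `V ≤ E + 1`). -/
def Subgraph.betti {G : QuantumGraph V E} (H : G.Subgraph) : ℕ :=
  H.edges.card + 1 - H.verts.card

/-- A vertex separation `[Γ₁, …, Γₙ]`: an ordered sequence of connected subgraphs with union the
whole graph, each of which, from the second on, has exactly one vertex in common with the union
of the previous ones. -/
structure IsVertexSeparation {n : ℕ} (Γ : Fin n → G.Subgraph) : Prop where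
  connected : ∀ j, G.ConnectedOn (Γ j).verts (Γ j).edges
  common : ∀ j : Fin n, 0 < j.val → ∃! v, v ∈ (Γ j).verts ∧ ∃ i < j, v ∈ (Γ i).verts
  verts_cover : ∀ v, ∃ j, v ∈ (Γ j).verts
  edges_cover : ∀ e, ∃ j, e ∈ (Γ j).edges

section Finite

variable [Fintype E] [DecidableEq V] [DecidableEq E]

/-- Degree of a vertex (a loop counts twice). -/
def degree (v : V) : ℕ := (Finset.univ.filter fun d : E × Bool => G.origin d = v).card

/-- Degree of a vertex within a subgraph (a loop counts twice). -/
def Subgraph.degree {G : QuantumGraph V E} (H : G.Subgraph) (v : V) : ℕ :=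
  (Finset.univ.filter fun d : E × Bool => d.1 ∈ H.edges ∧ G.origin d = v).card

/-- An edge separation: a vertex separation in which the common vertex of `Γⱼ` with the union of
the previous subgraphs has degree one in `Γⱼ`. -/
structure IsEdgeSeparation {n : ℕ} (Γ : Fin n → G.Subgraph) : Prop
    extends G.IsVertexSeparation Γ where
  degree_common : ∀ (j : Fin n) (v : V), v ∈ (Γ j).verts → (∃ i < j, v ∈ (Γ i).verts) →
    (Γ j).degree v = 1

/-- Nontrivial standard graph: a connected quantum graph with at least one edge, which is neither
a circle nor a polygon (a connected graph all of whose vertices have degree two), and whose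
Dirichlet conditions are at vertices of degree one only. -/
structure IsNontrivialStandard : Prop where
  nonempty_edges : Nonempty E
  connected : G.ConnectedOn Set.univ Set.univ
  not_cycle : ¬ ∀ v, G.degree v = 2
  dirichlet_degree : ∀ v ∈ G.dirichlet, G.degree v = 1

/-- A set of `β = E - V + 1` edges whose removal does not disconnect the graph.  The magnetic
fluxes `α ∈ ℝ^C` are placed on these edges. -/
def IsCut [Fintype V] (C : Finset E) : Prop :=
  C.card = Fintype.card E + 1 - Fintype.card V ∧ G.ConnectedOn Set.univ {e | e ∉ C}

/-! ### The secular function -/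

/-- The bond-scattering matrix. -/
def scattering : Matrix (E × Bool) (E × Bool) ℂ := Matrix.of fun d' d =>
  if d' = rev d then
    if G.terminus d ∈ G.dirichlet then -1 else 2 / (G.degree (G.terminus d) : ℂ) - 1
  else if G.origin d' = G.terminus d then 2 / (G.degree (G.terminus d) : ℂ)
  else 0

/-- `e^{i x}`, with the same entry `e^{i x_e}` for both directions of the edge `e`. -/
def phaseMatrix (x : E → ℝ) : Matrix (E × Bool) (E × Bool) ℂ :=
  Matrix.diagonal fun d => Complex.exp (Complex.I * (x d.1 : ℂ))

/-- `e^{i a}` for edge-integrated magnetic potentials `a`, which change sign under reversal. -/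
def magneticMatrix (a : E → ℝ) : Matrix (E × Bool) (E × Bool) ℂ :=
  Matrix.diagonal fun d => Complex.exp (Complex.I * (if d.2 then (a d.1 : ℂ) else -(a d.1 : ℂ)))

/-- The secular function `det (1 - e^{ia} e^{ix} S)`; it is `2π`-periodic in each variable. -/
def secular (x a : E → ℝ) : ℂ :=
  (1 - magneticMatrix a * phaseMatrix x * G.scattering).det

/-- The magnetic potential given by fluxes `α` on the edges in `C`, and `0` on the other edges. -/
def fluxPotential (C : Finset E) (α : C → ℝ) : E → ℝ :=
  fun e => if h : e ∈ C then α ⟨e, h⟩ else 0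

/-- The gradient `∇ₓ F(x; 0)` of the secular function. -/
def gradSecular (x : E → ℝ) : EuclideanSpace ℂ E :=
  WithLp.toLp 2 fun e => lineDeriv ℝ (fun y : E → ℝ => G.secular y 0) x (Pi.single e 1)

/-- `∇ₓ F(x; 0) · l`, where `l` is the vector of edge lengths. -/
def gradDotLen (x : E → ℝ) : ℂ := ∑ e, G.gradSecular x e * (G.len e : ℂ)

/-- The Hessian of `α ↦ F(x; α)` at `α = 0`. -/
def fluxHessian (C : Finset E) (x : E → ℝ) : Matrix C C ℂ := Matrix.of fun i j =>
  lineDeriv ℝ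
    (fun α : C → ℝ =>
      lineDeriv ℝ (fun α' : C → ℝ => G.secular x (fluxPotential C α')) α (Pi.single j 1))
    0 (Pi.single i 1)

/-! ### The secular manifold and the Barra-Gaspard measure -/

/-- The regular part of the secular manifold: the points of the torus `ℝ^E / (2πℤ)^E` with
`F(x; 0) = 0` and `∇ₓ F(x; 0) ≠ 0`.  The torus is represented by its fundamental domain
`[0, 2π)^E`. -/
def regularManifold : Set (EuclideanSpace ℝ E) :=
  {x | (∀ e, x e ∈ Set.Ico 0 (2 * Real.pi)) ∧ G.secular x.ofLp 0 = 0 ∧ G.gradSecular x.ofLp ≠ 0}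

/-- The generic part `Σ^g` of the secular manifold: the regular points at which the canonical
eigenfunction, given by a vector `a` spanning the kernel of `1 - e^{ix} S`, does not vanish at any
vertex without Dirichlet condition.  Its value at the origin of `d` is `e^{-i x_d} a_d + a_{rev d}`. -/
def genericManifold : Set (EuclideanSpace ℝ E) :=
  {x | x ∈ G.regularManifold ∧
    ∀ a : E × Bool → ℂ, a ≠ 0 → (1 - phaseMatrix x.ofLp * G.scattering).mulVec a = 0 →
      ∀ d : E × Bool, G.origin d ∉ G.dirichlet →
        Complex.exp (-(Complex.I * (x d.1 : ℂ))) * a d + a (rev d) ≠ 0}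

/-- `|n · l|`, where `n` is the unit normal to the secular manifold.  On the secular manifold
`∇ₓ F` is a real normal vector times a complex number of modulus one. -/
def normalDotLen (x : E → ℝ) : ℝ := ‖G.gradDotLen x‖ / ‖G.gradSecular x‖

/-- `|n · l| dσ` on `Σ^g`.  The surface measure is the Hausdorff measure of dimension `E - 1`
(its normalization, a constant depending on the dimension only, cancels below). -/
def fluxMeasure : Measure G.genericManifold :=
  (Measure.hausdorffMeasure ((Fintype.card E : ℝ) - 1)).withDensity
    fun x => ENNReal.ofReal (G.normalDotLen x.1.ofLp)

/-- The Barra-Gaspard measure `|n · l| dσ / ∫ |n · l| dσ` on `Σ^g`. -/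
def bgMeasure : Measure G.genericManifold :=
  (G.fluxMeasure Set.univ)⁻¹ • G.fluxMeasure

/-! ### The local surplus -/

open Classical in
/-- Number of negative eigenvalues, counted with multiplicity. -/
def morseIndex {ι : Type*} [Fintype ι] [DecidableEq ι] (A : Matrix ι ι ℂ) : ℕ :=
  A.charpoly.roots.countP fun z => z.im = 0 ∧ z.re < 0

/-- The local surplus of the block `H`: the Morse index of the (real symmetric) matrix
`- H_{α_b}(F)(x; 0) / (∇ₓ F · l)`, where `α_b` are the fluxes on the edges of `C` lying in `H`. -/
def localSurplus (C : Finset E) (H : G.Subgraph) (x : G.genericManifold) : ℕ :=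
  morseIndex (-((G.gradDotLen x.1.ofLp)⁻¹ •
    (G.fluxHessian C x.1.ofLp).submatrix
      (Subtype.val : {e : C // e.1 ∈ H.edges} → C) Subtype.val))

/-- The vector of the local surpluses of all blocks except the `b`-th one. -/
def otherSurpluses {n : ℕ} (C : Finset E) (Γ : Fin n → G.Subgraph) (b : Fin n)
    (x : G.genericManifold) : {j : Fin n // j ≠ b} → ℕ :=
  fun j => G.localSurplus C (Γ j.1) x

end Finite

end QuantumGraph

end

set_option linter.unusedSectionVars false

/-! ### Real waves: vertex conditions, edge conditions and currents. -/

namespace QuantumGraph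

open scoped ComplexConjugate
open Matrix

variable {V E : Type*} (G : QuantumGraph V E)

/-! A real eigenfunction is encoded by complex amplitudes `a` on the directed edges. At a vertex
without Dirichlet condition the incoming amplitudes have a common real part (half the vertex value)
and imaginary parts of sum zero; at a Dirichlet leaf the real part vanishes (`vertexCond_iff`).
Along an edge the two amplitudes have equal moduli, and the phase `x e` links them. All amplitudes
entering the vertices of a set `W` can therefore be conjugated: the vertex conditions survive, and
new phases restore the edge conditions. If at most one edge joins `W` to its complement,
conservation forces every Wronskian current through that edge to vanish. This makes the operation
carry one-dimensional kernels to one-dimensional kernels, so it is an involution of the generic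
manifold (`GenericWave.flip`, `flip_flip`).

Effect on the Hessian. On the generic manifold the adjugate of `1 - e^{ix} S` is the rank one matrix
`κ a a*`. First order perturbation gives the gradient `-2iκ |a_e|²`. Second order perturbation shows
that the normalized Hessian at `(i, j)` is a positive constant times the current through `i` of the
linear response to a unit flux through `j` (`GenericWave.surplusMatrix_apply`). Conjugation reverses
the currents in `W` and no others, hence changes the signs of the corresponding rows
(`GenericWave.surplusMatrix_flip`). An edge separation provides, for each block `b`, a set `W`
acting by `-1` on block `b` and trivially on all earlier blocks. This system of signs is triangular,
so composing flips produces a map which changes the sign of one block alone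
(`mulSingle_mem_signGroup`). By symmetry of the Hessian, blocks do not interact
(`surplusMatrix_eq_zero`); by a flow argument along a spanning tree, the Hessian is nondegenerate
(`GenericWave.surplusMatrix_injective`). So the map replaces the surplus of block `b` by its Betti
number minus the surplus, and fixes the other surpluses (`exists_reflection`).

Effect on the measure. The moduli of the amplitudes do not change, hence neither do the normal
vector nor the density `|n · l|`. Away from the crossing edge the flip acts on each phase by a sign,
and tangency determines the remaining coordinate. The derivative is thus a linear involution of a
hyperplane, of determinant `±1`. The surface measure is a Hausdorff measure, so this is turned into
a local Lipschitz comparison with a factor close to one (`exists_hausdorffMeasure_image_le`,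
`measure_image_le_of_local`); being an involution, the flip then preserves the measure
(`measurePreserving_flip_bgMeasure`). The symmetry of the conditional laws follows by applying the
reflection to events, and for Betti number one it halves every event determined by the other
surpluses.

Normalization. The total mass is finite by a covering argument based on the stability of eigenvalues
of unitary matrices (`hausdorffMeasure_genericManifold_lt_top`). It is positive because a generic
wave can be written down explicitly (`exists_genericWave`), where circles and polygons must be
excluded, and because the manifold near it projects onto an open set of dimension `E - 1`. -/

@[simp] lemma rev_rev (d : E × Bool) : rev (rev d) = d := by simp [rev]

@[simp] lemma rev_fst (d : E × Bool) : (rev d).1 = d.1 := rfl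

@[simp] lemma rev_mk (e : E) (b : Bool) : rev (e, b) = (e, !b) := rfl

lemma rev_injective : Function.Injective (rev : E × Bool → E × Bool) :=
  Function.LeftInverse.injective rev_rev

/-- Reversal as a permutation of the directed edges. -/
def revEquiv : Equiv.Perm (E × Bool) := ⟨rev, rev, rev_rev, rev_rev⟩

lemma terminus_rev (d : E × Bool) : G.terminus (rev d) = G.origin d := by simp [terminus]

lemma origin_rev (d : E × Bool) : G.origin (rev d) = G.terminus d := rfl

@[simp] lemma terminus_true (e : E) : G.terminus (e, true) = G.term e := by
  simp [terminus, origin]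

@[simp] lemma terminus_false (e : E) : G.terminus (e, false) = G.init e := by
  simp [terminus, origin]

@[simp] lemma origin_true (e : E) : G.origin (e, true) = G.init e := by
  simp [origin]

@[simp] lemma origin_false (e : E) : G.origin (e, false) = G.term e := by
  simp [origin]

lemma sum_rev [Fintype E] {M : Type*} [AddCommMonoid M] (f : E × Bool → M) :
    ∑ d, f (rev d) = ∑ d, f d := Equiv.sum_comp revEquiv f

section Finite

variable [Fintype E] [DecidableEq V] [DecidableEq E]

/-- The directed edges terminating at a vertex. -/
def incoming (v : V) : Finset (E × Bool) := Finset.univ.filter fun d => G.terminus d = v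

@[simp] lemma mem_incoming {v : V} {d : E × Bool} : d ∈ G.incoming v ↔ G.terminus d = v := by
  simp [incoming]

lemma card_incoming (v : V) : (G.incoming v).card = G.degree v := by
  unfold incoming degree
  refine Finset.card_bij (fun d _ => rev d) ?_ (fun _ _ _ _ h => rev_injective h) ?_
  · intro d hd; exact Finset.mem_filter.2 ⟨Finset.mem_univ _, (Finset.mem_filter.1 hd).2⟩
  · intro d hd
    exact ⟨rev d, Finset.mem_filter.2 ⟨Finset.mem_univ _, by
      rw [terminus_rev]; exact (Finset.mem_filter.1 hd).2⟩, rev_rev d⟩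

lemma degree_terminus_pos (d : E × Bool) : 0 < G.degree (G.terminus d) := by
  rw [← card_incoming]; exact Finset.card_pos.2 ⟨d, by simp⟩

lemma incoming_eq_singleton {d : E × Bool} (h : G.degree (G.terminus d) = 1) :
    G.incoming (G.terminus d) = {d} := by
  rw [← card_incoming, Finset.card_eq_one] at h
  obtain ⟨c, hc⟩ := h
  have : d ∈ G.incoming (G.terminus d) := by simp
  rw [hc] at this ⊢
  simp_all

lemma eq_of_terminus_eq {d d' : E × Bool} (h : G.degree (G.terminus d) = 1)
    (h' : G.terminus d' = G.terminus d) : d' = d := by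
  have : d' ∈ G.incoming (G.terminus d) := by simpa using h'
  rwa [G.incoming_eq_singleton h, Finset.mem_singleton] at this

lemma scattering_apply (d' d : E × Bool) : G.scattering (rev d') d =
    if d = d' then (if G.terminus d ∈ G.dirichlet then -1 else 2 / (G.degree (G.terminus d) : ℂ) - 1)
    else if G.terminus d = G.terminus d' then 2 / (G.degree (G.terminus d) : ℂ) else 0 := by
  simp only [scattering, Matrix.of_apply, rev_injective.eq_iff, origin_rev]
  simp only [eq_comm (a := d'), eq_comm (a := G.terminus d')]

/-- Time reversal symmetry: with the row index reversed, an entry depends only on whether the two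
directed edges coincide and on the vertex where both end. It exchanges left and right kernels. -/
lemma scattering_symm (d' d : E × Bool) :
    G.scattering (rev d') d = G.scattering (rev d) d' := by
  rw [scattering_apply, scattering_apply]
  by_cases h : d = d'
  · simp [h]
  · by_cases h2 : G.terminus d = G.terminus d'
    · simp [h, h2, Ne.symm h]
    · simp [h, h2, Ne.symm h, Ne.symm h2]

lemma conj_scattering (d' d : E × Bool) :
    conj (G.scattering d' d) = G.scattering d' d := by
  rw [← rev_rev d', scattering_apply]
  split_ifs <;> simp [map_div₀, Complex.conj_ofNat]

/-- The Dirichlet condition is imposed at vertices of degree one only. -/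
def DirichletLeaf : Prop := ∀ v ∈ G.dirichlet, G.degree v = 1

variable {G}

/-- Scattering reflects the incoming amplitudes in their mean. At a Dirichlet vertex the degree is
one, so `d` is the only incoming edge and the formula reduces to a sign. -/
lemma scattering_mulVec (hD : G.DirichletLeaf) (g : E × Bool → ℂ) (d : E × Bool) :
    (G.scattering *ᵥ g) (rev d) = if G.terminus d ∈ G.dirichlet then - g d else
      2 / (G.degree (G.terminus d) : ℂ) * ∑ d' ∈ G.incoming (G.terminus d), g d' - g d := by
  simp only [Matrix.mulVec, dotProduct, scattering_apply]
  split_ifs with h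
  · have : ∀ c, (if c = d then (if G.terminus c ∈ G.dirichlet then -1 else
        2 / (G.degree (G.terminus c) : ℂ) - 1)
        else if G.terminus c = G.terminus d then 2 / (G.degree (G.terminus c) : ℂ) else 0) * g c =
        if c = d then - g d else 0 := by
      intro c
      by_cases hc : c = d
      · subst hc; simp [h]
      · have : G.terminus c ≠ G.terminus d := fun h' => hc (G.eq_of_terminus_eq (hD _ h) h')
        simp [hc, this]
    simp [this]
  · have : ∀ c, (if c = d then (if G.terminus c ∈ G.dirichlet then -1 else
        2 / (G.degree (G.terminus c) : ℂ) - 1)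
        else if G.terminus c = G.terminus d then 2 / (G.degree (G.terminus c) : ℂ) else 0) * g c =
        2 / (G.degree (G.terminus d) : ℂ) * (if G.terminus c = G.terminus d then g c else 0)
          - if c = d then g d else 0 := by
      intro c
      by_cases hc : c = d
      · subst hc; simp [h]; ring
      · by_cases h2 : G.terminus c = G.terminus d <;> simp [hc, h2]
    simp only [this, Finset.sum_sub_distrib, ← Finset.mul_sum]
    simp [incoming, Finset.sum_filter]

/-- Scattering followed by reversal is an involution. -/
lemma scattering_involutive (hD : G.DirichletLeaf) (g : E × Bool → ℂ) (d : E × Bool) :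
    (G.scattering *ᵥ fun c => (G.scattering *ᵥ g) (rev c)) (rev d) = g d := by
  rw [scattering_mulVec hD]
  split_ifs with h
  · rw [scattering_mulVec hD, if_pos h]; simp
  · have hdeg : (G.degree (G.terminus d) : ℂ) ≠ 0 := by
      exact_mod_cast (G.degree_terminus_pos d).ne'
    have : ∀ c ∈ G.incoming (G.terminus d), (G.scattering *ᵥ g) (rev c) =
        2 / (G.degree (G.terminus d) : ℂ) * ∑ d' ∈ G.incoming (G.terminus d), g d' - g c := by
      intro c hc
      rw [mem_incoming] at hc
      rw [scattering_mulVec hD, hc, if_neg h]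
    rw [Finset.sum_congr rfl this, this d (by simp), Finset.sum_sub_distrib, Finset.sum_const,
      card_incoming, nsmul_eq_mul]
    field_simp
    ring

variable (G)

/-- The vertex conditions for a real wave: the outgoing amplitudes are the conjugates of the
incoming ones. -/
def VertexCond (g : E × Bool → ℂ) : Prop := ∀ d, (G.scattering *ᵥ g) (rev d) = conj (g d)

variable {G}

/-- Adding `g d` to both sides leaves `2 Re (g d)` on the right, so the mean of the incoming
amplitudes must be the real part of each of them. In this form the condition is visibly stable under
conjugating everything that enters one vertex, which makes flips possible. -/
lemma vertexCond_iff (hD : G.DirichletLeaf) {g : E × Bool → ℂ} : G.VertexCond g ↔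
    ∀ d, (G.terminus d ∈ G.dirichlet → (g d).re = 0) ∧ (G.terminus d ∉ G.dirichlet →
      ∑ d' ∈ G.incoming (G.terminus d), g d' = G.degree (G.terminus d) * ((g d).re : ℂ)) := by
  refine forall_congr' fun d => ?_
  rw [scattering_mulVec hD]
  have hdeg : (G.degree (G.terminus d) : ℂ) ≠ 0 := by
    exact_mod_cast (G.degree_terminus_pos d).ne'
  by_cases h : G.terminus d ∈ G.dirichlet
  · simp only [h, if_true, not_true_eq_false, false_imp_iff, and_true, true_imp_iff, Complex.ext_iff]
    simp
    constructor
    · intro h; linarith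
    · intro h; linarith
  · simp only [h, if_false, not_false_eq_true, false_imp_iff, true_and, true_imp_iff]
    have h2 : ((g d).re : ℂ) = (g d + conj (g d)) / 2 := by
      rw [Complex.add_conj]; push_cast; ring
    rw [h2, sub_eq_iff_eq_add]
    constructor
    · intro h; field_simp at h ⊢; rw [h]; ring
    · intro h; rw [h]; field_simp; ring

/-- The standing assumptions of this section are closed under real linear combinations. -/
lemma VertexCond.add {g h : E × Bool → ℂ} (hg : G.VertexCond g) (hh : G.VertexCond h) :
    G.VertexCond (g + h) := fun d => by
  rw [Matrix.mulVec_add, Pi.add_apply, hg d, hh d]; simp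

lemma VertexCond.smul {g : E × Bool → ℂ} (c : ℝ) (hg : G.VertexCond g) :
    G.VertexCond ((c : ℂ) • g) := fun d => by
  rw [Matrix.mulVec_smul, Pi.smul_apply, hg d]; simp

lemma VertexCond.re_eq (hD : G.DirichletLeaf) {g : E × Bool → ℂ} (hg : G.VertexCond g)
    {d d' : E × Bool} (h : G.terminus d = G.terminus d') : (g d).re = (g d').re := by
  rw [vertexCond_iff hD] at hg
  by_cases hd : G.terminus d ∈ G.dirichlet
  · rw [(hg d).1 hd, (hg d').1 (h ▸ hd)]
  · have h1 := (hg d).2 hd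
    have h2 := (hg d').2 (h ▸ hd)
    rw [← h, h1] at h2
    have hdeg : (G.degree (G.terminus d) : ℂ) ≠ 0 := by
      exact_mod_cast (G.degree_terminus_pos d).ne'
    exact_mod_cast mul_left_cancel₀ hdeg h2

lemma VertexCond.sum_im (hD : G.DirichletLeaf) {g : E × Bool → ℂ} (hg : G.VertexCond g)
    {v : V} (hv : v ∉ G.dirichlet) : ∑ d ∈ G.incoming v, (g d).im = 0 := by
  rcases (G.incoming v).eq_empty_or_nonempty with h | ⟨d, hd⟩
  · simp [h]
  · rw [mem_incoming] at hd
    subst hd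
    have := congrArg Complex.im (((vertexCond_iff hD).1 hg d).2 hv)
    rw [Complex.im_sum] at this
    simpa using this

/-- The Wronskian current of two real waves is conserved at every vertex. -/
lemma VertexCond.sum_current (hD : G.DirichletLeaf) {g h : E × Bool → ℂ} (hg : G.VertexCond g)
    (hh : G.VertexCond h) (v : V) : ∑ d ∈ G.incoming v, (conj (g d) * h d).im = 0 := by
  rcases (G.incoming v).eq_empty_or_nonempty with h | ⟨c, hc⟩
  · simp [h]
  · rw [mem_incoming] at hc
    subst hc
    by_cases hv : G.terminus c ∈ G.dirichlet
    · refine Finset.sum_eq_zero fun d hd => ?_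
      rw [mem_incoming] at hd
      have h1 := ((vertexCond_iff hD).1 hg d).1 (hd ▸ hv)
      have h2 := ((vertexCond_iff hD).1 hh d).1 (hd ▸ hv)
      simp [h1, h2]
    · have : ∀ d ∈ G.incoming (G.terminus c), (conj (g d) * h d).im =
          (g c).re * (h d).im - (h c).re * (g d).im := by
        intro d hd
        rw [mem_incoming] at hd
        rw [← hg.re_eq hD hd, ← hh.re_eq hD hd]
        simp; ring
      rw [Finset.sum_congr rfl this, Finset.sum_sub_distrib, ← Finset.mul_sum, ← Finset.mul_sum,
        hg.sum_im hD hv, hh.sum_im hD hv]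
      simp

/-- The condition on the edges for a real wave. -/
def EdgeCond (x : E → ℝ) (g : E × Bool → ℂ) : Prop :=
  ∀ d, g d = Complex.exp (Complex.I * (x d.1 : ℂ)) * conj (g (rev d))

lemma EdgeCond.add {x : E → ℝ} {g h : E × Bool → ℂ} (hg : EdgeCond x g) (hh : EdgeCond x h) :
    EdgeCond x (g + h) := fun d => by
  rw [Pi.add_apply, hg d, hh d]; simp; ring

lemma EdgeCond.smul {x : E → ℝ} {g : E × Bool → ℂ} (c : ℝ) (hg : EdgeCond x g) :
    EdgeCond x ((c : ℂ) • g) := fun d => by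
  rw [Pi.smul_apply, hg d]; simp; ring

lemma conj_exp_I_mul (t : ℝ) : conj (Complex.exp (Complex.I * (t : ℂ))) *
    Complex.exp (Complex.I * (t : ℂ)) = 1 := by
  rw [← Complex.exp_conj, ← Complex.exp_add]; simp

/-- The two phases cancel in the product and only the conjugation remains. Imaginary parts
(currents) are thus antisymmetric under reversal, real parts symmetric. -/
lemma EdgeCond.current {x : E → ℝ} {g h : E × Bool → ℂ} (hg : EdgeCond x g) (hh : EdgeCond x h)
    (d : E × Bool) : conj (g d) * h d = conj (conj (g (rev d)) * h (rev d)) := by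
  rw [hg d, hh d]
  have := conj_exp_I_mul (x d.1)
  simp only [map_mul, Complex.conj_conj]
  linear_combination (g (rev d) * conj (h (rev d))) * this

lemma EdgeCond.norm_rev {x : E → ℝ} {g : E × Bool → ℂ} (hg : EdgeCond x g) (d : E × Bool) :
    ‖g (rev d)‖ = ‖g d‖ := by
  rw [hg d, norm_mul, mul_comm Complex.I, Complex.norm_exp_ofReal_mul_I]; simp

end Finite

end QuantumGraph


/-! ### Matrices with one-dimensional kernel and their adjugates. -/

section Adjugate

open Matrix

variable {ι K : Type*} [Fintype ι] [DecidableEq ι] [Field K] {A : Matrix ι ι K}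

/-- The entry is the determinant of `A` with row `j` replaced by the `i`-th coordinate form, and a
kernel vector with `v i = 0` is killed by that matrix. -/
lemma Matrix.eq_zero_of_adjugate_ne_zero {i j : ι} (h : A.adjugate i j ≠ 0) {v : ι → K}
    (hv : A *ᵥ v = 0) (hi : v i = 0) : v = 0 := by
  by_contra hne
  apply h
  rw [Matrix.adjugate_apply, ← Matrix.exists_mulVec_eq_zero_iff]
  refine ⟨v, hne, ?_⟩
  ext k
  by_cases hk : k = j
  · subst hk
    simp [Matrix.mulVec, hi]
  · have := congrFun hv k
    simpa [Matrix.mulVec, hk] using this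

lemma Matrix.exists_smul_of_adjugate_ne_zero (h : A.adjugate ≠ 0) {a b : ι → K}
    (ha : A *ᵥ a = 0) (ha0 : a ≠ 0) (hb : A *ᵥ b = 0) : ∃ c : K, b = c • a := by
  obtain ⟨i, j, hij⟩ : ∃ i j, A.adjugate i j ≠ 0 := by
    by_contra! hcon
    exact h (Matrix.ext hcon)
  have hi : a i ≠ 0 := fun hi => ha0 (Matrix.eq_zero_of_adjugate_ne_zero hij ha hi)
  refine ⟨b i / a i, ?_⟩
  rw [← sub_eq_zero]
  refine Matrix.eq_zero_of_adjugate_ne_zero hij ?_ ?_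
  · rw [Matrix.mulVec_sub, Matrix.mulVec_smul, ha, hb]; simp
  · simp [hi]

/-- If the modified determinant vanished, some `v` with `v i = 0` would have `A v` supported at `j`.
Pairing with the left kernel vector `w` gives `A v = 0`, so `v` is a multiple of `a`, and `a i ≠ 0`
makes it zero. -/
lemma Matrix.adjugate_apply_ne_zero {a w : ι → K} (hw : w ᵥ* A = 0)
    (huniq : ∀ b, A *ᵥ b = 0 → ∃ c : K, b = c • a) {i j : ι} (hi : a i ≠ 0) (hj : w j ≠ 0) :
    A.adjugate i j ≠ 0 := by
  rw [Matrix.adjugate_apply, Ne, ← Matrix.exists_mulVec_eq_zero_iff]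
  rintro ⟨v, hv0, hv⟩
  have h1 : v i = 0 := by
    have := congrFun hv j
    simpa [Matrix.mulVec] using this
  have h2 : ∀ k, k ≠ j → (A *ᵥ v) k = 0 := by
    intro k hk
    have := congrFun hv k
    simpa [Matrix.mulVec, hk] using this
  have h3 : w ⬝ᵥ (A *ᵥ v) = 0 := by
    rw [Matrix.dotProduct_mulVec, hw, zero_dotProduct]
  have h4 : A *ᵥ v = 0 := by
    ext k
    by_cases hk : k = j
    · subst hk
      rw [dotProduct, Finset.sum_eq_single k (fun l _ hl => by rw [h2 l hl, mul_zero])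
        (by simp)] at h3
      simpa [hj] using h3
    · exact h2 k hk
  obtain ⟨c, rfl⟩ := huniq v h4
  have hc : c = 0 := by simpa [hi] using h1
  exact hv0 (by simp [hc])

/-- If the right kernel is spanned by `a` and the left kernel by `w`, then the adjugate is a nonzero
multiple of `a wᵀ`. -/
lemma Matrix.exists_adjugate_eq {a w : ι → K} (ha0 : a ≠ 0) (hw0 : w ≠ 0) (ha : A *ᵥ a = 0)
    (hw : w ᵥ* A = 0) (huniq : ∀ b, A *ᵥ b = 0 → ∃ c : K, b = c • a)
    (hwuniq : ∀ b, b ᵥ* A = 0 → ∃ c : K, b = c • w) :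
    ∃ κ : K, κ ≠ 0 ∧ ∀ i j, A.adjugate i j = κ * a i * w j := by
  obtain ⟨i, hi⟩ := Function.ne_iff.1 ha0
  obtain ⟨j, hj⟩ := Function.ne_iff.1 hw0
  have hdet : A.det = 0 := Matrix.exists_mulVec_eq_zero_iff.1 ⟨a, ha0, ha⟩
  have hcol : ∀ l, ∃ c : K, (fun k => A.adjugate k l) = c • a := by
    intro l
    refine huniq _ ?_
    ext k
    have := congrFun (congrFun A.mul_adjugate k) l
    simpa [hdet, Matrix.mul_apply, Matrix.mulVec, dotProduct] using this
  choose c hc using hcol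
  have hrow : ∃ s : K, (fun l => A.adjugate i l) = s • w := by
    refine hwuniq _ ?_
    ext l
    have := congrFun (congrFun A.adjugate_mul i) l
    simpa [hdet, Matrix.mul_apply, Matrix.vecMul, dotProduct] using this
  obtain ⟨s, hs⟩ := hrow
  have key : ∀ k l, A.adjugate k l = s / a i * a k * w l := by
    intro k l
    have h1 : A.adjugate k l = c l * a k := congrFun (hc l) k
    have h2 : A.adjugate i l = c l * a i := congrFun (hc l) i
    have h3 : A.adjugate i l = s * w l := congrFun hs l
    rw [h1]
    have h4 : c l = s * w l / a i := by rw [eq_div_iff hi, ← h2, h3]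
    rw [h4]; ring
  refine ⟨s / a i, fun h0 => ?_, key⟩
  exact Matrix.adjugate_apply_ne_zero hw huniq hi hj (by rw [key, h0]; simp)

/-- If the kernel is spanned by `a` and `w` is a nonzero left kernel vector, then the range is the
hyperplane orthogonal to `w`. -/
lemma Matrix.exists_mulVec_eq_of_dotProduct_eq_zero {a w y : ι → K} (hw0 : w ≠ 0)
    (hw : w ᵥ* A = 0) (huniq : ∀ b, A *ᵥ b = 0 → ∃ c : K, b = c • a) (hy : w ⬝ᵥ y = 0) :
    ∃ b, A *ᵥ b = y := by
  let W : (ι → K) →ₗ[K] K := ∑ k, w k • LinearMap.proj k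
  have hW : ∀ v, W v = w ⬝ᵥ v := fun v => by simp [W, dotProduct]
  have hle : LinearMap.range A.mulVecLin ≤ LinearMap.ker W := by
    rintro _ ⟨v, rfl⟩
    rw [LinearMap.mem_ker, hW, Matrix.mulVecLin_apply, Matrix.dotProduct_mulVec, hw,
      zero_dotProduct]
  have hker : LinearMap.ker A.mulVecLin ≤ Submodule.span K {a} := by
    intro v hv
    obtain ⟨c, rfl⟩ := huniq v (by simpa using hv)
    exact Submodule.smul_mem _ _ (Submodule.mem_span_singleton_self a)
  have h1 : Module.finrank K (LinearMap.ker A.mulVecLin) ≤ 1 :=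
    (Submodule.finrank_mono hker).trans (by simpa using finrank_span_le_card (R := K) ({a} : Set (ι → K)))
  have h2 := LinearMap.finrank_range_add_finrank_ker A.mulVecLin
  have h3 := LinearMap.finrank_range_add_finrank_ker W
  have h4 : Module.finrank K (LinearMap.range W) = 1 := by
    obtain ⟨j, hj⟩ := Function.ne_iff.1 hw0
    have : LinearMap.range W = ⊤ := by
      rw [LinearMap.range_eq_top]
      intro z
      refine ⟨Pi.single j (z / w j), ?_⟩
      rw [hW, dotProduct_single]
      exact mul_div_cancel₀ z hj
    rw [this]; simp
  have heq : LinearMap.range A.mulVecLin = LinearMap.ker W :=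
    Submodule.eq_of_le_of_finrank_le hle (by omega)
  have : y ∈ LinearMap.range A.mulVecLin := by
    rw [heq, LinearMap.mem_ker, hW, hy]
  obtain ⟨b, hb⟩ := this
  exact ⟨b, by simpa using hb⟩

end Adjugate

/-! ### The kernel of `1 - e^{ix} S` and generic waves. -/

namespace QuantumGraph

open scoped ComplexConjugate
open Matrix

variable {V E : Type*} {G : QuantumGraph V E} [Fintype E] [DecidableEq V] [DecidableEq E]

variable (G) in
/-- The matrix `1 - e^{ix} S` whose kernel consists of the eigenfunctions. -/
noncomputable def secMatrix (x : E → ℝ) : Matrix (E × Bool) (E × Bool) ℂ :=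
  1 - phaseMatrix x * G.scattering

lemma secMatrix_mulVec (x : E → ℝ) (a : E × Bool → ℂ) (d : E × Bool) :
    (G.secMatrix x *ᵥ a) d = a d - Complex.exp (Complex.I * (x d.1 : ℂ)) *
      (G.scattering *ᵥ a) d := by
  rw [secMatrix, Matrix.sub_mulVec, Matrix.one_mulVec, phaseMatrix]
  simp only [Pi.sub_apply]
  congr 1
  rw [← Matrix.mulVec_mulVec, Matrix.mulVec_diagonal]

lemma secular_eq_det (x : E → ℝ) : G.secular x 0 = (G.secMatrix x).det := by
  have : magneticMatrix (0 : E → ℝ) = 1 := by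
    simp [magneticMatrix]
  rw [secular, secMatrix, this, one_mul]

lemma secMatrix_mulVec_eq_zero {x : E → ℝ} {a : E × Bool → ℂ} (hv : G.VertexCond a)
    (he : EdgeCond x a) : G.secMatrix x *ᵥ a = 0 := by
  ext d
  rw [secMatrix_mulVec]
  have := hv (rev d)
  rw [rev_rev] at this
  rw [this, ← he d]; simp

lemma scattering_of_mem_ker {x : E → ℝ} {a : E × Bool → ℂ} (h : G.secMatrix x *ᵥ a = 0)
    (d : E × Bool) : (G.scattering *ᵥ a) d = Complex.exp (-(Complex.I * (x d.1 : ℂ))) * a d := by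
  have := congrFun h d
  rw [secMatrix_mulVec, Pi.zero_apply, sub_eq_zero] at this
  rw [this, ← mul_assoc, ← Complex.exp_add]; simp

/-- Time reversal, which fixes the amplitudes of the real eigenfunctions. -/
noncomputable def timeRev (x : E → ℝ) (g : E × Bool → ℂ) : E × Bool → ℂ :=
  fun d => Complex.exp (Complex.I * (x d.1 : ℂ)) * conj (g (rev d))

lemma timeRev_timeRev (x : E → ℝ) (g : E × Bool → ℂ) : timeRev x (timeRev x g) = g := by
  ext d
  have := conj_exp_I_mul (x d.1)
  simp only [timeRev, rev_fst, rev_rev, map_mul, Complex.conj_conj]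
  linear_combination g d * this

lemma conj_scattering_mulVec (g : E × Bool → ℂ) (d : E × Bool) :
    conj ((G.scattering *ᵥ g) d) = (G.scattering *ᵥ fun c => conj (g c)) d := by
  simp [Matrix.mulVec, dotProduct, map_sum, conj_scattering]

/-- On the kernel, `timeRev x a` equals the reversed scattering of the conjugate of `a`, because `S`
is real. Scattering it again gives back the conjugate of `a`, since reversed scattering is an
involution. -/
lemma secMatrix_mulVec_timeRev (hD : G.DirichletLeaf) {x : E → ℝ} {a : E × Bool → ℂ}
    (h : G.secMatrix x *ᵥ a = 0) : G.secMatrix x *ᵥ timeRev x a = 0 := by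
  ext d
  rw [secMatrix_mulVec, Pi.zero_apply, sub_eq_zero, timeRev]
  congr 1
  have h1 : timeRev x a = fun c => (G.scattering *ᵥ fun c' => conj (a c')) (rev c) := by
    ext c
    rw [← conj_scattering_mulVec, scattering_of_mem_ker h, timeRev]
    simp [← Complex.exp_conj]
  have h2 := scattering_involutive hD (fun c' => conj (a c')) (rev d)
  rw [rev_rev, ← h1] at h2
  exact h2.symm

lemma vertexCond_of_mem_ker {x : E → ℝ} {a : E × Bool → ℂ} (h : G.secMatrix x *ᵥ a = 0)
    (he : EdgeCond x a) : G.VertexCond a := by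
  intro d
  have := conj_exp_I_mul (x d.1)
  rw [scattering_of_mem_ker h, rev_fst, he (rev d), rev_rev, ← mul_assoc, ← Complex.exp_add]
  simp

/-- Every element of the kernel is a complex combination of amplitudes of real eigenfunctions. -/
lemma exists_re_im_of_mem_ker (hD : G.DirichletLeaf) {x : E → ℝ} {b : E × Bool → ℂ}
    (h : G.secMatrix x *ᵥ b = 0) : ∃ p q : E × Bool → ℂ, G.VertexCond p ∧ EdgeCond x p ∧
      G.VertexCond q ∧ EdgeCond x q ∧ b = p + Complex.I • q := by
  have ht := secMatrix_mulVec_timeRev hD h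
  have htt : ∀ d, b d = Complex.exp (Complex.I * (x d.1 : ℂ)) * conj (timeRev x b (rev d)) :=
    fun d => (congrFun (timeRev_timeRev x b) d).symm
  have htd : ∀ d, timeRev x b d = Complex.exp (Complex.I * (x d.1 : ℂ)) * conj (b (rev d)) :=
    fun d => rfl
  -- Real and imaginary parts of `b` with respect to the antilinear involution `timeRev x`, whose
  -- fixed vectors are those satisfying `EdgeCond x`.
  let p : E × Bool → ℂ := (1 / 2 : ℂ) • (b + timeRev x b)
  let q : E × Bool → ℂ := (-(Complex.I) / 2) • (b - timeRev x b)
  have hp : EdgeCond x p := by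
    intro d
    simp only [p, Pi.smul_apply, Pi.add_apply, smul_eq_mul, map_mul, map_add]
    simp only [map_div₀, map_one, Complex.conj_ofNat]
    linear_combination (1 / 2) * htt d + (1 / 2) * htd d
  have hq : EdgeCond x q := by
    intro d
    simp only [q, Pi.smul_apply, Pi.sub_apply, smul_eq_mul, map_mul, map_sub]
    simp only [map_div₀, map_neg, Complex.conj_I, Complex.conj_ofNat]
    linear_combination (-Complex.I / 2) * htt d + (Complex.I / 2) * htd d
  refine ⟨p, q, vertexCond_of_mem_ker ?_ hp, hp, vertexCond_of_mem_ker ?_ hq, hq, ?_⟩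
  · simp only [p]; rw [Matrix.mulVec_smul, Matrix.mulVec_add, h, ht]; simp
  · simp only [q]; rw [Matrix.mulVec_smul, Matrix.mulVec_sub, h, ht]; simp
  · ext d
    simp only [p, q, Pi.add_apply, Pi.smul_apply, Pi.sub_apply, smul_eq_mul]
    linear_combination ((1 / 2) * (b d - timeRev x b d)) * Complex.I_mul_I

variable (G) in
/-- `a` spans the kernel of `1 - e^{ix} S`, is real, and does not vanish at the vertices without
Dirichlet condition. -/
structure GenericWave (x : E → ℝ) (a : E × Bool → ℂ) : Prop where
  vertex : G.VertexCond a
  edge : EdgeCond x a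
  unique : ∀ b, G.VertexCond b → EdgeCond x b → ∃ c : ℝ, b = (c : ℂ) • a
  re_ne_zero : ∀ d, G.terminus d ∉ G.dirichlet → (a d).re ≠ 0
  ne_zero : ∀ d, a d ≠ 0

variable {x : E → ℝ} {a : E × Bool → ℂ}

lemma GenericWave.mulVec (h : G.GenericWave x a) : G.secMatrix x *ᵥ a = 0 :=
  secMatrix_mulVec_eq_zero h.vertex h.edge

lemma GenericWave.unique_complex (hD : G.DirichletLeaf) (h : G.GenericWave x a)
    {b : E × Bool → ℂ} (hb : G.secMatrix x *ᵥ b = 0) : ∃ c : ℂ, b = c • a := by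
  obtain ⟨p, q, hpv, hpe, hqv, hqe, rfl⟩ := exists_re_im_of_mem_ker hD hb
  obtain ⟨c, rfl⟩ := h.unique p hpv hpe
  obtain ⟨c', rfl⟩ := h.unique q hqv hqe
  exact ⟨c + Complex.I * c', by rw [add_smul, mul_smul]⟩

/-- `scattering_symm` turns multiplication by `S` from the right into multiplication from the left,
at the price of reversals. -/
lemma vecMul_secMatrix (x : E → ℝ) (b : E × Bool → ℂ) (d : E × Bool) :
    (b ᵥ* G.secMatrix x) d = b d -
      (G.scattering *ᵥ fun c => Complex.exp (Complex.I * (x c.1 : ℂ)) * b (rev c)) (rev d) := by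
  have : G.scattering *ᵥ (fun c => Complex.exp (Complex.I * (x c.1 : ℂ)) * b (rev c)) =
      fun d => ((fun c => Complex.exp (Complex.I * (x c.1 : ℂ)) * b c) ᵥ* G.scattering)
        (rev d) := by
    ext d
    simp only [Matrix.mulVec, Matrix.vecMul, dotProduct]
    rw [← sum_rev]
    refine Finset.sum_congr rfl fun c _ => ?_
    have := G.scattering_symm (rev d) (rev c)
    simp only [rev_rev] at this
    simp only [rev_rev, rev_fst]
    rw [this, mul_comm]
  rw [this]
  simp only [rev_rev]
  rw [secMatrix, Matrix.vecMul_sub, Matrix.vecMul_one, ← Matrix.vecMul_vecMul]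
  simp only [Pi.sub_apply]
  congr 2
  ext c
  simp [phaseMatrix, Matrix.vecMul_diagonal, mul_comm]

lemma conj_vecMul_secMatrix (hv : G.VertexCond a) (he : EdgeCond x a) :
    (fun d => conj (a d)) ᵥ* G.secMatrix x = 0 := by
  ext d
  rw [vecMul_secMatrix]
  have : (fun c => Complex.exp (Complex.I * (x c.1 : ℂ)) * conj (a (rev c))) = a :=
    funext fun c => (he c).symm
  rw [this, hv d]; simp

/-- Reversal followed by the phases `e^{ix}` sends the left kernel to the right kernel, where
uniqueness is known. -/
lemma GenericWave.left_unique (hD : G.DirichletLeaf) (h : G.GenericWave x a)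
    {b : E × Bool → ℂ} (hb : b ᵥ* G.secMatrix x = 0) : ∃ c : ℂ, b = c • fun d => conj (a d) := by
  have hb' : ∀ d, b d = (G.scattering *ᵥ
      fun c => Complex.exp (Complex.I * (x c.1 : ℂ)) * b (rev c)) (rev d) := by
    intro d
    have := congrFun hb d
    rwa [vecMul_secMatrix, Pi.zero_apply, sub_eq_zero] at this
  have : G.secMatrix x *ᵥ (fun c => Complex.exp (Complex.I * (x c.1 : ℂ)) * b (rev c)) = 0 := by
    ext d
    rw [secMatrix_mulVec, hb' (rev d), rev_rev]; simp
  obtain ⟨c, hc⟩ := h.unique_complex hD this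
  refine ⟨c, funext fun d => ?_⟩
  have h1 := congrFun hc (rev d)
  simp only [rev_fst, rev_rev, Pi.smul_apply, smul_eq_mul] at h1 ⊢
  rw [h.edge (rev d), rev_rev, rev_fst, mul_left_comm] at h1
  exact mul_left_cancel₀ (Complex.exp_ne_zero _) h1

variable [Nonempty E]

/-- The left kernel is spanned by the conjugate of `a`, so the adjugate is a multiple of `a a*`. The
factor `κ` occurs in the gradient and in the Hessian alike and cancels from the normalized Hessian.
-/
lemma GenericWave.exists_adjugate (hD : G.DirichletLeaf) (h : G.GenericWave x a) :
    ∃ κ : ℂ, κ ≠ 0 ∧ ∀ d d', (G.secMatrix x).adjugate d d' = κ * a d * conj (a d') := by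
  obtain ⟨e⟩ := ‹Nonempty E›
  refine Matrix.exists_adjugate_eq (w := fun d => conj (a d))
    (Function.ne_iff.2 ⟨(e, true), h.ne_zero _⟩)
    (Function.ne_iff.2 ⟨(e, true), by simpa using h.ne_zero _⟩) h.mulVec
    (conj_vecMul_secMatrix h.vertex h.edge) (fun b hb => h.unique_complex hD hb)
    (fun b hb => h.left_unique hD hb)

end QuantumGraph


/-! ### Mixed second derivatives and perturbation of determinants. -/

section Jets

open Matrix

/-- The function `g` of two real variables has value `c`, first derivatives `cs`, `ct` and mixed
second derivative `cst` at the origin. -/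
def HasJet (g : ℝ → ℝ → ℂ) (c cs ct cst : ℂ) : Prop :=
  ∃ gt : ℝ → ℂ, (∀ s, HasDerivAt (g s) (gt s) 0) ∧ HasDerivAt (fun s => g s 0) cs 0 ∧
    HasDerivAt gt cst 0 ∧ g 0 0 = c ∧ gt 0 = ct

namespace HasJet

variable {g h : ℝ → ℝ → ℂ} {c cs ct cst d ds dt dst : ℂ}

lemma deriv_deriv (hg : HasJet g c cs ct cst) :
    deriv (fun s => deriv (fun t => g s t) 0) 0 = cst := by
  obtain ⟨gt, h1, h2, h3, -, -⟩ := hg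
  have : (fun s => deriv (fun t => g s t) 0) = gt := funext fun s => (h1 s).deriv
  rw [this, h3.deriv]

lemma unique (hg : HasJet g c cs ct cst) (hg' : HasJet g d ds dt dst) :
    c = d ∧ cs = ds ∧ ct = dt ∧ cst = dst := by
  have h3 := hg.deriv_deriv.symm.trans hg'.deriv_deriv
  obtain ⟨gt, h1, h2, -, h4, h5⟩ := hg
  obtain ⟨gt', h1', h2', -, h4', h5'⟩ := hg'
  exact ⟨h4.symm.trans h4', h2.unique h2', h5 ▸ h5' ▸ (h1 0).unique (h1' 0), h3⟩

lemma const (c : ℂ) : HasJet (fun _ _ => c) c 0 0 0 :=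
  ⟨fun _ => 0, fun _ => hasDerivAt_const _ _, hasDerivAt_const _ _, hasDerivAt_const _ _, rfl, rfl⟩

lemma add (hg : HasJet g c cs ct cst) (hh : HasJet h d ds dt dst) :
    HasJet (fun s t => g s t + h s t) (c + d) (cs + ds) (ct + dt) (cst + dst) := by
  obtain ⟨gt, h1, h2, h3, h4, h5⟩ := hg
  obtain ⟨ht, h1', h2', h3', h4', h5'⟩ := hh
  exact ⟨fun s => gt s + ht s, fun s => (h1 s).add (h1' s), h2.add h2', h3.add h3',
    by simp only [h4, h4'], by simp only [h5, h5']⟩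

lemma mul (hg : HasJet g c cs ct cst) (hh : HasJet h d ds dt dst) :
    HasJet (fun s t => g s t * h s t) (c * d) (cs * d + c * ds) (ct * d + c * dt)
      (cst * d + ct * ds + cs * dt + c * dst) := by
  obtain ⟨gt, h1, h2, h3, rfl, rfl⟩ := hg
  obtain ⟨ht, h1', h2', h3', rfl, rfl⟩ := hh
  refine ⟨fun s => gt s * h s 0 + g s 0 * ht s, fun s => (h1 s).mul (h1' s), h2.mul h2', ?_,
    rfl, rfl⟩
  convert! (h3.mul h2').add (h2.mul h3') using 1
  ring

lemma sub (hg : HasJet g c cs ct cst) (hh : HasJet h d ds dt dst) :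
    HasJet (fun s t => g s t - h s t) (c - d) (cs - ds) (ct - dt) (cst - dst) := by
  obtain ⟨gt, h1, h2, h3, h4, h5⟩ := hg
  obtain ⟨ht, h1', h2', h3', h4', h5'⟩ := hh
  exact ⟨fun s => gt s - ht s, fun s => (h1 s).sub (h1' s), h2.sub h2', h3.sub h3',
    by simp only [h4, h4'], by simp only [h5, h5']⟩

lemma sum {ι : Type*} (S : Finset ι) {g : ι → ℝ → ℝ → ℂ} {c cs ct cst : ι → ℂ}
    (h : ∀ i ∈ S, HasJet (g i) (c i) (cs i) (ct i) (cst i)) :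
    HasJet (fun s t => ∑ i ∈ S, g i s t) (∑ i ∈ S, c i) (∑ i ∈ S, cs i) (∑ i ∈ S, ct i)
      (∑ i ∈ S, cst i) := by
  classical
  induction S using Finset.induction_on with
  | empty => simpa using HasJet.const 0
  | insert i S hi ih =>
    simp only [Finset.sum_insert hi]
    exact (h i (by simp)).add (ih fun j hj => h j (by simp [hj]))

lemma affine (a b b' : ℂ) : HasJet (fun s t => a + s * b + t * b') a b b' 0 := by
  refine ⟨fun _ => b', fun s => ?_, ?_, hasDerivAt_const _ _, by simp, rfl⟩
  · simpa using ((Complex.ofRealCLM.hasDerivAt (x := (0 : ℝ))).mul_const b').const_add (a + s * b)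
  · simpa using ((Complex.ofRealCLM.hasDerivAt (x := (0 : ℝ))).mul_const b).const_add a

lemma exp (α β : ℝ) : HasJet (fun s t => Complex.exp (Complex.I * (s * α + t * β)))
    1 (Complex.I * α) (Complex.I * β) (-(α * β)) := by
  have h0 : ∀ (c z : ℂ), HasDerivAt (fun t : ℝ => Complex.exp (Complex.I * (z + t * c)))
      (Complex.exp (Complex.I * z) * (Complex.I * c)) 0 := by
    intro c z
    have := (((Complex.ofRealCLM.hasDerivAt (x := (0 : ℝ))).mul_const c).const_add z).const_mul
      Complex.I
    simpa using this.cexp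
  refine ⟨fun s => Complex.exp (Complex.I * (s * α)) * (Complex.I * β), fun s => h0 _ _, ?_, ?_,
    by simp, by simp⟩
  · simpa using h0 α 0
  · have := (h0 α 0).mul_const (Complex.I * β)
    simp only [zero_add, mul_zero, Complex.exp_zero, one_mul] at this
    convert! this using 1
    linear_combination (-(α : ℂ) * β) * Complex.I_mul_I

lemma exists_of_contDiff {g : ℝ × ℝ → ℂ} (hg : ContDiff ℝ 2 g) :
    ∃ c cs ct cst, HasJet (fun s t => g (s, t)) c cs ct cst := by
  have hd : Differentiable ℝ g := hg.differentiable (by norm_num)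
  have hfd : Differentiable ℝ (fderiv ℝ g) :=
    (hg.fderiv_right (m := 1) (by norm_num)).differentiable (by norm_num)
  have hpath : ∀ t : ℝ, HasDerivAt (fun s : ℝ => (s, t)) ((1 : ℝ), (0 : ℝ)) 0 := fun t =>
    (hasDerivAt_id 0).prodMk (hasDerivAt_const _ _)
  have hpath' : ∀ s : ℝ, HasDerivAt (fun t : ℝ => (s, t)) ((0 : ℝ), (1 : ℝ)) 0 := fun s =>
    (hasDerivAt_const _ _).prodMk (hasDerivAt_id 0)
  have h1 := (HasFDerivAt.comp_hasDerivAt (f := fun s : ℝ => (s, (0 : ℝ))) (0 : ℝ)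
    (hfd (0, 0)).hasFDerivAt (hpath 0)).clm_apply (hasDerivAt_const (0 : ℝ) ((0 : ℝ), (1 : ℝ)))
  exact ⟨_, _, _, _, fun s => fderiv ℝ g (s, 0) (0, 1),
    fun s => HasFDerivAt.comp_hasDerivAt (f := fun t : ℝ => (s, t)) (0 : ℝ)
      (hd (s, 0)).hasFDerivAt (hpath' s),
    HasFDerivAt.comp_hasDerivAt (f := fun s : ℝ => (s, (0 : ℝ))) (0 : ℝ)
      (hd (0, 0)).hasFDerivAt (hpath 0), h1, rfl, rfl⟩

end HasJet

variable {ι : Type*} [Fintype ι] [DecidableEq ι]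

lemma ContDiff.matrix_det {X : Type*} [NormedAddCommGroup X] [NormedSpace ℝ X] {n : WithTop ℕ∞}
    {M : X → Matrix ι ι ℂ} (h : ∀ i j, ContDiff ℝ n fun x => M x i j) :
    ContDiff ℝ n fun x => (M x).det := by
  simp only [Matrix.det_apply]
  exact ContDiff.sum fun σ _ => (contDiff_prod fun i _ => h _ _).const_smul _

lemma ContDiff.matrix_adjugate {X : Type*} [NormedAddCommGroup X] [NormedSpace ℝ X]
    {n : WithTop ℕ∞} {M : X → Matrix ι ι ℂ} (h : ∀ i j, ContDiff ℝ n fun x => M x i j) (i j : ι) :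
    ContDiff ℝ n fun x => (M x).adjugate i j := by
  simp only [Matrix.adjugate_apply]
  refine ContDiff.matrix_det fun k l => ?_
  by_cases hk : k = j
  · subst hk; simpa using contDiff_const
  · simpa [Matrix.updateRow_apply, hk] using h k l

lemma Matrix.det_smul_eq_adjugate_mulVec (A : Matrix ι ι ℂ) (v : ι → ℂ) (k : ι) :
    A.det * v k = ∑ l, A.adjugate k l * (A *ᵥ v) l := by
  have : A.adjugate *ᵥ (A *ᵥ v) = A.det • v := by
    rw [Matrix.mulVec_mulVec, Matrix.adjugate_mul, Matrix.smul_mulVec, Matrix.one_mulVec]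
  have := congrFun this k
  simpa [Matrix.mulVec, dotProduct] using this.symm

/-- First order perturbation of a determinant with a kernel vector. -/
lemma deriv_det_mul {M : ℝ → Matrix ι ι ℂ} (h : ∀ i j, ContDiff ℝ 1 fun t => M t i j)
    {a φ : ι → ℂ} (ha : M 0 *ᵥ a = 0) (hφ : ∀ l, HasDerivAt (fun t => (M t *ᵥ a) l) (φ l) 0)
    (k : ι) : deriv (fun t => (M t).det) 0 * a k = ∑ l, (M 0).adjugate k l * φ l := by
  have h1 : HasDerivAt (fun t => (M t).det) (deriv (fun t => (M t).det) 0) 0 :=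
    (((ContDiff.matrix_det h).differentiable (by norm_num)) 0).hasDerivAt
  have h2 : ∀ l, HasDerivAt (fun t => (M t).adjugate k l)
      (deriv (fun t => (M t).adjugate k l) 0) 0 := fun l =>
    (((ContDiff.matrix_adjugate h k l).differentiable (by norm_num)) 0).hasDerivAt
  have h3 := h1.mul_const (a k)
  have h4 := HasDerivAt.fun_sum (u := Finset.univ) fun l _ => (h2 l).mul (hφ l)
  have : (fun t => (M t).det * a k) =
      fun t => ∑ l, (M t).adjugate k l * (M t *ᵥ a) l :=
    funext fun t => Matrix.det_smul_eq_adjugate_mulVec _ _ _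
  rw [this] at h3
  rw [h3.unique h4]
  simp [ha]

/-- Second order perturbation of a determinant with a kernel vector. -/
lemma deriv_deriv_det_mul {M : ℝ → ℝ → Matrix ι ι ℂ}
    (h : ∀ i j, ContDiff ℝ 2 fun p : ℝ × ℝ => M p.1 p.2 i j)
    {v : ι → ℝ → ℝ → ℂ} {a b b' m : ι → ℂ} (hv : ∀ l, HasJet (v l) (a l) (b l) (b' l) 0)
    (hm : ∀ l, HasJet (fun s t => (M s t *ᵥ fun l => v l s t) l) 0 0 0 (m l)) {k : ι}
    (hk : a k ≠ 0) : deriv (fun s => deriv (fun t => (M s t).det) 0) 0 * a k =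
      ∑ l, (M 0 0).adjugate k l * m l := by
  obtain ⟨c, cs, ct, cst, hdet⟩ := HasJet.exists_of_contDiff (ContDiff.matrix_det h)
  have hadj := fun l => HasJet.exists_of_contDiff (ContDiff.matrix_adjugate h k l)
  choose d ds dt dst hadj using hadj
  have h1 := hdet.mul (hv k)
  have h2 := HasJet.sum Finset.univ fun l _ => (hadj l).mul (hm l)
  have : (fun s t => (M s t).det * v k s t) = fun s t => ∑ l, (M s t).adjugate k l *
      (M s t *ᵥ fun l => v l s t) l :=
    funext fun s => funext fun t =>
      Matrix.det_smul_eq_adjugate_mulVec (M s t) (fun l => v l s t) k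
  simp only at h1
  rw [this] at h1
  obtain ⟨e0, e1, e2, e3⟩ := h1.unique h2
  have hd : ∀ l, d l = (M 0 0).adjugate k l := fun l => by
    obtain ⟨_, _, _, _, h4, _⟩ := hadj l
    exact h4.symm
  -- The corrected vector makes `M v` vanish to first order, so the right-hand side has only a mixed
  -- coefficient. Comparing coefficients and dividing by `a k`, the value and the first derivatives
  -- of the determinant vanish one after the other.
  simp only [mul_zero, add_zero, Finset.sum_const_zero, zero_add] at e0 e1 e2 e3
  have hc : c = 0 := by simpa [hk] using e0
  have hcs : cs = 0 := by simpa [hk, hc] using e1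
  have hct : ct = 0 := by simpa [hk, hc] using e2
  rw [hdet.deriv_deriv]
  simp only [hcs, hct, zero_mul, add_zero] at e3
  rw [e3]
  simp only [hd]

end Jets


/-! ### Gradient and flux Hessian of the secular function. -/

namespace QuantumGraph

open scoped ComplexConjugate
open Matrix

variable {V E : Type*} {G : QuantumGraph V E} [Fintype E] [DecidableEq V] [DecidableEq E]

variable (G) in
/-- The matrix whose determinant is the secular function. -/
noncomputable def magSecMatrix (x a : E → ℝ) : Matrix (E × Bool) (E × Bool) ℂ :=
  1 - magneticMatrix a * phaseMatrix x * G.scattering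

lemma magSecMatrix_zero (x : E → ℝ) : G.magSecMatrix x 0 = G.secMatrix x := by
  have : magneticMatrix (0 : E → ℝ) = 1 := by simp [magneticMatrix]
  rw [magSecMatrix, secMatrix, this, one_mul]

lemma magSecMatrix_apply (x a : E → ℝ) (d d' : E × Bool) : G.magSecMatrix x a d d' =
    (1 : Matrix (E × Bool) (E × Bool) ℂ) d d' -
      Complex.exp (Complex.I * (if d.2 then (a d.1 : ℂ) else -(a d.1 : ℂ))) *
      Complex.exp (Complex.I * (x d.1 : ℂ)) * G.scattering d d' := by
  rw [magSecMatrix, magneticMatrix, phaseMatrix, Matrix.diagonal_mul_diagonal, Matrix.sub_apply,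
    Matrix.diagonal_mul]

lemma magSecMatrix_mulVec (x a : E → ℝ) (v : E × Bool → ℂ) (d : E × Bool) :
    (G.magSecMatrix x a *ᵥ v) d = v d -
      Complex.exp (Complex.I * (if d.2 then (a d.1 : ℂ) else -(a d.1 : ℂ))) *
      Complex.exp (Complex.I * (x d.1 : ℂ)) * (G.scattering *ᵥ v) d := by
  rw [magSecMatrix, magneticMatrix, phaseMatrix, Matrix.diagonal_mul_diagonal, Matrix.sub_mulVec,
    Matrix.one_mulVec, Pi.sub_apply, ← Matrix.mulVec_mulVec, Matrix.mulVec_diagonal]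

lemma contDiff_magSecMatrix {X : Type*} [NormedAddCommGroup X] [NormedSpace ℝ X]
    {n : WithTop ℕ∞} {x a : X → E → ℝ} (hx : ∀ e, ContDiff ℝ n fun p => x p e)
    (ha : ∀ e, ContDiff ℝ n fun p => a p e) (d d' : E × Bool) :
    ContDiff ℝ n fun p => G.magSecMatrix (x p) (a p) d d' := by
  simp only [magSecMatrix_apply]
  have h1 : ∀ e, ContDiff ℝ n fun p => ((x p e : ℝ) : ℂ) := fun e =>
    Complex.ofRealCLM.contDiff.comp (hx e)
  have h2 : ∀ e, ContDiff ℝ n fun p => ((a p e : ℝ) : ℂ) := fun e =>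
    Complex.ofRealCLM.contDiff.comp (ha e)
  refine contDiff_const.sub (((ContDiff.cexp (contDiff_const.mul ?_)).mul
    (ContDiff.cexp (contDiff_const.mul (h1 _)))).mul contDiff_const)
  by_cases h : d.2
  · simpa [h] using h2 _
  · simpa [h] using (h2 _).neg

lemma contDiff_secular {X : Type*} [NormedAddCommGroup X] [NormedSpace ℝ X]
    {n : WithTop ℕ∞} {x a : X → E → ℝ} (hx : ∀ e, ContDiff ℝ n fun p => x p e)
    (ha : ∀ e, ContDiff ℝ n fun p => a p e) : ContDiff ℝ n fun p => G.secular (x p) (a p) :=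
  ContDiff.matrix_det (contDiff_magSecMatrix hx ha)

/-! ### The gradient -/

/-- Kernel vectors satisfy `S a = e^{-ix} a`, so differentiating the phase of `e` in `(1 - e^{ix} S)
a` produces `-i a` on the two directions of `e`. -/
lemma gradSecular_mul {x : E → ℝ} {a : E × Bool → ℂ} (ha : G.secMatrix x *ᵥ a = 0) (e : E)
    (k : E × Bool) : G.gradSecular x e * a k = ∑ l, (G.secMatrix x).adjugate k l *
      (if l.1 = e then -Complex.I * a l else 0) := by
  have hx : ∀ e', ContDiff ℝ 1 fun t : ℝ => (x + t • (Pi.single e 1 : E → ℝ)) e' := fun e' => by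
    simp only [Pi.add_apply, Pi.smul_apply, smul_eq_mul]
    exact contDiff_const.add (contDiff_id.mul contDiff_const)
  have h := deriv_det_mul (M := fun t : ℝ => G.magSecMatrix (x + t • (Pi.single e 1 : E → ℝ)) 0)
    (a := a) (φ := fun l => if l.1 = e then -Complex.I * a l else 0)
    (contDiff_magSecMatrix hx fun _ => contDiff_const) (by simpa [magSecMatrix_zero] using ha) ?_ k
  · have h0 : G.gradSecular x e = deriv (fun t : ℝ =>
        (G.magSecMatrix (x + t • (Pi.single e 1 : E → ℝ)) 0).det) 0 := rfl
    rw [h0, h]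
    simp [magSecMatrix_zero]
  · intro l
    simp only [magSecMatrix_zero, secMatrix_mulVec, scattering_of_mem_ker ha]
    have h0 : HasDerivAt (fun t : ℝ => Complex.I * (((x + t • (Pi.single e 1 : E → ℝ)) l.1 : ℝ) : ℂ))
        (Complex.I * (if l.1 = e then 1 else 0)) 0 := by
      have h1 : HasDerivAt (fun t : ℝ => (t : ℂ)) 1 0 := Complex.ofRealCLM.hasDerivAt
      have h2 := ((h1.mul_const ((Pi.single e 1 : E → ℝ) l.1 : ℂ)).const_add
        (x l.1 : ℂ)).const_mul Complex.I
      convert! h2 using 1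
      · ext t; simp
      · by_cases hl : l.1 = e
        · rw [hl]; simp
        · simp [hl]
    have h3 := ((h0.cexp).mul_const (Complex.exp (-(Complex.I * (x l.1 : ℂ))) * a l)).const_sub (a l)
    convert! h3 using 1
    simp only [zero_smul, add_zero]
    split_ifs with hl
    · have : Complex.exp (Complex.I * (x l.1 : ℂ)) * Complex.exp (-(Complex.I * (x l.1 : ℂ))) = 1 := by
        rw [← Complex.exp_add]; simp
      linear_combination (Complex.I * a l) * this
    · simp

variable {x : E → ℝ} {a : E × Bool → ℂ}

lemma sum_edge (e : E) (f : E × Bool → ℂ) :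
    ∑ l, (if l.1 = e then f l else 0) = f (e, true) + f (e, false) := by
  rw [Fintype.sum_prod_type]
  simp [Finset.sum_add_distrib]

/-- Both directions of `e` contribute equally because their amplitudes have equal moduli. The
gradient is thus a complex constant times the real vector `|a_e|²`, which flips do not alter. -/
lemma GenericWave.gradSecular_apply [Nonempty E] (h : G.GenericWave x a) {κ : ℂ}
    (hκ : ∀ d d', (G.secMatrix x).adjugate d d' = κ * a d * conj (a d')) (e : E) :
    G.gradSecular x e = -2 * Complex.I * κ * ((‖a (e, true)‖ ^ 2 : ℝ) : ℂ) := by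
  have h1 := gradSecular_mul h.mulVec e (e, true)
  have h2 : ∀ l, (G.secMatrix x).adjugate (e, true) l * (if l.1 = e then -Complex.I * a l else 0)
      = if l.1 = e then (-Complex.I * κ * a (e, true)) * ((‖a l‖ ^ 2 : ℝ) : ℂ) else 0 := by
    intro l
    split_ifs
    · rw [hκ]
      push_cast
      rw [← Complex.conj_mul']
      ring
    · simp
  rw [Finset.sum_congr rfl fun l _ => h2 l, sum_edge] at h1
  have h3 : ‖a (e, false)‖ = ‖a (e, true)‖ := h.edge.norm_rev (e, true)
  refine mul_right_cancel₀ (h.ne_zero (e, true)) ?_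
  rw [h1, h3]
  ring

/-! ### The Hessian -/

/-- The sign of a unit flux along `i`, as a function on the directed edges. -/
noncomputable def fluxSign (i : E) (d : E × Bool) : ℝ :=
  if d.1 = i then (if d.2 then 1 else -1) else 0

lemma fluxSign_rev (i : E) (d : E × Bool) : fluxSign i (rev d) = -fluxSign i d := by
  rcases d with ⟨e, b⟩
  cases b <;> by_cases h : e = i <;> simp [fluxSign, rev, h]

lemma sum_fluxSign_mul (i : E) (f : E × Bool → ℂ) :
    ∑ l, (fluxSign i l : ℂ) * f l = f (i, true) - f (i, false) := by
  have : ∀ l : E × Bool, (fluxSign i l : ℂ) * f l =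
      if l.1 = i then (if l.2 then 1 else -1) * f l else 0 := by
    intro l
    unfold fluxSign
    by_cases h : l.1 = i <;> by_cases h2 : l.2 <;> simp [h, h2]
  rw [Finset.sum_congr rfl fun l _ => this l, sum_edge i fun l => (if l.2 then 1 else -1) * f l]
  simp [sub_eq_add_neg]

lemma fluxPotential_apply {C : Finset E} (i j : C) (s t : ℝ) (d : E × Bool) :
    (if d.2 then ((fluxPotential C ((0 + s • Pi.single i 1) + t • Pi.single j 1) d.1 : ℝ) : ℂ)
      else -((fluxPotential C ((0 + s • Pi.single i 1) + t • Pi.single j 1) d.1 : ℝ) : ℂ)) =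
      s * (fluxSign i.1 d : ℝ) + t * (fluxSign j.1 d : ℝ) := by
  unfold fluxPotential fluxSign
  by_cases h : d.1 ∈ C
  · have hs : ∀ k : C, ((Pi.single k 1 : C → ℝ) ⟨d.1, h⟩ : ℝ) = if d.1 = k.1 then 1 else 0 := by
      intro k
      by_cases hk : d.1 = k.1
      · have : (⟨d.1, h⟩ : C) = k := Subtype.ext hk
        rw [this]; simp [hk]
      · have : (⟨d.1, h⟩ : C) ≠ k := fun h' => hk (congrArg Subtype.val h')
        simp [this, hk]
    simp only [h, dif_pos, Pi.add_apply, Pi.smul_apply, zero_add, hs, smul_eq_mul]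
    split_ifs <;> push_cast <;> ring
  · have h1 : d.1 ≠ i.1 := fun h' => h (h' ▸ i.2)
    have h2 : d.1 ≠ j.1 := fun h' => h (h' ▸ j.2)
    simp [h, h1, h2]

/-- The Hessian in terms of first order corrections of the kernel vector. -/
lemma fluxHessian_mul {C : Finset E} (i j : C) (ha : G.secMatrix x *ᵥ a = 0)
    {b b' : E × Bool → ℂ}
    (hb : ∀ d, (G.secMatrix x *ᵥ b) d = Complex.I * fluxSign i.1 d * a d)
    (hb' : ∀ d, (G.secMatrix x *ᵥ b') d = Complex.I * fluxSign j.1 d * a d)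
    {k : E × Bool} (hk : a k ≠ 0) :
    G.fluxHessian C x i j * a k = ∑ l, (G.secMatrix x).adjugate k l *
      (-(fluxSign i.1 l * fluxSign j.1 l * a l) - Complex.I * fluxSign i.1 l * b' l
        - Complex.I * fluxSign j.1 l * b l) := by
  have hα : ∀ e, ContDiff ℝ 2 fun p : ℝ × ℝ =>
      fluxPotential C ((0 + p.1 • Pi.single i 1) + p.2 • Pi.single j 1) e := by
    intro e
    unfold fluxPotential
    by_cases h : e ∈ C
    · simp only [h, dif_pos, Pi.add_apply, Pi.smul_apply, smul_eq_mul]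
      exact (contDiff_const.add (contDiff_fst.mul contDiff_const)).add
        (contDiff_snd.mul contDiff_const)
    · simp only [h, dif_neg, not_false_eq_true]; exact contDiff_const
  have h := deriv_deriv_det_mul (M := fun s t => G.magSecMatrix x
    (fluxPotential C ((0 + s • Pi.single i 1) + t • Pi.single j 1)))
    (v := fun l s t => a l + s * b l + t * b' l) (a := a) (b := b) (b' := b')
    (m := fun l => -(fluxSign i.1 l * fluxSign j.1 l * a l) - Complex.I * fluxSign i.1 l * b' l
        - Complex.I * fluxSign j.1 l * b l)
    (contDiff_magSecMatrix (fun _ => contDiff_const) hα)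
    (fun l => HasJet.affine _ _ _) ?_ hk
  · have h0 : fluxPotential C ((0 + (0 : ℝ) • Pi.single i 1) + (0 : ℝ) • Pi.single j 1) = 0 := by
      ext e; simp [fluxPotential]
    rw [h0, magSecMatrix_zero] at h
    exact h
  · intro l
    have hS : ∀ s t : ℝ, Complex.exp (Complex.I * (x l.1 : ℂ)) *
        (G.scattering *ᵥ fun l => a l + s * b l + t * b' l) l =
        a l + s * (b l - Complex.I * fluxSign i.1 l * a l)
          + t * (b' l - Complex.I * fluxSign j.1 l * a l) := by
      intro s t
      have h1 : (fun l => a l + s * b l + t * b' l) = a + (s : ℂ) • b + (t : ℂ) • b' := by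
        ext l; simp
      have e0 := congrFun ha l
      have e1 := hb l
      have e2 := hb' l
      rw [secMatrix_mulVec] at e0 e1 e2
      rw [h1, Matrix.mulVec_add, Matrix.mulVec_add, Matrix.mulVec_smul, Matrix.mulVec_smul]
      simp only [Pi.add_apply, Pi.smul_apply, smul_eq_mul, Pi.zero_apply] at e0 ⊢
      linear_combination -e0 - (s : ℂ) * e1 - (t : ℂ) * e2
    have h1 := (HasJet.affine (a l) (b l) (b' l)).sub
      ((HasJet.exp (fluxSign i.1 l) (fluxSign j.1 l)).mul
        (HasJet.affine (a l) (b l - Complex.I * fluxSign i.1 l * a l)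
          (b' l - Complex.I * fluxSign j.1 l * a l)))
    convert! h1 using 1
    · ext s t
      rw [magSecMatrix_mulVec, fluxPotential_apply, mul_assoc, hS]
    · ring
    · ring
    · ring
    · linear_combination (-2 * fluxSign i.1 l * fluxSign j.1 l * a l) * Complex.I_mul_I

/-- `q` is the first order response of the real wave `a` to a unit flux through `i`, in a
symmetric gauge. -/
structure FluxResponse (G : QuantumGraph V E) (x : E → ℝ) (a : E × Bool → ℂ) (i : E)
    (q : E × Bool → ℂ) : Prop where
  edge : EdgeCond x q
  vertex : G.VertexCond fun d => q d + fluxSign i d / 2 * a d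

lemma exp_neg_mul_exp (t : ℝ) : Complex.exp (-(Complex.I * (t : ℂ))) *
    Complex.exp (Complex.I * (t : ℂ)) = 1 := by
  rw [← Complex.exp_add]; simp

/-- Fredholm alternative: the source `fluxSign i · a` is orthogonal to the left kernel, since the
two directions of `i` carry opposite signs and equal moduli. Averaging a solution with its time
reversal makes it real. -/
lemma GenericWave.exists_fluxResponse [Nonempty E] (hD : G.DirichletLeaf) (h : G.GenericWave x a)
    (i : E) : ∃ q, G.FluxResponse x a i q := by
  have hnorm : ∀ d, conj (a (rev d)) * a (rev d) = conj (a d) * a d := fun d => by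
    rw [h.edge.current h.edge d]; simp [mul_comm]
  obtain ⟨e⟩ := ‹Nonempty E›
  obtain ⟨g, hg⟩ := Matrix.exists_mulVec_eq_of_dotProduct_eq_zero (A := G.secMatrix x) (a := a)
    (w := fun d => conj (a d)) (y := fun d => fluxSign i d * a d)
    (Function.ne_iff.2 ⟨(e, true), by simpa using h.ne_zero _⟩)
    (conj_vecMul_secMatrix h.vertex h.edge) (fun b hb => h.unique_complex hD hb) (by
      have : ∀ d, conj (a d) * (fluxSign i d * a d) = (fluxSign i d : ℂ) * (conj (a d) * a d) :=
        fun d => by ring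
      simp only [dotProduct, this]
      rw [sum_fluxSign_mul i fun d => conj (a d) * a d, ← hnorm (i, true)]
      simp [rev])
  let g' : E × Bool → ℂ := timeRev x fun d => g d - fluxSign i d * a d
  have hg' : ∀ d, g' d = Complex.exp (Complex.I * (x d.1 : ℂ)) *
      conj (g (rev d) - fluxSign i (rev d) * a (rev d)) := fun d => rfl
  have h1 : ∀ d, (G.scattering *ᵥ g) (rev d) = conj (g' d) := by
    intro d
    have e1 := congrFun hg (rev d)
    rw [secMatrix_mulVec, rev_fst] at e1
    have e2 := exp_neg_mul_exp (x d.1)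
    have e3 := conj_exp_I_mul (x d.1)
    have e4 : conj (Complex.exp (Complex.I * (x d.1 : ℂ))) =
        Complex.exp (-(Complex.I * (x d.1 : ℂ))) := by
      rw [← Complex.exp_conj]; simp
    rw [hg' d, map_mul, Complex.conj_conj, e4]
    linear_combination (-(G.scattering *ᵥ g) (rev d)) * e2 -
      Complex.exp (-(Complex.I * (x d.1 : ℂ))) * e1
  have h2 : ∀ d, (G.scattering *ᵥ g') (rev d) = conj (g d) := by
    intro d
    have : g' = fun c => (G.scattering *ᵥ fun c' => conj (g c')) (rev c) := by
      ext c
      rw [← conj_scattering_mulVec, h1 c, Complex.conj_conj]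
    rw [this, scattering_involutive hD]
  -- The flux is split evenly between the two ends of `i`: subtracting half of the source from the
  -- average restores the unperturbed edge condition and moves the flux to the vertex condition.
  refine ⟨fun d => (1 / 2 : ℂ) * (g d + g' d) - fluxSign i d / 2 * a d, ?_, ?_⟩
  · intro d
    have e2 : g d = Complex.exp (Complex.I * (x d.1 : ℂ)) * conj (g' (rev d))
        + fluxSign i d * a d := by
      have := congrFun (timeRev_timeRev x fun d => g d - fluxSign i d * a d) d
      rw [timeRev] at this
      linear_combination -this
    have e3 := hg' d
    simp only [map_sub, map_mul, map_add, map_div₀, Complex.conj_ofReal, Complex.conj_ofNat,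
      map_one, fluxSign_rev, Complex.ofReal_neg, map_neg] at e3 ⊢
    linear_combination (1 / 2) * e2 + (1 / 2) * e3
  · intro d
    have : (fun d => (1 / 2 : ℂ) * (g d + g' d) - fluxSign i d / 2 * a d + fluxSign i d / 2 * a d)
        = (1 / 2 : ℂ) • (g + g') := by
      ext d; simp
    rw [this, Matrix.mulVec_smul, Matrix.mulVec_add]
    simp only [Pi.smul_apply, Pi.add_apply, smul_eq_mul, h1, h2, map_mul, map_add, map_div₀,
      map_one, Complex.conj_ofNat]
    ring

lemma FluxResponse.secMatrix_mulVec {i : E} {q : E × Bool → ℂ} (he : EdgeCond x a)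
    (h : G.FluxResponse x a i q) (d : E × Bool) :
    (G.secMatrix x *ᵥ fun d => Complex.I * (q d + fluxSign i d / 2 * a d)) d =
      Complex.I * fluxSign i d * a d := by
  have h1 : (fun d => Complex.I * (q d + fluxSign i d / 2 * a d)) =
      Complex.I • fun d => q d + fluxSign i d / 2 * a d := rfl
  have h2 := h.vertex (rev d)
  rw [rev_rev] at h2
  rw [QuantumGraph.secMatrix_mulVec, h1, Matrix.mulVec_smul, Pi.smul_apply, h2]
  have e1 := he d
  have e2 := h.edge d
  simp only [smul_eq_mul, map_mul, map_add, map_div₀, Complex.conj_ofReal,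
    Complex.conj_ofNat, fluxSign_rev, Complex.ofReal_neg, map_neg]
  linear_combination Complex.I * e2 - Complex.I * (fluxSign i d / 2) * e1

/-- The current through the edge `i` of the response `q`. -/
def current (a q : E × Bool → ℂ) (i : E) : ℝ := (conj (a (i, true)) * q (i, true)).im

lemma sum_fluxSign_current (i : E) {q : E × Bool → ℂ} (he : EdgeCond x a) (hq : EdgeCond x q) :
    ∑ l, (fluxSign i l : ℂ) * (conj (a l) * q l) = 2 * Complex.I * current a q i := by
  rw [sum_fluxSign_mul i fun l => conj (a l) * q l, he.current hq (i, false), rev_mk]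
  have := Complex.sub_conj (conj (a (i, true)) * q (i, true))
  simp only [Bool.not_false]
  rw [this, current]
  push_cast
  ring

lemma sum_incoming (f : E × Bool → ℝ) [Fintype V] : ∑ v, ∑ d ∈ G.incoming v, f d = ∑ d, f d := by
  unfold incoming
  exact Finset.sum_fiberwise _ _ _

/-- Reciprocity. The Wronskian of the two shifted responses sums to zero at every vertex, and that
of the unshifted ones cancels along every edge. What remains is the difference of the two cross
terms, that is, of the two currents. -/
lemma FluxResponse.current_symm [Fintype V] (hD : G.DirichletLeaf) {i j : E}
    {q q' : E × Bool → ℂ} (he : EdgeCond x a)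
    (h : G.FluxResponse x a i q) (h' : G.FluxResponse x a j q') :
    current a q' i = current a q j := by
  have h0 : ∑ d, (conj (q d + fluxSign i d / 2 * a d) *
      (q' d + fluxSign j d / 2 * a d)).im = 0 := by
    rw [← sum_incoming (G := G)]
    exact Finset.sum_eq_zero fun v _ => VertexCond.sum_current hD h.vertex h'.vertex v
  have h1 : ∑ d, (conj (q d) * q' d).im = 0 := by
    have : ∀ d, (conj (q (rev d)) * q' (rev d)).im = -(conj (q d) * q' d).im := fun d => by
      rw [h.edge.current h'.edge d, Complex.conj_im, neg_neg]
    have h2 := sum_rev fun d => (conj (q d) * q' d).im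
    simp only [this, Finset.sum_neg_distrib] at h2
    linarith
  have h2 : ∀ d, (conj (q d + fluxSign i d / 2 * a d) * (q' d + fluxSign j d / 2 * a d)).im =
      (conj (q d) * q' d).im + (1 / 2) * ((fluxSign i d : ℂ) * (conj (a d) * q' d)).im
        - (1 / 2) * ((fluxSign j d : ℂ) * (conj (a d) * q d)).im := by
    intro d
    have : ∀ s : ℝ, (s : ℂ) / 2 = ((s / 2 : ℝ) : ℂ) := fun s => by push_cast; rfl
    simp only [this, Complex.mul_im, Complex.add_re, Complex.add_im, Complex.conj_re,
      Complex.conj_im, Complex.mul_re, Complex.ofReal_re, Complex.ofReal_im, map_add, map_mul]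
    ring
  have h3 : ∀ f : E × Bool → ℂ, ∑ d, (f d).im = (∑ d, f d).im := fun f =>
    (Complex.im_sum _ _).symm
  simp only [h2, Finset.sum_add_distrib, Finset.sum_sub_distrib, ← Finset.mul_sum] at h0
  rw [h1, h3 fun d => fluxSign i d * (conj (a d) * q' d),
    h3 fun d => fluxSign j d * (conj (a d) * q d)] at h0
  rw [sum_fluxSign_current i he h'.edge, sum_fluxSign_current j he h.edge] at h0
  simp at h0
  linarith

/-- With the first order corrections `i (q + fluxSign/2 · a)` the terms containing the product of
the two signs cancel. Two current sums remain, equal by reciprocity, each contributing `2iκ` times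
the current. -/
lemma GenericWave.fluxHessian_apply [Fintype V] [Nonempty E] (hD : G.DirichletLeaf)
    (h : G.GenericWave x a) {κ : ℂ}
    (hκ : ∀ d d', (G.secMatrix x).adjugate d d' = κ * a d * conj (a d')) {C : Finset E} (i j : C)
    {q : E × Bool → ℂ} (hq : G.FluxResponse x a j.1 q) :
    G.fluxHessian C x i j = 4 * Complex.I * κ * current a q i.1 := by
  obtain ⟨q', hq'⟩ := h.exists_fluxResponse hD i.1
  have hk := h.ne_zero (i.1, true)
  have h1 := fluxHessian_mul i j h.mulVec (hq'.secMatrix_mulVec h.edge)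
    (hq.secMatrix_mulVec h.edge) hk
  have h2 : ∀ l, (G.secMatrix x).adjugate (i.1, true) l *
      (-(fluxSign i.1 l * fluxSign j.1 l * a l) -
        Complex.I * fluxSign i.1 l * (Complex.I * (q l + fluxSign j.1 l / 2 * a l))
        - Complex.I * fluxSign j.1 l * (Complex.I * (q' l + fluxSign i.1 l / 2 * a l))) =
      (κ * a (i.1, true)) * (fluxSign i.1 l * (conj (a l) * q l)) +
        (κ * a (i.1, true)) * (fluxSign j.1 l * (conj (a l) * q' l)) := by
    intro l
    rw [hκ]
    linear_combination (-κ * a (i.1, true) * conj (a l) *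
      (fluxSign i.1 l * q l + fluxSign j.1 l * q' l + fluxSign i.1 l * fluxSign j.1 l * a l)) *
        Complex.I_mul_I
  rw [Finset.sum_congr rfl fun l _ => h2 l, Finset.sum_add_distrib, ← Finset.mul_sum,
    ← Finset.mul_sum, sum_fluxSign_current i.1 h.edge hq.edge,
    sum_fluxSign_current j.1 h.edge hq'.edge, ← hq'.current_symm hD h.edge hq] at h1
  refine mul_right_cancel₀ hk ?_
  rw [h1]
  ring

variable (G) in
/-- The normalized Hessian, whose Morse indices are the surpluses. -/
noncomputable def surplusMatrix (C : Finset E) (x : E → ℝ) : Matrix C C ℂ :=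
  -((G.gradDotLen x)⁻¹ • G.fluxHessian C x)

variable (G) in
/-- The sum of the squared amplitudes weighted by the lengths. -/
noncomputable def weight (a : E × Bool → ℂ) : ℝ := ∑ e, ‖a (e, true)‖ ^ 2 * G.len e

lemma GenericWave.weight_pos [Nonempty E] (h : G.GenericWave x a) : 0 < G.weight a :=
  Finset.sum_pos (fun e _ => mul_pos (pow_pos (norm_pos_iff.2 (h.ne_zero _)) 2) (G.len_pos e))
    Finset.univ_nonempty

lemma GenericWave.gradDotLen_eq [Nonempty E] (h : G.GenericWave x a) {κ : ℂ}
    (hκ : ∀ d d', (G.secMatrix x).adjugate d d' = κ * a d * conj (a d')) :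
    G.gradDotLen x = -2 * Complex.I * κ * G.weight a := by
  simp only [gradDotLen, h.gradSecular_apply hκ, weight, Complex.ofReal_sum, Finset.mul_sum]
  refine Finset.sum_congr rfl fun e _ => ?_
  push_cast
  ring

/-- The normalized Hessian is the real matrix of the currents of the responses. -/
lemma GenericWave.surplusMatrix_apply [Fintype V] [Nonempty E] (hD : G.DirichletLeaf)
    (h : G.GenericWave x a) {C : Finset E} (i j : C)
    {q : E × Bool → ℂ} (hq : G.FluxResponse x a j.1 q) :
    G.surplusMatrix C x i j = ((2 / G.weight a * current a q i.1 : ℝ) : ℂ) := by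
  obtain ⟨κ, hκ0, hκ⟩ := h.exists_adjugate hD
  have hw : (G.weight a : ℂ) ≠ 0 := by exact_mod_cast h.weight_pos.ne'
  rw [surplusMatrix, Matrix.neg_apply, Matrix.smul_apply, h.fluxHessian_apply hD hκ i j hq,
    h.gradDotLen_eq hκ]
  have hI := Complex.I_ne_zero
  push_cast
  simp only [smul_eq_mul]
  field_simp
  ring

end QuantumGraph


/-! ### Spanning trees, flows and nondegeneracy of the Hessian. -/

namespace QuantumGraph

open scoped ComplexConjugate
open Matrix

variable {V E : Type*} {G : QuantumGraph V E}

/-! ### Connectedness -/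

/-- The working form of connectedness: a function which does not change across the edges of `A` is
constant. `connectedOn_of_const` is the converse. -/
lemma ConnectedOn.const {W : Set V} {A : Set E} (h : G.ConnectedOn W A) {α : Type*} {f : V → α}
    (hf : ∀ e ∈ A, G.init e ∈ W → G.term e ∈ W → f (G.init e) = f (G.term e)) {u v : V}
    (hu : u ∈ W) (hv : v ∈ W) : f u = f v := by
  obtain ⟨p⟩ := h.preconnected ⟨u, hu⟩ ⟨v, hv⟩
  suffices ∀ a b : W, (SimpleGraph.fromRel (fun u v : W => ∃ e ∈ A, G.init e = u ∧
      G.term e = v)).Walk a b → f a = f b from this _ _ p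
  intro a b p
  induction p with
  | nil => rfl
  | cons hadj _ ih =>
    rw [← ih]
    rw [SimpleGraph.fromRel_adj] at hadj
    rcases hadj.2 with ⟨e, he, h1, h2⟩ | ⟨e, he, h1, h2⟩
    · rw [← h1, ← h2]; exact hf e he (h1 ▸ Subtype.mem _) (h2 ▸ Subtype.mem _)
    · rw [← h1, ← h2]; exact (hf e he (h1 ▸ Subtype.mem _) (h2 ▸ Subtype.mem _)).symm

lemma connectedOn_of_const {W : Set V} {A : Set E} (hW : W.Nonempty)
    (h : ∀ P : V → Prop, (∀ e ∈ A, G.init e ∈ W → G.term e ∈ W → (P (G.init e) ↔ P (G.term e))) →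
      ∀ u ∈ W, ∀ v ∈ W, P u → P v) : G.ConnectedOn W A := by
  have : Nonempty W := hW.to_subtype
  refine SimpleGraph.Connected.mk fun u v => ?_
  let K := SimpleGraph.fromRel (fun u v : W => ∃ e ∈ A, G.init e = u ∧ G.term e = v)
  have := h (fun w => ∃ hw : w ∈ W, K.Reachable u ⟨w, hw⟩) ?_ u.1 u.2 v.1 v.2
    ⟨u.2, SimpleGraph.Reachable.refl _⟩
  · exact this.2
  · intro e he h1 h2
    have hadj : K.Reachable ⟨G.init e, h1⟩ ⟨G.term e, h2⟩ := by
      by_cases heq : (⟨G.init e, h1⟩ : W) = ⟨G.term e, h2⟩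
      · rw [heq]
      · exact SimpleGraph.Adj.reachable
          ((SimpleGraph.fromRel_adj _ _ _).2 ⟨heq, Or.inl ⟨e, he, rfl, rfl⟩⟩)
    exact ⟨fun ⟨_, h⟩ => ⟨h2, h.trans hadj⟩, fun ⟨_, h⟩ => ⟨h1, h.trans hadj.symm⟩⟩

lemma ConnectedOn.card_le {W : Finset V} {A : Finset E} (h : G.ConnectedOn W A) :
    W.card ≤ A.card + 1 := by
  classical
  have h1 := SimpleGraph.Connected.card_vert_le_card_edgeSet_add_one h
  have h2 : Nat.card (W : Set V) = W.card := by simp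
  rw [h2] at h1
  refine h1.trans (Nat.add_le_add_right ?_ 1)
  set K := SimpleGraph.fromRel (fun u v : (W : Set V) => ∃ e ∈ (A : Set E),
    G.init e = u ∧ G.term e = v)
  have h3 : ∀ s ∈ K.edgeSet, ∃ e ∈ A, Sym2.map Subtype.val s = s(G.init e, G.term e) := by
    intro s
    induction s using Sym2.ind with
    | _ u v =>
      intro hs
      rw [SimpleGraph.mem_edgeSet, SimpleGraph.fromRel_adj] at hs
      rcases hs.2 with ⟨e, he, h1, h2⟩ | ⟨e, he, h1, h2⟩
      · exact ⟨e, he, by simp [h1, h2]⟩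
      · exact ⟨e, he, by simp [h1, h2, Sym2.eq_swap]⟩
  choose φ hφ hφ' using h3
  have : Nat.card K.edgeSet ≤ Nat.card (A : Set E) := by
    refine Nat.card_le_card_of_injective (fun s : K.edgeSet => (⟨φ s.1 s.2, hφ s.1 s.2⟩ : (A : Set E))) ?_
    intro s t hst
    have h4 := hφ' s.1 s.2
    have h5 := hφ' t.1 t.2
    have h6 : φ s.1 s.2 = φ t.1 t.2 := congrArg Subtype.val hst
    rw [h6, ← h5] at h4
    exact Subtype.ext (Sym2.map.injective Subtype.val_injective h4)
  simpa using this

section Finite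

variable [Fintype E] [DecidableEq V] [DecidableEq E]

/-! ### Flows -/

variable (G) in
/-- A conserved antisymmetric flow on the directed edges. -/
structure IsFlow (J : E × Bool → ℝ) : Prop where
  antisymm : ∀ d, J (rev d) = -J d
  conserved : ∀ v, ∑ d ∈ G.incoming v, J d = 0

/-- A flow through a cut consisting of a single edge vanishes there. -/
lemma IsFlow.eq_zero_of_cut [Fintype V] {J : E × Bool → ℝ} (hJ : G.IsFlow J) {W : Set V} {e₀ : E}
    (h : ∀ e ≠ e₀, J (e, true) ≠ 0 → (G.init e ∈ W ↔ G.term e ∈ W))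
    (h₀ : ¬ (G.init e₀ ∈ W ↔ G.term e₀ ∈ W)) : J (e₀, true) = 0 := by
  classical
  -- Discrete divergence theorem for `W`: the contributions of edges with both ends in `W` cancel by
  -- antisymmetry, and only the crossing edge is left.
  have h1 : ∑ v, (if v ∈ W then ∑ d ∈ G.incoming v, J d else 0) = 0 :=
    Finset.sum_eq_zero fun v _ => by rw [hJ.conserved]; simp
  have h2 : ∑ v, (if v ∈ W then ∑ d ∈ G.incoming v, J d else 0) =
      ∑ d, if G.terminus d ∈ W then J d else 0 := by
    rw [← sum_incoming (G := G)]
    refine Finset.sum_congr rfl fun v _ => ?_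
    split_ifs with hv
    · exact Finset.sum_congr rfl fun d hd => by rw [mem_incoming] at hd; rw [hd, if_pos hv]
    · exact (Finset.sum_eq_zero fun d hd => by rw [mem_incoming] at hd; rw [hd, if_neg hv]).symm
  rw [h2, Fintype.sum_prod_type] at h1
  rw [Finset.sum_eq_single e₀ ?_ (by simp)] at h1
  · have h3 : J (e₀, false) = -J (e₀, true) := hJ.antisymm (e₀, true)
    simp only [Fintype.sum_bool, terminus_true, terminus_false, h3] at h1
    by_cases hi : G.init e₀ ∈ W <;> by_cases ht : G.term e₀ ∈ W <;> simp [hi, ht] at h1 h₀ ⊢ <;>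
      linarith
  · intro e _ he
    have h3 : J (e, false) = -J (e, true) := hJ.antisymm (e, true)
    simp only [Fintype.sum_bool, terminus_true, terminus_false, h3]
    by_cases h0 : J (e, true) = 0
    · simp [h0]
    · have := h e he h0
      by_cases hi : G.init e ∈ W
      · simp [hi, this.1 hi]
      · simp [hi, mt this.2 hi]

variable [Fintype V] {C : Finset E}

/-- The subtraction in `IsCut` is not truncated: the complement of `C` connects all vertices, so it
has at least `V - 1` edges. -/
lemma IsCut.card_add (hC : G.IsCut C) : C.card + Fintype.card V = Fintype.card E + 1 := by
  obtain ⟨h1, h2⟩ := hC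
  have h3 : G.ConnectedOn (Finset.univ : Finset V) ((Finset.univ \ C : Finset E) : Set E) := by
    convert! h2 using 1
    · simp
    · ext; simp
  have h4 := h3.card_le
  have h5 := Finset.card_le_univ (Finset.univ \ C)
  rw [Finset.card_univ] at h4
  omega

/-- The complement of `C` is connected with exactly `V - 1` edges, a spanning tree. Without `e₀`
there are too few edges to connect `V`, so `e₀` is a bridge of the tree and `W` is one of its sides.
-/
lemma IsCut.exists_cut (hC : G.IsCut C) {e₀ : E} (he₀ : e₀ ∉ C) :
    ∃ W : Set V, (∀ e ∉ C, e ≠ e₀ → (G.init e ∈ W ↔ G.term e ∈ W)) ∧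
      ¬ (G.init e₀ ∈ W ↔ G.term e₀ ∈ W) := by
  have hcard := hC.card_add
  by_contra! hcon
  have hne : (Set.univ : Set V).Nonempty := ⟨G.init e₀, trivial⟩
  have h1 : G.ConnectedOn Set.univ {e | e ∉ C ∧ e ≠ e₀} := by
    refine connectedOn_of_const hne fun P hP u _ v _ hu => ?_
    have hP' : ∀ e ∉ C, e ≠ e₀ → (P (G.init e) ↔ P (G.term e)) := fun e he he' =>
      hP e ⟨he, he'⟩ trivial trivial
    have h2 := hcon {v | P v} hP'
    have := hC.2.const (f := P) (fun e he _ _ => propext ?_) (Set.mem_univ u) (Set.mem_univ v)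
    · exact this ▸ hu
    · by_cases h : e = e₀
      · rw [h]; exact h2
      · exact hP' e he h
  have h3 : G.ConnectedOn (Finset.univ : Finset V)
      (((Finset.univ \ C).erase e₀ : Finset E) : Set E) := by
    convert! h1 using 1
    · simp
    · ext; simp [and_comm]
  have h4 := h3.card_le
  rw [Finset.card_univ, Finset.card_erase_of_mem (by simpa using he₀),
    Finset.card_univ_sdiff] at h4
  have h5 := Finset.card_le_univ C
  have h6 : C.card < Fintype.card E := by
    rw [← Finset.card_univ]
    exact Finset.card_lt_card ⟨Finset.subset_univ _, fun h => he₀ (h (Finset.mem_univ _))⟩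
  omega

/-- A flow which vanishes on the complement of a spanning tree vanishes. -/
lemma IsFlow.eq_zero (hC : G.IsCut C) {J : E × Bool → ℝ} (hJ : G.IsFlow J)
    (h : ∀ e ∈ C, J (e, true) = 0) (d : E × Bool) : J d = 0 := by
  have h1 : ∀ e, J (e, true) = 0 := by
    intro e
    by_cases he : e ∈ C
    · exact h e he
    · obtain ⟨W, hW, hW'⟩ := hC.exists_cut he
      exact hJ.eq_zero_of_cut (fun e' he' h0 => hW e' (fun hc => h0 (h e' hc)) he') hW'
  rcases d with ⟨e, b⟩
  cases b
  · have := hJ.antisymm (e, true)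
    rw [h1, neg_zero] at this
    exact this
  · exact h1 e

/-! ### Nondegeneracy -/

variable {x : E → ℝ} {a : E × Bool → ℂ}

lemma VertexCond.sum {ι : Type*} (S : Finset ι) {g : ι → E × Bool → ℂ}
    (h : ∀ i ∈ S, G.VertexCond (g i)) : G.VertexCond (∑ i ∈ S, g i) := by
  classical
  induction S using Finset.induction_on with
  | empty => intro d; simp
  | insert i S hi ih =>
    rw [Finset.sum_insert hi]
    exact (h i (by simp)).add (ih fun j hj => h j (by simp [hj]))

lemma EdgeCond.sum {ι : Type*} (S : Finset ι) {g : ι → E × Bool → ℂ}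
    (h : ∀ i ∈ S, EdgeCond x (g i)) : EdgeCond x (∑ i ∈ S, g i) := by
  classical
  induction S using Finset.induction_on with
  | empty => intro d; simp
  | insert i S hi ih =>
    rw [Finset.sum_insert hi]
    exact (h i (by simp)).add (ih fun j hj => h j (by simp [hj]))

/-- Real multiples of `a d` do not contribute to the current against `a d`, so the shift by `δ`
affects the vertex condition but not conservation. -/
lemma IsFlow.of_wave (hD : G.DirichletLeaf) {g : E × Bool → ℂ} (hav : G.VertexCond a)
    (hae : EdgeCond x a) (hge : EdgeCond x g) {δ : E × Bool → ℝ}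
    (hgv : G.VertexCond fun d => g d + δ d * a d) : G.IsFlow fun d => (conj (a d) * g d).im := by
  refine ⟨fun d => ?_, fun v => ?_⟩
  · have := congrArg Complex.im (hae.current hge (rev d))
    rw [rev_rev, Complex.conj_im] at this
    exact this
  · rw [← VertexCond.sum_current hD hav hgv v]
    refine Finset.sum_congr rfl fun d _ => ?_
    simp
    ring

/-- For `η` in the kernel, the superposed response `Q` has no current on `C`, hence none anywhere.
So `Q = c a` with `c` real and symmetric under reversal. The vertex condition makes `c + δ` a
function `k` of the vertex, since `a` does not vanish there. Along an edge `k` jumps by `2δ`, which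
is zero off `C`; the complement of `C` is connected, so `k` is constant, `δ` vanishes on `C` too,
and `η = 0`. -/
lemma GenericWave.surplusMatrix_injective [Nonempty E] (hD : G.DirichletLeaf) (hC : G.IsCut C)
    (h : G.GenericWave x a) {η : C → ℝ}
    (hη : ∀ i, ∑ j, G.surplusMatrix C x i j * (η j : ℂ) = 0) : η = 0 := by
  choose q hq using fun j : C => h.exists_fluxResponse hD j.1
  let Q : E × Bool → ℂ := ∑ j, (η j : ℂ) • q j
  let δ : E × Bool → ℝ := fun d => ∑ j, η j * (fluxSign j.1 d / 2)
  have hQ : EdgeCond x Q := EdgeCond.sum _ fun j _ => (hq j).edge.smul _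
  have hδ : ∀ d, δ (rev d) = -δ d := fun d => by
    simp only [δ, fluxSign_rev, neg_div, mul_neg, Finset.sum_neg_distrib]
  have hg : G.VertexCond fun d => Q d + δ d * a d := by
    have := VertexCond.sum Finset.univ fun j _ => ((hq j).vertex.smul (η j))
    convert! this using 1
    ext d
    simp only [Q, δ, Finset.sum_apply, Pi.smul_apply, smul_eq_mul, mul_add,
      Finset.sum_add_distrib, Complex.ofReal_sum, Finset.sum_mul]
    congr 1
    refine Finset.sum_congr rfl fun j _ => ?_
    push_cast
    ring
  have hflow := IsFlow.of_wave hD h.vertex h.edge hQ hg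
  have hcur : ∀ i ∈ C, (conj (a (i, true)) * Q (i, true)).im = 0 := by
    intro i hi
    have h1 := hη ⟨i, hi⟩
    simp only [h.surplusMatrix_apply hD _ _ (hq _)] at h1
    have h2 : ∑ j, 2 / G.weight a * current a (q j) i * η j = 0 := by exact_mod_cast h1
    have h3 : (conj (a (i, true)) * Q (i, true)).im = ∑ j, current a (q j) i * η j := by
      simp only [Q, Finset.sum_apply, Pi.smul_apply, smul_eq_mul, Finset.mul_sum, Complex.im_sum,
        current]
      refine Finset.sum_congr rfl fun j _ => ?_
      rw [mul_left_comm, Complex.im_ofReal_mul, mul_comm]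
    simp only [mul_assoc] at h2
    rw [← Finset.mul_sum, ← h3] at h2
    exact (mul_eq_zero.1 h2).resolve_left (by have := h.weight_pos; positivity)
  have hzero : ∀ d, (conj (a d) * Q d).im = 0 := hflow.eq_zero hC hcur
  let c : E × Bool → ℝ := fun d => (conj (a d) * Q d).re / ‖a d‖ ^ 2
  have hc : ∀ d, Q d = c d * a d := by
    intro d
    have h1 : conj (a d) * Q d = ((conj (a d) * Q d).re : ℂ) := by
      apply Complex.ext <;> simp [-Complex.mul_re, -Complex.mul_im, hzero d]
    have h2 : (‖a d‖ ^ 2 : ℂ) ≠ 0 := by exact_mod_cast pow_ne_zero 2 (norm_ne_zero_iff.2 (h.ne_zero d))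
    have h3 : (c d : ℂ) * (‖a d‖ ^ 2 : ℂ) = conj (a d) * Q d := by
      rw [h1]; simp only [c]; push_cast; exact div_mul_cancel₀ _ h2
    rw [← Complex.conj_mul'] at h3
    have h4 : conj (a d) ≠ 0 := by simpa using h.ne_zero d
    apply mul_left_cancel₀ h4
    rw [← h3]; ring
  have hcrev : ∀ d, c (rev d) = c d := by
    intro d
    simp only [c]
    rw [h.edge.norm_rev, h.edge.current hQ d, Complex.conj_re]
  have hk : ∀ d d', G.terminus d = G.terminus d' → c d + δ d = c d' + δ d' := by
    intro d d' hdd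
    by_cases hd : G.terminus d ∈ G.dirichlet
    · rw [G.eq_of_terminus_eq (hD _ hd) hdd.symm]
    · have h1 := hg.re_eq hD hdd
      have h2 := h.vertex.re_eq hD hdd
      have h3 : ∀ d, (Q d + δ d * a d).re = (c d + δ d) * (a d).re := fun d => by
        rw [hc d]; simp; ring
      rw [h3, h3, ← h2] at h1
      exact mul_right_cancel₀ (h.re_ne_zero d hd) h1
  let k : V → ℝ := fun v => if hv : ∃ d, G.terminus d = v then c hv.choose + δ hv.choose else 0
  have hkd : ∀ d, k (G.terminus d) = c d + δ d := by
    intro d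
    have hv : ∃ d', G.terminus d' = G.terminus d := ⟨d, rfl⟩
    simp only [k, dif_pos hv]
    exact hk _ _ hv.choose_spec
  have hdiff : ∀ e, k (G.term e) - k (G.init e) = 2 * δ (e, true) := by
    intro e
    have h1 := hkd (e, true)
    have h2 := hkd (e, false)
    rw [terminus_true] at h1
    rw [terminus_false] at h2
    have h3 := hcrev (e, true)
    have h4 := hδ (e, true)
    rw [rev_mk, Bool.not_true] at h3 h4
    rw [h1, h2, h3, h4]; ring
  have hδe : ∀ e, δ (e, true) = if he : e ∈ C then η ⟨e, he⟩ / 2 else 0 := by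
    intro e
    simp only [δ]
    split_ifs with he
    · rw [Finset.sum_eq_single ⟨e, he⟩]
      · simp [fluxSign]; ring
      · intro j _ hj
        have : e ≠ j.1 := fun h => hj (Subtype.ext h.symm)
        simp [fluxSign, this]
      · simp
    · refine Finset.sum_eq_zero fun j _ => ?_
      have : e ≠ j.1 := fun h => he (h ▸ j.2)
      simp [fluxSign, this]
  have hconst : ∀ u v, k u = k v := fun u v =>
    hC.2.const (fun e he _ _ => by
      have := hdiff e
      rw [hδe, dif_neg he] at this
      linarith) (Set.mem_univ u) (Set.mem_univ v)
  ext i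
  have h1 := hdiff i.1
  rw [hδe, dif_pos i.2, hconst (G.term i.1) (G.init i.1)] at h1
  rw [Pi.zero_apply]
  linarith

end Finite

end QuantumGraph


/-! ### Generic waves on the secular manifold and their flips. -/

namespace QuantumGraph

open scoped ComplexConjugate
open Matrix

variable {V E : Type*} {G : QuantumGraph V E}

section Finite

variable [Fintype E] [DecidableEq V] [DecidableEq E]

/-! ### The generic manifold -/

lemma IsNontrivialStandard.dirichletLeaf (hG : G.IsNontrivialStandard) : G.DirichletLeaf :=
  hG.dirichlet_degree

/-- Both ends have degree one, so the edge is a connected component and hence the whole graph. -/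
lemma subsingleton_of_dirichlet (hD : G.DirichletLeaf) (hconn : G.ConnectedOn Set.univ Set.univ)
    {e : E} (hi : G.init e ∈ G.dirichlet) (ht : G.term e ∈ G.dirichlet) (e' : E) : e' = e := by
  have hkey : ∀ d : E × Bool, (G.terminus d = G.init e ∨ G.terminus d = G.term e) → d.1 = e := by
    rintro d (h | h)
    · exact congrArg Prod.fst (G.eq_of_terminus_eq (d := (e, false)) (by simpa using hD _ hi)
        (by simpa using h))
    · exact congrArg Prod.fst (G.eq_of_terminus_eq (d := (e, true)) (by simpa using hD _ ht)
        (by simpa using h))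
  have h1 := hconn.const (f := fun v => (v = G.init e ∨ v = G.term e)) (fun e'' _ _ _ => by
    apply propext
    constructor
    · intro h
      have := hkey (e'', false) (by simpa using h)
      simp only at this
      simp [this]
    · intro h
      have := hkey (e'', true) (by simpa using h)
      simp only at this
      simp [this]) (Set.mem_univ (G.init e)) (Set.mem_univ (G.init e'))
  have h2 : G.init e' = G.init e ∨ G.init e' = G.term e := by
    rw [← h1]; exact Or.inl rfl
  exact hkey (e', false) (by simpa using h2)

lemma EdgeCond.eq_zero_rev {x : E → ℝ} {a : E × Bool → ℂ} (h : EdgeCond x a) {d : E × Bool}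
    (hd : a d = 0) : a (rev d) = 0 := by
  rw [← norm_eq_zero, h.norm_rev, hd, norm_zero]

/-- A nonzero gradient forces a nonzero adjugate, hence a one-dimensional kernel, and conversely by
`gradSecular_apply`; the eigenfunction at a vertex is twice the real part of an incoming amplitude.
If an amplitude vanished on an edge, both its ends would be Dirichlet vertices, this edge would be
the whole graph, and `a = 0`. -/
lemma exists_genericWave_iff [Nonempty E] (hD : G.DirichletLeaf)
    (hconn : G.ConnectedOn Set.univ Set.univ)
    (x : E → ℝ) : (∃ a, G.GenericWave x a) ↔ G.secular x 0 = 0 ∧ G.gradSecular x ≠ 0 ∧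
      ∀ a : E × Bool → ℂ, a ≠ 0 → (1 - phaseMatrix x * G.scattering).mulVec a = 0 →
      ∀ d : E × Bool, G.origin d ∉ G.dirichlet →
        Complex.exp (-(Complex.I * (x d.1 : ℂ))) * a d + a (rev d) ≠ 0 := by
  have hval : ∀ a : E × Bool → ℂ, EdgeCond x a → ∀ d,
      Complex.exp (-(Complex.I * (x d.1 : ℂ))) * a d + a (rev d) = 2 * ((a (rev d)).re : ℂ) := by
    intro a ha d
    have h1 := Complex.add_conj (a (rev d))
    push_cast at h1
    rw [ha d]
    linear_combination conj (a (rev d)) * exp_neg_mul_exp (x d.1) + h1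
  constructor
  · rintro ⟨a, h⟩
    obtain ⟨κ, hκ0, hκ⟩ := h.exists_adjugate hD
    obtain ⟨e⟩ := ‹Nonempty E›
    refine ⟨?_, fun h0 => ?_, fun b hb0 hb d hd => ?_⟩
    · rw [secular_eq_det, ← Matrix.exists_mulVec_eq_zero_iff]
      exact ⟨a, Function.ne_iff.2 ⟨(e, true), h.ne_zero _⟩, h.mulVec⟩
    · have : Nonempty E := ⟨e⟩
      have h1 := h.gradSecular_apply hκ e
      rw [h0] at h1
      have h2 := norm_ne_zero_iff.2 (h.ne_zero (e, true))
      simp [hκ0, h.ne_zero] at h1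
    · obtain ⟨c, rfl⟩ := h.unique_complex hD hb
      have hc : c ≠ 0 := by rintro rfl; simp at hb0
      have h1 : Complex.exp (-(Complex.I * (x d.1 : ℂ))) * (c • a) d + (c • a) (rev d) =
          c * (Complex.exp (-(Complex.I * (x d.1 : ℂ))) * a d + a (rev d)) := by
        simp; ring
      rw [h1, hval a h.edge]
      have := h.re_ne_zero (rev d) (by rwa [terminus_rev])
      refine mul_ne_zero hc (mul_ne_zero two_ne_zero ?_)
      exact_mod_cast this
  · rintro ⟨h0, hgrad, hne⟩
    rw [secular_eq_det, ← Matrix.exists_mulVec_eq_zero_iff] at h0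
    obtain ⟨b, hb0, hb⟩ := h0
    obtain ⟨a, ha0, hav, hae⟩ : ∃ a, a ≠ 0 ∧ G.VertexCond a ∧ EdgeCond x a := by
      obtain ⟨p, q, hpv, hpe, hqv, hqe, rfl⟩ := exists_re_im_of_mem_ker hD hb
      by_cases hp : p = 0
      · refine ⟨q, ?_, hqv, hqe⟩
        rintro rfl
        simp [hp] at hb0
      · exact ⟨p, hp, hpv, hpe⟩
    have ha := secMatrix_mulVec_eq_zero hav hae
    have hadj : (G.secMatrix x).adjugate ≠ 0 := by
      intro hadj
      obtain ⟨k, hk⟩ := Function.ne_iff.1 ha0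
      apply hgrad
      ext e
      have := gradSecular_mul ha e k
      have h1 : G.gradSecular x e = 0 ∨ a k = 0 := by simpa [hadj] using this
      exact h1.resolve_right hk
    have hre : ∀ d, G.terminus d ∉ G.dirichlet → (a d).re ≠ 0 := by
      intro d hd h
      refine hne a ha0 ha (rev d) (by rwa [origin_rev]) ?_
      have := hval a hae (rev d)
      rw [rev_rev] at this ⊢
      rw [this, h]; simp
    refine ⟨a, hav, hae, fun c hcv hce => ?_, hre, fun d hd => ?_⟩
    · obtain ⟨z, rfl⟩ := Matrix.exists_smul_of_adjugate_ne_zero hadj ha ha0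
        (secMatrix_mulVec_eq_zero hcv hce)
      obtain ⟨k, hk⟩ := Function.ne_iff.1 ha0
      refine ⟨z.re, ?_⟩
      have h1 := hce k
      have h2 := hae k
      simp only [Pi.smul_apply, smul_eq_mul, map_mul] at h1
      rw [mul_left_comm, ← h2] at h1
      have h3 := mul_right_cancel₀ hk h1
      rw [Complex.conj_eq_iff_re.1 h3.symm]
    · have hd' := hae.eq_zero_rev hd
      have h1 : ∀ b, a (d.1, b) = 0 := by
        rcases d with ⟨e, b⟩
        rw [rev_mk] at hd'
        intro b'
        cases b <;> cases b' <;> simp_all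
      have h2 : ∀ b, G.terminus (d.1, b) ∈ G.dirichlet := fun b => by
        by_contra hcon
        exact hre _ hcon (by rw [h1 b]; simp)
      have h3 := subsingleton_of_dirichlet hD hconn (e := d.1) (by simpa using h2 false)
        (by simpa using h2 true)
      exact ha0 (funext fun c => by rw [← Prod.mk.eta (p := c), h3 c.1, h1]; rfl)

lemma mem_genericManifold_iff (hG : G.IsNontrivialStandard) (x : EuclideanSpace ℝ E) :
    x ∈ G.genericManifold ↔
      (∀ e, x e ∈ Set.Ico 0 (2 * Real.pi)) ∧ ∃ a, G.GenericWave x.ofLp a := by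
  have := hG.nonempty_edges
  rw [exists_genericWave_iff hG.dirichletLeaf hG.connected, genericManifold, regularManifold]
  simp only [Set.mem_ofPred_eq]
  tauto

/-! ### Flips -/

/-- Complex conjugation of the amplitudes entering the vertices of `W`. -/
noncomputable def flipWave (G : QuantumGraph V E) (W : Finset V) (g : E × Bool → ℂ) :
    E × Bool → ℂ := fun d => if G.terminus d ∈ W then conj (g d) else g d

variable {W : Finset V}

lemma flipWave_flipWave (g : E × Bool → ℂ) : G.flipWave W (G.flipWave W g) = g := by
  ext d; unfold flipWave; split_ifs <;> simp

lemma flipWave_re (g : E × Bool → ℂ) (d : E × Bool) : (G.flipWave W g d).re = (g d).re := by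
  unfold flipWave; split_ifs <;> simp

lemma norm_flipWave (g : E × Bool → ℂ) (d : E × Bool) : ‖G.flipWave W g d‖ = ‖g d‖ := by
  unfold flipWave; split_ifs <;> simp

lemma flipWave_smul (c : ℝ) (g : E × Bool → ℂ) :
    G.flipWave W ((c : ℂ) • g) = (c : ℂ) • G.flipWave W g := by
  ext d; simp only [flipWave, Pi.smul_apply, smul_eq_mul]; split_ifs <;> simp

/-- Amplitudes entering the same vertex are conjugated together. Real parts are unchanged and the
total at the vertex is real. -/
lemma VertexCond.flip (hD : G.DirichletLeaf) {g : E × Bool → ℂ} (hg : G.VertexCond g) :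
    G.VertexCond (G.flipWave W g) := by
  rw [vertexCond_iff hD] at hg ⊢
  intro d
  simp only [flipWave_re]
  refine ⟨(hg d).1, fun hd => ?_⟩
  have h1 := (hg d).2 hd
  by_cases hW : G.terminus d ∈ W
  · have : ∀ c ∈ G.incoming (G.terminus d), G.flipWave W g c = conj (g c) := fun c hc => by
      rw [mem_incoming] at hc
      rw [flipWave, hc, if_pos hW]
    rw [Finset.sum_congr rfl this, ← map_sum, h1]
    simp
  · have : ∀ c ∈ G.incoming (G.terminus d), G.flipWave W g c = g c := fun c hc => by
      rw [mem_incoming] at hc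
      rw [flipWave, hc, if_neg hW]
    rw [Finset.sum_congr rfl this, h1]

/-- The only edge which may join `W` to its complement is `e₀`. -/
def SingleCrossing (G : QuantumGraph V E) (W : Finset V) (e₀ : E) : Prop :=
  ∀ e, ¬ (G.init e ∈ W ↔ G.term e ∈ W) → e = e₀

/-- `x'` is a phase vector for the flipped wave. -/
def IsFlip (G : QuantumGraph V E) (W : Finset V) (a : E × Bool → ℂ) (x' : E → ℝ) : Prop :=
  ∀ e, Complex.exp (Complex.I * (x' e : ℂ)) * conj (G.flipWave W a (e, false)) =
    G.flipWave W a (e, true)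

variable {x x' : E → ℝ} {a : E × Bool → ℂ} {e₀ : E}

lemma IsFlip.edgeCond (h : G.IsFlip W a x') (ha : EdgeCond x a) :
    EdgeCond x' (G.flipWave W a) := by
  rintro ⟨e, b⟩
  cases b
  · have h1 := h e
    have h2 : ‖G.flipWave W a (e, false)‖ = ‖G.flipWave W a (e, true)‖ := by
      rw [norm_flipWave, norm_flipWave]; exact ha.norm_rev (e, true)
    simp only [rev_mk, Bool.not_false]
    rw [← h1, map_mul, Complex.conj_conj]
    linear_combination (-(G.flipWave W a (e, false))) * conj_exp_I_mul (x' e)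
  · exact (h e).symm

/-- Converse of `EdgeCond.current`: against a nowhere vanishing reference wave, the edge condition
can be read off the products, in which no phases appear. -/
lemma EdgeCond.of_current {b p : E × Bool → ℂ} (hb : EdgeCond x b) (hb0 : ∀ d, b d ≠ 0)
    (h : ∀ d, conj (b d) * p d = conj (conj (b (rev d)) * p (rev d))) : EdgeCond x p := by
  intro d
  have h1 := h d
  have h2 := hb d
  rw [h2] at h1
  simp only [map_mul, Complex.conj_conj] at h1
  refine mul_left_cancel₀ (hb0 (rev d)) ?_
  linear_combination Complex.exp (Complex.I * (x d.1 : ℂ)) * h1 -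
    (b (rev d) * p d) * conj_exp_I_mul (x d.1)

variable [Fintype V]

/-- On an edge which does not cross, both products are conjugated or neither is. On the crossing
edge the current vanishes by conservation, so the products are real and conjugation does not affect
them. This is the one place where a single crossing is essential. -/
lemma flip_edgeCond (hD : G.DirichletLeaf) (hW : G.SingleCrossing W e₀) (hav : G.VertexCond a)
    (hae : EdgeCond x a) (ha0 : ∀ d, a d ≠ 0) {q : E × Bool → ℂ} {δ : E × Bool → ℝ}
    (hq : EdgeCond x q) (hqv : G.VertexCond fun d => q d + δ d * a d) (hx' : G.IsFlip W a x') :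
    EdgeCond x' (G.flipWave W q) := by
  have hflow := IsFlow.of_wave hD hav hae hq hqv
  have hcross : ∀ e, ¬ (G.init e ∈ W ↔ G.term e ∈ W) → ∀ b, (conj (a (e, b)) * q (e, b)).im = 0 := by
    intro e he
    obtain rfl := hW e he
    have h1 := hflow.eq_zero_of_cut (W := (W : Set V)) (e₀ := e) (fun e' he' _ => by
      by_contra hcon
      exact he' (hW e' (by simpa using hcon))) (by simpa using he)
    intro b
    cases b
    · have := hflow.antisymm (e, true)
      rw [h1, neg_zero] at this
      exact this
    · exact h1
  refine (hx'.edgeCond hae).of_current (fun d => ?_) fun d => ?_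
  · rw [← norm_ne_zero_iff, norm_flipWave, norm_ne_zero_iff]; exact ha0 d
  · have hcur := hae.current hq d
    by_cases hc : (G.init d.1 ∈ W ↔ G.term d.1 ∈ W)
    · have hc' : G.terminus d ∈ W ↔ G.terminus (rev d) ∈ W := by
        rcases d with ⟨e, b⟩
        cases b <;> simp [hc]
      unfold flipWave
      by_cases h : G.terminus d ∈ W
      · rw [if_pos h, if_pos h, if_pos (hc'.1 h), if_pos (hc'.1 h), ← map_mul, hcur, ← map_mul]
      · rw [if_neg h, if_neg h, if_neg (mt hc'.2 h), if_neg (mt hc'.2 h), hcur]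
    · have hz : ∀ c, c.1 = d.1 → conj (G.flipWave W a c) * G.flipWave W q c = conj (a c) * q c := by
        rintro ⟨e, b⟩ rfl
        have := Complex.conj_eq_iff_im.2 (hcross _ hc b)
        unfold flipWave
        split_ifs
        · rw [← map_mul, this]
        · rfl
      rw [hz d rfl, hz (rev d) rfl, hcur]

lemma GenericWave.flip (hD : G.DirichletLeaf) (hW : G.SingleCrossing W e₀)
    (h : G.GenericWave x a) (hx' : G.IsFlip W a x') : G.GenericWave x' (G.flipWave W a) where
  vertex := h.vertex.flip hD
  edge := hx'.edgeCond h.edge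
  re_ne_zero d hd := by rw [flipWave_re]; exact h.re_ne_zero d hd
  ne_zero d := by rw [← norm_ne_zero_iff, norm_flipWave, norm_ne_zero_iff]; exact h.ne_zero d
  unique b hbv hbe := by
    have h1 : EdgeCond x (G.flipWave W b) := by
      -- A competing wave at `x'` is flipped back to `x`, the roles of the two phase vectors being
      -- exchanged, and compared with `a` there.
      refine flip_edgeCond (x := x') (a := G.flipWave W a) (δ := 0) hD hW (h.vertex.flip hD)
        (hx'.edgeCond h.edge) (fun d => ?_) hbe (by simpa using hbv) fun e => ?_
      · rw [← norm_ne_zero_iff, norm_flipWave, norm_ne_zero_iff]; exact h.ne_zero d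
      · rw [flipWave_flipWave]; exact (h.edge (e, true)).symm
    obtain ⟨c, hc⟩ := h.unique _ (hbv.flip hD) h1
    exact ⟨c, by rw [← flipWave_smul, ← hc, flipWave_flipWave]⟩

lemma FluxResponse.flip (hD : G.DirichletLeaf) (hW : G.SingleCrossing W e₀)
    (h : G.GenericWave x a) (hx' : G.IsFlip W a x') {i : E} {q : E × Bool → ℂ}
    (hq : G.FluxResponse x a i q) : G.FluxResponse x' (G.flipWave W a) i (G.flipWave W q) where
  edge := flip_edgeCond (δ := fun d => fluxSign i d / 2) hD hW h.vertex h.edge h.ne_zero hq.edge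
    (by simpa using hq.vertex) hx'
  vertex := by
    have := hq.vertex.flip (W := W) hD
    convert! this using 1
    ext d
    simp only [flipWave]
    split_ifs <;> simp [Complex.conj_ofNat]

lemma weight_flipWave : G.weight (G.flipWave W a) = G.weight a := by
  simp only [weight, norm_flipWave]

lemma current_flipWave (q : E × Bool → ℂ) (i : E) :
    current (G.flipWave W a) (G.flipWave W q) i =
      if G.term i ∈ W then -current a q i else current a q i := by
  unfold current flipWave
  simp only [terminus_true]
  split_ifs
  · rw [← map_mul, Complex.conj_im]
  · rfl

/-- Conjugation reverses the currents read at vertices of `W`, and the weight depends on moduli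
only. The sign involves just the row edge `i`; combined with symmetry, this will make the entries
between different blocks vanish. -/
lemma GenericWave.surplusMatrix_flip [Nonempty E] (hD : G.DirichletLeaf)
    (hW : G.SingleCrossing W e₀) (h : G.GenericWave x a) (hx' : G.IsFlip W a x') {C : Finset E}
    (i j : C) : G.surplusMatrix C x' i j =
      if G.term i.1 ∈ W then -G.surplusMatrix C x i j else G.surplusMatrix C x i j := by
  obtain ⟨q, hq⟩ := h.exists_fluxResponse hD j.1
  rw [h.surplusMatrix_apply hD i j hq,
    (h.flip hD hW hx').surplusMatrix_apply hD i j (hq.flip hD hW h hx'), weight_flipWave,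
    current_flipWave]
  split_ifs <;> simp

/-! ### The phases of the flipped waves -/

/-- The phases of the flipped wave, as functions of the phases of the original one. -/
noncomputable def flipPhase (G : QuantumGraph V E) (W : Finset V) (x : E → ℝ) (e : E) : ℂ :=
  if G.init e ∈ W then
    if G.term e ∈ W then Complex.exp (-(Complex.I * (x e : ℂ)))
    else (G.secMatrix x).adjugate (e, true) (e, true) / (G.secMatrix x).adjugate (e, false) (e, true)
  else
    if G.term e ∈ W then
      (G.secMatrix x).adjugate (e, false) (e, true) / (G.secMatrix x).adjugate (e, true) (e, true)
    else Complex.exp (Complex.I * (x e : ℂ))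

/-- Ratios of entries in one column of the adjugate are ratios of amplitudes. The new phase of the
crossing edge is therefore an explicit function of `x`, with no choice of `a`, which later yields
measurability and continuity. -/
lemma GenericWave.flipPhase_mul [Nonempty E] (hD : G.DirichletLeaf) (h : G.GenericWave x a)
    (e : E) : G.flipPhase W x e * conj (G.flipWave W a (e, false)) = G.flipWave W a (e, true) := by
  obtain ⟨κ, hκ0, hκ⟩ := h.exists_adjugate hD
  have h1 := h.ne_zero (e, true)
  have h2 := h.ne_zero (e, false)
  have h3 : conj (a (e, true)) ≠ 0 := by simpa using h1
  have h4 : a (e, true) * conj (a (e, true)) = a (e, false) * conj (a (e, false)) := by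
    have : ‖a (e, false)‖ = ‖a (e, true)‖ := h.edge.norm_rev (e, true)
    rw [Complex.mul_conj', Complex.mul_conj', this]
  unfold flipPhase flipWave
  simp only [terminus_true, terminus_false, hκ]
  split_ifs
  · rw [Complex.conj_conj, h.edge (e, false)]
    simp only [rev_mk, Bool.not_false]
    linear_combination conj (a (e, true)) * exp_neg_mul_exp (x e)
  · rw [Complex.conj_conj]; field_simp
  · field_simp; linear_combination -h4
  · exact (h.edge (e, true)).symm

lemma GenericWave.norm_flipPhase [Nonempty E] (hD : G.DirichletLeaf) (h : G.GenericWave x a)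
    (e : E) : ‖G.flipPhase W x e‖ = 1 := by
  have h1 := congrArg norm (h.flipPhase_mul (W := W) hD e)
  rw [norm_mul, RCLike.norm_conj, norm_flipWave, norm_flipWave] at h1
  have h2 : ‖a (e, false)‖ = ‖a (e, true)‖ := h.edge.norm_rev (e, true)
  rw [h2] at h1
  exact mul_right_cancel₀ (norm_ne_zero_iff.2 (h.ne_zero (e, true))) (by rw [h1, one_mul])

end Finite

end QuantumGraph


open scoped ENNReal NNReal Topology

/-! ### Hausdorff measure under maps close to linear involutions. -/

section Geometry

/-- The inequality forces `f` to factor on `A` through `g`, by a `K`-Lipschitz map on `g '' A`. -/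
lemma hausdorffMeasure_image_le_of_dist_le {α Y Z : Type*} [MetricSpace Y] [MeasurableSpace Y]
    [BorelSpace Y] [MetricSpace Z] [MeasurableSpace Z] [BorelSpace Z] {A : Set α} {f : α → Y}
    {g : α → Z} {K : ℝ≥0} {d : ℝ} (hd : 0 ≤ d)
    (h : ∀ x ∈ A, ∀ y ∈ A, dist (f x) (f y) ≤ K * dist (g x) (g y)) :
    μH[d] (f '' A) ≤ (K : ℝ≥0∞) ^ d * μH[d] (g '' A) := by
  classical
  rcases A.eq_empty_or_nonempty with rfl | ⟨a₀, ha₀⟩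
  · simp
  let φ : Z → Y := fun z => if hz : ∃ x ∈ A, g x = z then f hz.choose else f a₀
  have hφ : ∀ x ∈ A, φ (g x) = f x := by
    intro x hx
    have hz : ∃ x' ∈ A, g x' = g x := ⟨x, hx, rfl⟩
    simp only [φ, dif_pos hz]
    obtain ⟨h1, h2⟩ := hz.choose_spec
    have := h _ h1 x hx
    rw [h2, dist_self, mul_zero] at this
    exact dist_le_zero.1 this
  have hlip : LipschitzOnWith K φ (g '' A) := by
    refine LipschitzOnWith.of_dist_le_mul ?_
    rintro _ ⟨x, hx, rfl⟩ _ ⟨y, hy, rfl⟩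
    rw [hφ x hx, hφ y hy]
    exact h x hx y hy
  have : f '' A = φ '' (g '' A) := by
    rw [Set.image_image]
    exact (Set.image_congr hφ).symm
  rw [this]
  exact hlip.hausdorffMeasure_image_le hd

variable {F : Type*} [NormedAddCommGroup F] [InnerProductSpace ℝ F] [FiniteDimensional ℝ F]
  [MeasurableSpace F] [BorelSpace F]

/-- A linear involution preserving a hyperplane preserves its Hausdorff measure. -/
lemma hausdorffMeasure_image_of_involutive {n : F} (hn : n ≠ 0) (L : F →ₗ[ℝ] F)
    (hL : ∀ v, L (L v) = v) (hLn : ∀ v, inner ℝ n v = 0 → inner ℝ n (L v) = 0) {B : Set F}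
    (hB : ∀ v ∈ B, inner ℝ n v = 0) :
    μH[(Module.finrank ℝ F : ℝ) - 1] (L '' B) = μH[(Module.finrank ℝ F : ℝ) - 1] B := by
  let P : Submodule ℝ F := (Submodule.span ℝ {n})ᗮ
  have hP : ∀ v, v ∈ P ↔ inner ℝ n v = 0 := fun v => Submodule.mem_orthogonal_singleton_iff_inner_right
  have hrank : (Module.finrank ℝ P : ℝ) = (Module.finrank ℝ F : ℝ) - 1 := by
    have h1 := Submodule.finrank_add_finrank_orthogonal (𝕜 := ℝ) (Submodule.span ℝ {n})
    rw [finrank_span_singleton hn] at h1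
    have : (Module.finrank ℝ F : ℝ) = 1 + Module.finrank ℝ P := by exact_mod_cast h1.symm
    linarith
  rw [← hrank]
  have hd : (0 : ℝ) ≤ (Module.finrank ℝ P : ℝ) := by positivity
  let LP : P →ₗ[ℝ] P := L.restrict fun v hv => (hP _).2 (hLn v ((hP v).1 hv))
  have hLP : LP.comp LP = LinearMap.id := by
    ext v
    simp [LP, hL]
  have hdet : |LinearMap.det LP| = 1 := by
    have h1 := congrArg LinearMap.det hLP
    rw [LinearMap.det_comp, LinearMap.det_id] at h1
    rcases mul_self_eq_one_iff.1 h1 with h | h <;> simp [h]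
  have hBP : B = (Subtype.val : P → F) '' (Subtype.val ⁻¹' B) := by
    ext v
    constructor
    · exact fun hv => ⟨⟨v, (hP v).2 (hB v hv)⟩, hv, rfl⟩
    · rintro ⟨w, hw, rfl⟩
      exact hw
  have hLB : L '' B = (Subtype.val : P → F) '' (LP '' (Subtype.val ⁻¹' B)) := by
    conv_lhs => rw [hBP]
    rw [Set.image_image, Set.image_image]
    rfl
  have hiso : Isometry (Subtype.val : P → F) := isometry_subtype_coe
  rw [hLB, hiso.hausdorffMeasure_image (Or.inl hd), Measure.addHaar_image_linearMap, hdet,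
    ENNReal.ofReal_one, one_mul, ← hiso.hausdorffMeasure_image (Or.inl hd), ← hBP]

/-- The projection to the hyperplane orthogonal to `n`. -/
noncomputable def projHyperplane (n : F) : F →ₗ[ℝ] F where
  toFun u := u - (inner ℝ n u / ‖n‖ ^ 2) • n
  map_add' u v := by rw [inner_add_right, add_div, add_smul]; abel
  map_smul' c u := by
    rw [inner_smul_right, mul_div_assoc, mul_smul, smul_sub]; rfl

lemma projHyperplane_apply (n u : F) : projHyperplane n u = u - (inner ℝ n u / ‖n‖ ^ 2) • n := rfl

lemma inner_projHyperplane {n : F} (hn : n ≠ 0) (u : F) : inner ℝ n (projHyperplane n u) = 0 := by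
  have : ‖n‖ ≠ 0 := norm_ne_zero_iff.2 hn
  rw [projHyperplane_apply, inner_sub_right, inner_smul_right, real_inner_self_eq_norm_sq]
  field_simp
  ring

lemma norm_projHyperplane_le {n : F} (hn : n ≠ 0) (u : F) : ‖projHyperplane n u‖ ≤ ‖u‖ := by
  have h1 : u = projHyperplane n u + (inner ℝ n u / ‖n‖ ^ 2) • n := by
    rw [projHyperplane_apply]; abel
  have h2 : ‖u‖ ^ 2 = ‖projHyperplane n u‖ ^ 2 + ‖(inner ℝ n u / ‖n‖ ^ 2) • n‖ ^ 2 := by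
    have h3 : inner ℝ (projHyperplane n u) n = 0 := by
      rw [real_inner_comm]; exact inner_projHyperplane hn u
    conv_lhs => rw [h1]
    rw [norm_add_sq_real, inner_smul_right, h3]
    ring
  have := norm_nonneg u
  nlinarith [sq_nonneg ‖(inner ℝ n u / ‖n‖ ^ 2) • n‖, norm_nonneg (projHyperplane n u)]

/-- If two vectors `u`, `u'` almost lie in a hyperplane and `u'` almost is the image of `u` under a
linear involution, then it hardly is longer than the image of the projection of `u`. -/
lemma exists_norm_le_projHyperplane {n : F} (hn : n ≠ 0) (L : F →ₗ[ℝ] F) (hL : ∀ v, L (L v) = v)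
    (c : ℝ) (hc : 0 ≤ c) {η : ℝ} (hη : 0 < η) : ∃ ε > 0, ∀ u u' : F, |inner ℝ n u| ≤ ε * ‖u‖ →
      ‖u' - L u‖ ≤ c * (ε * ‖u'‖ + ε * ‖u‖) →
      ‖u'‖ ≤ (1 + η) * ‖L (projHyperplane n u)‖ := by
  have hn' : 0 < ‖n‖ := norm_pos_iff.2 hn
  let Lc : F →L[ℝ] F := LinearMap.toContinuousLinearMap L
  have hLc : ∀ v, ‖L v‖ ≤ ‖Lc‖ * ‖v‖ := fun v => Lc.le_opNorm v
  set b : ℝ := ‖Lc‖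
  have hb : 0 ≤ b := norm_nonneg _
  -- Replacing `L u` by `w`, the image of the projection of `u`, and absorbing the error
  -- proportional to `‖u‖` costs at most `ε (b/‖n‖ + c) ‖u‖`, and `‖u‖ ≤ 2 b ‖w‖`. The parameter `ε`
  -- is then taken so small that `1 + k ε < (1 + η) (1 - c ε)`.
  set k : ℝ := 2 * b * (b / ‖n‖ + c)
  have hk : 0 ≤ k := by positivity
  have htend : Filter.Tendsto (fun ε : ℝ => (1 + η) * (1 - c * ε) - (1 + k * ε)) (𝓝[>] 0)
      (𝓝 ((1 + η) * (1 - c * 0) - (1 + k * 0))) :=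
    (Continuous.tendsto (by fun_prop) 0).mono_left nhdsWithin_le_nhds
  have h1 : ∀ᶠ ε : ℝ in 𝓝[>] 0, 0 < (1 + η) * (1 - c * ε) - (1 + k * ε) :=
    htend.eventually (lt_mem_nhds (by simpa using hη))
  have h2 : ∀ᶠ ε : ℝ in 𝓝[>] 0, ε < ‖n‖ / 2 :=
    nhdsWithin_le_nhds (Iio_mem_nhds (by positivity))
  obtain ⟨ε, ⟨h1, h2⟩, hε⟩ := ((h1.and h2).and self_mem_nhdsWithin).exists
  have hε : 0 < ε := hε
  refine ⟨ε, hε, fun u u' hu huu' => ?_⟩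
  set w := L (projHyperplane n u) with hw
  have hQ : ‖(inner ℝ n u / ‖n‖ ^ 2) • n‖ ≤ ε * ‖u‖ / ‖n‖ := by
    rw [norm_smul, Real.norm_eq_abs, abs_div, abs_of_pos (pow_pos hn' 2), sq, div_mul_eq_mul_div,
      mul_div_mul_right _ _ hn'.ne']
    gcongr
  have h3 : ‖u‖ ≤ b * ‖w‖ + ε * ‖u‖ / ‖n‖ := by
    calc ‖u‖ = ‖projHyperplane n u + (inner ℝ n u / ‖n‖ ^ 2) • n‖ := by
          rw [projHyperplane_apply]; congr 1; abel
      _ ≤ ‖projHyperplane n u‖ + ‖(inner ℝ n u / ‖n‖ ^ 2) • n‖ := norm_add_le _ _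
      _ ≤ b * ‖w‖ + ε * ‖u‖ / ‖n‖ := by
          refine add_le_add ?_ hQ
          rw [← hL (projHyperplane n u)]
          exact hLc _
  have h4 : ‖u‖ ≤ 2 * b * ‖w‖ := by
    have : ε * ‖u‖ / ‖n‖ ≤ ‖u‖ / 2 := by
      rw [div_le_iff₀ hn']
      nlinarith [norm_nonneg u]
    linarith
  have h5 : ‖L u‖ ≤ ‖w‖ + b * (ε * ‖u‖ / ‖n‖) := by
    calc ‖L u‖ = ‖w + L ((inner ℝ n u / ‖n‖ ^ 2) • n)‖ := by
          rw [hw, ← map_add, projHyperplane_apply]; congr 2; abel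
      _ ≤ ‖w‖ + ‖L ((inner ℝ n u / ‖n‖ ^ 2) • n)‖ := norm_add_le _ _
      _ ≤ ‖w‖ + b * (ε * ‖u‖ / ‖n‖) := by
          gcongr
          exact (hLc _).trans (by gcongr)
  have h6 : ‖u'‖ ≤ ‖L u‖ + c * (ε * ‖u'‖ + ε * ‖u‖) := by
    calc ‖u'‖ = ‖L u + (u' - L u)‖ := by congr 1; abel
      _ ≤ _ := (norm_add_le _ _).trans (by gcongr)
  have h7 : ‖u'‖ * (1 - c * ε) ≤ (1 + k * ε) * ‖w‖ := by
    have : ε * (b / ‖n‖ + c) * ‖u‖ ≤ ε * (b / ‖n‖ + c) * (2 * b * ‖w‖) := by gcongr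
    have h8 : b * (ε * ‖u‖ / ‖n‖) + c * (ε * ‖u‖) = ε * (b / ‖n‖ + c) * ‖u‖ := by ring
    have h9 : ε * (b / ‖n‖ + c) * (2 * b * ‖w‖) = k * ε * ‖w‖ := by simp only [k]; ring
    linarith
  have h10 : 0 < 1 - c * ε := by
    have : 0 ≤ k * ε := by positivity
    by_contra hcon
    have : (1 + η) * (1 - c * ε) ≤ 0 := mul_nonpos_of_nonneg_of_nonpos (by linarith) (by linarith)
    linarith
  have h11 : ‖u'‖ * (1 - c * ε) ≤ (1 + η) * ‖w‖ * (1 - c * ε) := by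
    have : (1 + k * ε) * ‖w‖ ≤ (1 + η) * (1 - c * ε) * ‖w‖ := by gcongr; linarith
    linarith
  exact le_of_mul_le_mul_right h11 h10

/-- The comparison of the Hausdorff measures of a subset of an almost flat hypersurface and of its
image under a map which almost is a linear involution of the tangent space. -/
lemma exists_hausdorffMeasure_image_le {n : F} (hn : n ≠ 0) (L : F →ₗ[ℝ] F)
    (hL : ∀ v, L (L v) = v) (hLn : ∀ v, inner ℝ n v = 0 → inner ℝ n (L v) = 0)
    (hF : 1 ≤ Module.finrank ℝ F) (c : ℝ) (hc : 0 ≤ c) {η : ℝ≥0} (hη : 0 < η) :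
    ∃ ε > 0, ∀ (A : Set F) (g : F → F),
      (∀ x ∈ A, ∀ y ∈ A, |inner ℝ n (x - y)| ≤ ε * ‖x - y‖) →
      (∀ x ∈ A, ∀ y ∈ A, ‖(g x - g y) - L (x - y)‖ ≤ c * (ε * ‖g x - g y‖ + ε * ‖x - y‖)) →
      μH[(Module.finrank ℝ F : ℝ) - 1] (g '' A) ≤
        ((1 + η : ℝ≥0) : ℝ≥0∞) ^ ((Module.finrank ℝ F : ℝ) - 1) *
          μH[(Module.finrank ℝ F : ℝ) - 1] A := by
  have hd : (0 : ℝ) ≤ (Module.finrank ℝ F : ℝ) - 1 := by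
    have : (1 : ℝ) ≤ Module.finrank ℝ F := by exact_mod_cast hF
    linarith
  obtain ⟨ε, hε, H⟩ := exists_norm_le_projHyperplane hn L hL c hc (η := η) (by exact_mod_cast hη)
  refine ⟨ε, hε, fun A g h1 h2 => ?_⟩
  -- `g` is compared with projection to the hyperplane followed by `L`: the passage to `g` is `(1 +
  -- η)`-Lipschitz, `L` preserves the measure of the hyperplane, and the projection is a
  -- contraction.
  have h3 : μH[(Module.finrank ℝ F : ℝ) - 1] (g '' A) ≤
      ((1 + η : ℝ≥0) : ℝ≥0∞) ^ ((Module.finrank ℝ F : ℝ) - 1) *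
        μH[(Module.finrank ℝ F : ℝ) - 1] ((fun x => L (projHyperplane n x)) '' A) := by
    refine hausdorffMeasure_image_le_of_dist_le hd fun x hx y hy => ?_
    rw [dist_eq_norm, dist_eq_norm, ← map_sub, ← map_sub]
    simpa using H (x - y) (g x - g y) (h1 x hx y hy) (h2 x hx y hy)
  have h4 : μH[(Module.finrank ℝ F : ℝ) - 1] ((fun x => L (projHyperplane n x)) '' A) =
      μH[(Module.finrank ℝ F : ℝ) - 1] (projHyperplane n '' A) := by
    rw [← Set.image_image L (projHyperplane n)]
    refine hausdorffMeasure_image_of_involutive hn L hL hLn ?_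
    rintro _ ⟨u, -, rfl⟩
    exact inner_projHyperplane hn u
  have h5 : μH[(Module.finrank ℝ F : ℝ) - 1] (projHyperplane n '' A) ≤
      μH[(Module.finrank ℝ F : ℝ) - 1] A := by
    have := hausdorffMeasure_image_le_of_dist_le (A := A) (f := projHyperplane n) (g := id)
      (K := 1) hd fun x _ y _ => by
        rw [dist_eq_norm, ← map_sub]
        simpa [dist_eq_norm] using norm_projHyperplane_le hn (x - y)
    simpa using this
  rw [h4] at h3
  exact h3.trans (by gcongr)

/-- A map which locally hardly increases a measure does not increase it. -/
lemma measure_image_le_of_local {M : Type*} [TopologicalSpace M] [SecondCountableTopology M]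
    [MeasurableSpace M] [BorelSpace M] {μ : Measure M} {R : M → M}
    (h : ∀ p, ∀ c : ℝ≥0, 1 < c → ∃ U ∈ 𝓝 p, ∀ A ⊆ U, MeasurableSet A → μ (R '' A) ≤ c * μ A)
    {A : Set M} (hA : MeasurableSet A) : μ (R '' A) ≤ μ A := by
  have key : ∀ c : ℝ≥0, 1 < c → μ (R '' A) ≤ c * μ A := by
    intro c hc
    choose U hU hUA using fun p => h p c hc
    obtain ⟨s, hs, hcov⟩ := TopologicalSpace.countable_cover_nhds fun p =>
      interior_mem_nhds.2 (hU p)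
    rcases isEmpty_or_nonempty M with hM | hM
    · simp [Set.eq_empty_of_isEmpty A]
    have hsne : s.Nonempty := by
      by_contra hcon
      rw [Set.not_nonempty_iff_eq_empty.1 hcon] at hcov
      simp only [Set.mem_empty_iff_false, Set.iUnion_of_empty, Set.iUnion_empty] at hcov
      exact Set.empty_ne_univ hcov
    obtain ⟨φ, hφ⟩ := hs.exists_eq_range hsne
    let B : ℕ → Set M := disjointed fun i => interior (U (φ i))
    have hBm : ∀ i, MeasurableSet (B i) := fun i =>
      MeasurableSet.disjointed (fun i => isOpen_interior.measurableSet) i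
    have hBd : Pairwise (Function.onFun Disjoint B) := disjoint_disjointed _
    have hBu : ⋃ i, B i = Set.univ := by
      rw [iUnion_disjointed, ← hcov, hφ, Set.biUnion_range]
    have hAB : A = ⋃ i, A ∩ B i := by rw [← Set.inter_iUnion, hBu, Set.inter_univ]
    calc μ (R '' A) = μ (⋃ i, R '' (A ∩ B i)) := by
          rw [← Set.image_iUnion, ← hAB]
      _ ≤ ∑' i, μ (R '' (A ∩ B i)) := measure_iUnion_le _
      _ ≤ ∑' i, c * μ (A ∩ B i) := ENNReal.tsum_le_tsum fun i =>
          hUA (φ i) _ (Set.inter_subset_right.trans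
            ((disjointed_subset _ i).trans interior_subset)) (hA.inter (hBm i))
      _ = c * μ A := by
          rw [ENNReal.tsum_mul_left, ← measure_iUnion, ← hAB]
          · exact fun i j hij => (hBd hij).mono Set.inter_subset_right Set.inter_subset_right
          · exact fun i => hA.inter (hBm i)
  by_cases htop : μ A = ∞
  · rw [htop]; exact le_top
  have htend : Filter.Tendsto (fun c : ℝ≥0 => (c : ℝ≥0∞) * μ A) (𝓝[>] 1) (𝓝 (((1 : ℝ≥0) : ℝ≥0∞) * μ A)) := by
    refine Filter.Tendsto.mono_left ?_ nhdsWithin_le_nhds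
    exact ENNReal.Tendsto.mul_const (ENNReal.tendsto_coe.2 Filter.tendsto_id) (Or.inr htop)
  have := ge_of_tendsto htend (Filter.eventually_of_mem self_mem_nhdsWithin fun c hc => key c hc)
  simpa using this

end Geometry


/-! ### The flip of the generic manifold preserves the Barra-Gaspard measure. -/

namespace QuantumGraph

open scoped ComplexConjugate ENNReal NNReal Topology
open Matrix

variable {V E : Type*} {G : QuantumGraph V E} [Fintype E] [DecidableEq V] [DecidableEq E]

/-! ### The tangent spaces of the secular manifold -/

lemma contDiff_eucl {n : WithTop ℕ∞} (e : E) : ContDiff ℝ n fun x : EuclideanSpace ℝ E => x.ofLp e :=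
  (EuclideanSpace.proj (𝕜 := ℝ) e).contDiff

lemma contDiff_secular_eucl {n : WithTop ℕ∞} :
    ContDiff ℝ n fun x : EuclideanSpace ℝ E => G.secular x.ofLp 0 :=
  contDiff_secular contDiff_eucl fun _ => contDiff_const

lemma gradSecular_eq_fderiv (x : EuclideanSpace ℝ E) (e : E) : G.gradSecular x.ofLp e =
    fderiv ℝ (fun x : EuclideanSpace ℝ E => G.secular x.ofLp 0) x (EuclideanSpace.single e 1) := by
  rw [← DifferentiableAt.lineDeriv_eq_fderiv
    ((contDiff_secular_eucl (n := 1)).differentiable one_ne_zero x)]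
  rfl

lemma eucl_eq_sum (v : EuclideanSpace ℝ E) : v = ∑ e, v e • EuclideanSpace.single e (1 : ℝ) := by
  ext e
  simp [Finset.sum_apply, Pi.single_apply]

lemma fderiv_secular (x v : EuclideanSpace ℝ E) :
    fderiv ℝ (fun x : EuclideanSpace ℝ E => G.secular x.ofLp 0) x v =
      ∑ e, (v e : ℂ) * G.gradSecular x.ofLp e := by
  conv_lhs => rw [eucl_eq_sum v]
  simp [map_sum, gradSecular_eq_fderiv]

lemma continuous_gradSecular (e : E) :
    Continuous fun x : EuclideanSpace ℝ E => G.gradSecular x.ofLp e := by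
  simp only [gradSecular_eq_fderiv]
  exact ((contDiff_secular_eucl (n := 1)).continuous_fderiv one_ne_zero).clm_apply continuous_const

lemma continuous_secMatrix_adjugate (d d' : E × Bool) :
    Continuous fun x : EuclideanSpace ℝ E => (G.secMatrix x.ofLp).adjugate d d' := by
  have := ContDiff.matrix_adjugate (n := 0) (M := fun x : EuclideanSpace ℝ E => G.magSecMatrix x.ofLp 0)
    (contDiff_magSecMatrix contDiff_eucl fun _ => contDiff_const) d d'
  simp only [magSecMatrix_zero] at this
  exact this.continuous

/-- A normal vector of the secular manifold. -/
noncomputable def normalVec (a : E × Bool → ℂ) : EuclideanSpace ℝ E :=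
  WithLp.toLp 2 fun e => ‖a (e, true)‖ ^ 2

lemma normalVec_apply (a : E × Bool → ℂ) (e : E) : normalVec a e = ‖a (e, true)‖ ^ 2 := rfl

lemma inner_normalVec (a : E × Bool → ℂ) (v : EuclideanSpace ℝ E) :
    inner ℝ (normalVec a) v = ∑ e, ‖a (e, true)‖ ^ 2 * v e := by
  simp [PiLp.inner_apply, normalVec_apply, mul_comm]

lemma normalVec_flipWave {W : Finset V} (a : E × Bool → ℂ) :
    normalVec (G.flipWave W a) = normalVec a := by
  ext e; simp only [normalVec_apply, norm_flipWave]

variable [Nonempty E]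

lemma normalVec_ne_zero {a : E × Bool → ℂ} (ha : ∀ d, a d ≠ 0) : normalVec a ≠ 0 := by
  obtain ⟨e⟩ := ‹Nonempty E›
  intro h
  have : normalVec a e = 0 := by rw [h]; rfl
  rw [normalVec_apply] at this
  exact ha (e, true) (by simpa using this)

lemma GenericWave.fderiv_secular {x : EuclideanSpace ℝ E} {a : E × Bool → ℂ}
    (h : G.GenericWave x.ofLp a) {κ : ℂ}
    (hκ : ∀ d d', (G.secMatrix x.ofLp).adjugate d d' = κ * a d * conj (a d'))
    (v : EuclideanSpace ℝ E) :
    fderiv ℝ (fun x : EuclideanSpace ℝ E => G.secular x.ofLp 0) x v =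
      -2 * Complex.I * κ * ((inner ℝ (normalVec a) v : ℝ) : ℂ) := by
  rw [QuantumGraph.fderiv_secular, inner_normalVec, Complex.ofReal_sum, Finset.mul_sum]
  refine Finset.sum_congr rfl fun e _ => ?_
  rw [h.gradSecular_apply hκ]
  push_cast
  ring

/-- Strict differentiability at `p`: the secular function vanishes at both points, so its
derivative, a nonzero multiple of the pairing with `normalVec a`, is `o(‖x - y‖)` on `x - y`. -/
lemma GenericWave.eventually_tangent (hD : G.DirichletLeaf) {p : EuclideanSpace ℝ E}
    {a : E × Bool → ℂ} (h : G.GenericWave p.ofLp a) {ε : ℝ} (hε : 0 < ε) :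
    ∃ U ∈ 𝓝 p, ∀ x ∈ U, ∀ y ∈ U, G.secular x.ofLp 0 = 0 → G.secular y.ofLp 0 = 0 →
      |inner ℝ (normalVec a) (x - y)| ≤ ε * ‖x - y‖ := by
  obtain ⟨κ, hκ0, hκ⟩ := h.exists_adjugate hD
  have hκ' : 0 < ‖κ‖ := norm_pos_iff.2 hκ0
  have h1 := (contDiff_secular_eucl (G := G) (n := 1)).contDiffAt.hasStrictFDerivAt
    one_ne_zero (x := p)
  have h2 := h1.isLittleO.bound (c := 2 * ‖κ‖ * ε) (by positivity)
  rw [nhds_prod_eq] at h2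
  obtain ⟨U, hU, hUU⟩ := Filter.eventually_prod_self_iff'.1 h2
  refine ⟨U, hU, fun x hx y hy hx0 hy0 => ?_⟩
  have h3 := hUU x hx y hy
  simp only [hx0, hy0, h.fderiv_secular hκ] at h3
  have h4 : ‖(0 : ℂ) - 0 - -2 * Complex.I * κ * ((inner ℝ (normalVec a) (x - y) : ℝ) : ℂ)‖ =
      2 * ‖κ‖ * |inner ℝ (normalVec a) (x - y)| := by
    simp
  rw [h4, mul_assoc] at h3
  exact le_of_mul_le_mul_left (by linarith) (show 0 < 2 * ‖κ‖ by positivity)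

lemma GenericWave.secular_eq_zero {x : E → ℝ} {a : E × Bool → ℂ}
    (h : G.GenericWave x a) : G.secular x 0 = 0 := by
  obtain ⟨e⟩ := ‹Nonempty E›
  rw [secular_eq_det, ← Matrix.exists_mulVec_eq_zero_iff]
  exact ⟨a, Function.ne_iff.2 ⟨(e, true), h.ne_zero _⟩, h.mulVec⟩

lemma GenericWave.of_exp_eq {x x' : E → ℝ} {a : E × Bool → ℂ} (h : G.GenericWave x a)
    (hx : ∀ e, Complex.exp (Complex.I * (x' e : ℂ)) = Complex.exp (Complex.I * (x e : ℂ))) :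
    G.GenericWave x' a where
  vertex := h.vertex
  edge d := by rw [hx]; exact h.edge d
  re_ne_zero := h.re_ne_zero
  ne_zero := h.ne_zero
  unique b hb hb' := h.unique b hb fun d => by rw [← hx]; exact hb' d

/-! ### The normal component of the vector of lengths -/

lemma continuous_normalDotLen_num : Continuous fun x : EuclideanSpace ℝ E => G.gradDotLen x.ofLp :=
  continuous_finsetSum _ fun e _ => (continuous_gradSecular e).mul continuous_const

lemma measurable_normalDotLen :
    Measurable fun x : EuclideanSpace ℝ E => G.normalDotLen x.ofLp := by
  unfold normalDotLen
  refine (continuous_normalDotLen_num.norm.measurable).div (Continuous.measurable ?_)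
  simp only [EuclideanSpace.norm_eq]
  exact (continuous_finsetSum _ fun e _ => ((continuous_gradSecular e).norm.pow 2)).sqrt

/-- The constant `κ` cancels, and the density depends on the moduli of the amplitudes only. This
gives its invariance under flips. -/
lemma GenericWave.normalDotLen_eq (hD : G.DirichletLeaf) {x : E → ℝ}
    {a : E × Bool → ℂ} (h : G.GenericWave x a) :
    G.normalDotLen x = G.weight a / ‖normalVec a‖ := by
  obtain ⟨κ, hκ0, hκ⟩ := h.exists_adjugate hD
  have h1 : G.gradSecular x = (-2 * Complex.I * κ) • WithLp.toLp 2 fun e => ((normalVec a e : ℝ) : ℂ) := by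
    ext e
    simp [h.gradSecular_apply hκ, normalVec_apply]
  have h2 : ‖(WithLp.toLp 2 fun e => ((normalVec a e : ℝ) : ℂ) : EuclideanSpace ℂ E)‖ =
      ‖normalVec a‖ := by
    simp [EuclideanSpace.norm_eq]
  rw [normalDotLen, h1, h.gradDotLen_eq hκ, norm_smul, h2, norm_mul, Complex.norm_real,
    Real.norm_of_nonneg h.weight_pos.le, mul_div_mul_left]
  simp [hκ0]

/-! ### The flip of the generic manifold -/

variable [Fintype V] {W : Finset V} {e₀ : E}

variable (G W) in
/-- The flip of a phase vector. -/
noncomputable def flipMap (x : EuclideanSpace ℝ E) : EuclideanSpace ℝ E :=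
  WithLp.toLp 2 fun e => toIcoMod Real.two_pi_pos 0 (G.flipPhase W x.ofLp e).arg

lemma exp_toIcoMod_arg {z : ℂ} (hz : ‖z‖ = 1) :
    Complex.exp (Complex.I * ((toIcoMod Real.two_pi_pos 0 z.arg : ℝ) : ℂ)) = z := by
  have h1 := self_sub_toIcoMod Real.two_pi_pos 0 z.arg
  have h2 := Complex.norm_mul_exp_arg_mul_I z
  rw [hz, Complex.ofReal_one, one_mul] at h2
  conv_rhs => rw [← h2]
  rw [Complex.exp_eq_exp_iff_exists_int]
  refine ⟨-toIcoDiv Real.two_pi_pos 0 z.arg, ?_⟩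
  have h3 : toIcoMod Real.two_pi_pos 0 z.arg =
      z.arg - (toIcoDiv Real.two_pi_pos 0 z.arg : ℝ) * (2 * Real.pi) := by
    rw [zsmul_eq_mul] at h1; linarith
  rw [h3]
  push_cast
  ring

lemma exists_int_of_exp_eq {s t : ℝ}
    (h : Complex.exp (Complex.I * (s : ℂ)) = Complex.exp (Complex.I * (t : ℂ))) :
    ∃ k : ℤ, s = t + k * (2 * Real.pi) := by
  obtain ⟨k, hk⟩ := Complex.exp_eq_exp_iff_exists_int.1 h
  refine ⟨k, ?_⟩
  have h1 : Complex.I * (s : ℂ) = Complex.I * ((t + k * (2 * Real.pi) : ℝ) : ℂ) := by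
    rw [hk]; push_cast; ring
  exact_mod_cast mul_left_cancel₀ Complex.I_ne_zero h1

lemma eq_of_exp_eq {s t : ℝ} (hs : s ∈ Set.Ico 0 (2 * Real.pi)) (ht : t ∈ Set.Ico 0 (2 * Real.pi))
    (h : Complex.exp (Complex.I * (s : ℂ)) = Complex.exp (Complex.I * (t : ℂ))) : s = t := by
  obtain ⟨k, hk⟩ := exists_int_of_exp_eq h
  have hpi := Real.two_pi_pos
  have h1 : (k : ℝ) < 1 := by
    by_contra hcon
    have := mul_le_mul_of_nonneg_right (not_lt.1 hcon) hpi.le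
    linarith [hs.2, ht.1]
  have h2 : (-1 : ℝ) < k := by
    by_contra hcon
    have := mul_le_mul_of_nonneg_right (not_lt.1 hcon) hpi.le
    linarith [hs.1, ht.2]
  have h3 : k = 0 := by
    have : k < 1 := by exact_mod_cast h1
    have : -1 < k := by exact_mod_cast h2
    omega
  rw [hk, h3]; simp

lemma GenericWave.exp_flipMap (hD : G.DirichletLeaf) {x : EuclideanSpace ℝ E} {a : E × Bool → ℂ}
    (h : G.GenericWave x.ofLp a) (e : E) :
    Complex.exp (Complex.I * ((G.flipMap W x e : ℝ) : ℂ)) = G.flipPhase W x.ofLp e :=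
  exp_toIcoMod_arg (h.norm_flipPhase hD e)

lemma GenericWave.isFlip_flipMap (hD : G.DirichletLeaf) {x : EuclideanSpace ℝ E}
    {a : E × Bool → ℂ} (h : G.GenericWave x.ofLp a) : G.IsFlip W a (G.flipMap W x).ofLp := by
  intro e
  rw [h.exp_flipMap hD, h.flipPhase_mul hD]

lemma flipMap_mem_Ico (x : EuclideanSpace ℝ E) (e : E) :
    G.flipMap W x e ∈ Set.Ico 0 (2 * Real.pi) := by
  have := toIcoMod_mem_Ico Real.two_pi_pos 0 (G.flipPhase W x.ofLp e).arg
  rwa [zero_add] at this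

lemma measurable_flipPhase (e : E) :
    Measurable fun x : EuclideanSpace ℝ E => G.flipPhase W x.ofLp e := by
  unfold flipPhase
  have hx : Measurable fun x : EuclideanSpace ℝ E => Complex.I * ((x.ofLp e : ℝ) : ℂ) :=
    (continuous_const.mul (Complex.continuous_ofReal.comp
      (contDiff_eucl (n := 0) e).continuous)).measurable
  split_ifs
  · exact Complex.measurable_exp.comp hx.neg
  · exact (continuous_secMatrix_adjugate _ _).measurable.div
      (continuous_secMatrix_adjugate _ _).measurable
  · exact (continuous_secMatrix_adjugate _ _).measurable.div
      (continuous_secMatrix_adjugate _ _).measurable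
  · exact Complex.measurable_exp.comp hx

lemma measurable_flipMap : Measurable (G.flipMap W) := by
  refine (MeasurableEquiv.toLp 2 (E → ℝ)).measurable.comp (measurable_pi_lambda _ fun e => ?_)
  simp only [toIcoMod_eq_fract_mul]
  exact ((((Complex.measurable_arg.comp (measurable_flipPhase e)).div_const _).fract).mul_const _)

/-- The flip as a map of the generic manifold. -/
noncomputable def flip (hG : G.IsNontrivialStandard) (hW : G.SingleCrossing W e₀)
    (x : G.genericManifold) : G.genericManifold :=
  ⟨G.flipMap W x.1, (mem_genericManifold_iff hG _).2 ⟨flipMap_mem_Ico _, by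
    have := hG.nonempty_edges
    obtain ⟨-, a, ha⟩ := (mem_genericManifold_iff hG _).1 x.2
    exact ⟨_, ha.flip hG.dirichletLeaf hW (ha.isFlip_flipMap hG.dirichletLeaf)⟩⟩⟩

/-- After two flips the wave is again `a`, so the phases agree modulo `2π`; both lie in `[0, 2π)`.
-/
lemma flip_flip (hG : G.IsNontrivialStandard) (hW : G.SingleCrossing W e₀)
    (x : G.genericManifold) : flip hG hW (flip hG hW x) = x := by
  obtain ⟨hx, a, ha⟩ := (mem_genericManifold_iff hG _).1 x.2
  have hD := hG.dirichletLeaf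
  have hf := ha.isFlip_flipMap (W := W) hD
  have ha' := ha.flip hD hW hf
  have hf' := ha'.isFlip_flipMap (W := W) hD
  apply Subtype.ext
  ext e
  refine eq_of_exp_eq (flipMap_mem_Ico _ _) (hx e) ?_
  have h1 := hf' e
  rw [flipWave_flipWave] at h1
  have h2 := ha.edge (e, true)
  refine mul_right_cancel₀ (b := conj (a (e, false))) (by simpa using ha.ne_zero (e, false)) ?_
  exact h1.trans h2

lemma measurable_flip (hG : G.IsNontrivialStandard) (hW : G.SingleCrossing W e₀) :
    Measurable (flip hG hW) :=
  (measurable_flipMap.comp measurable_subtype_coe).subtype_mk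

lemma GenericWave.continuousAt_flipPhase (hD : G.DirichletLeaf) {p : EuclideanSpace ℝ E}
    {a : E × Bool → ℂ} (h : G.GenericWave p.ofLp a) (e : E) :
    ContinuousAt (fun x : EuclideanSpace ℝ E => G.flipPhase W x.ofLp e) p := by
  obtain ⟨κ, hκ0, hκ⟩ := h.exists_adjugate hD
  have hne : ∀ d d', (G.secMatrix p.ofLp).adjugate d d' ≠ 0 := fun d d' => by
    rw [hκ]
    exact mul_ne_zero (mul_ne_zero hκ0 (h.ne_zero d)) (by simpa using h.ne_zero d')
  unfold flipPhase
  have hx : Continuous fun x : EuclideanSpace ℝ E => Complex.I * ((x.ofLp e : ℝ) : ℂ) :=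
    (continuous_const.mul (Complex.continuous_ofReal.comp
      (contDiff_eucl (n := 0) e).continuous))
  split_ifs
  · exact (Complex.continuous_exp.comp hx.neg).continuousAt
  · exact (continuous_secMatrix_adjugate _ _).continuousAt.div
      (continuous_secMatrix_adjugate _ _).continuousAt (hne _ _)
  · exact (continuous_secMatrix_adjugate _ _).continuousAt.div
      (continuous_secMatrix_adjugate _ _).continuousAt (hne _ _)
  · exact (Complex.continuous_exp.comp hx).continuousAt

variable (G W) in
/-- A continuous lift of the flip near the point `p`. -/
noncomputable def flipLift (p x : EuclideanSpace ℝ E) : EuclideanSpace ℝ E :=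
  WithLp.toLp 2 fun e =>
    G.flipMap W p e + (G.flipPhase W x.ofLp e / G.flipPhase W p.ofLp e).arg

lemma flipLift_self (p : EuclideanSpace ℝ E) : G.flipLift W p p = G.flipMap W p := by
  ext e
  simp [flipLift]

lemma GenericWave.continuousAt_flipLift (hD : G.DirichletLeaf) {p : EuclideanSpace ℝ E}
    {a : E × Bool → ℂ} (h : G.GenericWave p.ofLp a) : ContinuousAt (G.flipLift W p) p := by
  refine (PiLp.continuous_toLp 2 _).continuousAt.comp (continuousAt_pi.2 fun e => ?_)
  have h0 : G.flipPhase W p.ofLp e ≠ 0 := norm_ne_zero_iff.1 (by rw [h.norm_flipPhase hD]; simp)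
  refine continuousAt_const.add (ContinuousAt.comp (g := Complex.arg) ?_
    ((h.continuousAt_flipPhase hD e).div_const _))
  refine Complex.continuousAt_arg ?_
  rw [div_self h0]
  simp

lemma GenericWave.exp_flipLift (hD : G.DirichletLeaf) {p x : EuclideanSpace ℝ E}
    {a b : E × Bool → ℂ} (h : G.GenericWave p.ofLp a) (h' : G.GenericWave x.ofLp b) (e : E) :
    Complex.exp (Complex.I * ((G.flipLift W p x e : ℝ) : ℂ)) = G.flipPhase W x.ofLp e := by
  have h0 : G.flipPhase W p.ofLp e ≠ 0 := norm_ne_zero_iff.1 (by rw [h.norm_flipPhase hD]; simp)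
  have h1 := Complex.norm_mul_exp_arg_mul_I (G.flipPhase W x.ofLp e / G.flipPhase W p.ofLp e)
  rw [norm_div, h.norm_flipPhase hD, h'.norm_flipPhase hD, div_one, Complex.ofReal_one, one_mul]
    at h1
  have h2 : G.flipLift W p x e =
    G.flipMap W p e + (G.flipPhase W x.ofLp e / G.flipPhase W p.ofLp e).arg := rfl
  rw [h2, Complex.ofReal_add, mul_add, Complex.exp_add, h.exp_flipMap hD, mul_comm Complex.I
    ((Complex.arg _ : ℝ) : ℂ), h1]
  field_simp

lemma GenericWave.isFlip_flipLift (hD : G.DirichletLeaf) {p x : EuclideanSpace ℝ E}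
    {a b : E × Bool → ℂ} (h : G.GenericWave p.ofLp a) (h' : G.GenericWave x.ofLp b) :
    G.IsFlip W b (G.flipLift W p x).ofLp := by
  intro e
  rw [h.exp_flipLift hD h', h'.flipPhase_mul hD]

variable (G W) in
/-- The sign with which a flip acts on the phase of an edge which does not cross. -/
noncomputable def flipSign (e : E) : ℝ := if G.init e ∈ W then -1 else 1

/-- Off the crossing edge the flip only changes the sign of a phase, so the lift is exactly affine
as long as the increment stays in the range of the principal argument. -/
lemma flipLift_sub (hW : G.SingleCrossing W e₀) {p x : EuclideanSpace ℝ E} {e : E} (he : e ≠ e₀)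
    (hx : |x e - p e| < Real.pi) :
    G.flipLift W p x e = G.flipMap W p e + G.flipSign W e * (x e - p e) := by
  have h1 : G.init e ∈ W ↔ G.term e ∈ W := by
    by_contra hcon
    exact he (hW e hcon)
  have h2 : G.flipPhase W x.ofLp e / G.flipPhase W p.ofLp e =
      Complex.exp ((G.flipSign W e * (x e - p e) : ℝ) * Complex.I) := by
    unfold flipPhase flipSign
    split_ifs with h3 h4 h4
    · rw [← Complex.exp_sub]; congr 1; push_cast; ring
    · exact absurd (h1.1 h3) h4
    · exact absurd (h1.2 h4) h3
    · rw [← Complex.exp_sub]; congr 1; push_cast; ring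
  have h3 : |G.flipSign W e * (x e - p e)| < Real.pi := by
    rw [abs_mul]
    have : |G.flipSign W e| = 1 := by unfold flipSign; split_ifs <;> simp
    rwa [this, one_mul]
  rw [abs_lt] at h3
  have h4 : G.flipLift W p x e =
    G.flipMap W p e + (G.flipPhase W x.ofLp e / G.flipPhase W p.ofLp e).arg := rfl
  rw [h4, h2, Complex.arg_exp_mul_I, (toIocMod_eq_self Real.two_pi_pos).2]
  constructor <;> linarith [h3.1, h3.2]

/-- The linearization of the flip. -/
noncomputable def flipLinear (N : EuclideanSpace ℝ E) (s : E → ℝ) (e₀ : E) :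
    EuclideanSpace ℝ E →ₗ[ℝ] EuclideanSpace ℝ E where
  toFun v := WithLp.toLp 2 fun e =>
    if e = e₀ then (inner ℝ N v - ∑ e' ∈ Finset.univ.erase e₀, N e' * (s e' * v e')) / N e₀
    else s e * v e
  map_add' u v := by
    ext e
    by_cases h : e = e₀
    · simp [h, inner_add_right, mul_add, Finset.sum_add_distrib]
      ring
    · simp [h, mul_add]
  map_smul' c v := by
    ext e
    by_cases h : e = e₀
    · simp only [h, inner_smul_right, PiLp.smul_apply, smul_eq_mul, RingHom.id_apply,
        if_true]
      have : ∀ e', N e' * (s e' * (c * v e')) = c * (N e' * (s e' * v e')) := fun e' => by ring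
      simp only [this, ← Finset.mul_sum]
      ring
    · simp [h]; ring

lemma flipLinear_apply_of_ne (N : EuclideanSpace ℝ E) (s : E → ℝ) {e e₀ : E} (h : e ≠ e₀)
    (v : EuclideanSpace ℝ E) : flipLinear N s e₀ v e = s e * v e := by
  simp [flipLinear, h]

lemma flipLinear_apply_self (N : EuclideanSpace ℝ E) (s : E → ℝ) (e₀ : E)
    (v : EuclideanSpace ℝ E) : flipLinear N s e₀ v e₀ =
      (inner ℝ N v - ∑ e' ∈ Finset.univ.erase e₀, N e' * (s e' * v e')) / N e₀ := by
  simp [flipLinear]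

lemma inner_eq_add_sum_erase (N v : EuclideanSpace ℝ E) (e₀ : E) :
    inner ℝ N v = N e₀ * v e₀ + ∑ e ∈ Finset.univ.erase e₀, N e * v e := by
  rw [Finset.add_sum_erase _ (fun e => N e * v e) (Finset.mem_univ e₀)]
  simp [PiLp.inner_apply, mul_comm]

/-- The coordinate at `e₀` is defined precisely to preserve this pairing. It is the only possible
linearization, because the point and its flip have the same normal vector `N`. -/
lemma inner_flipLinear {N : EuclideanSpace ℝ E} (s : E → ℝ) {e₀ : E} (hN : N e₀ ≠ 0)
    (v : EuclideanSpace ℝ E) : inner ℝ N (flipLinear N s e₀ v) = inner ℝ N v := by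
  rw [inner_eq_add_sum_erase N (flipLinear N s e₀ v) e₀, flipLinear_apply_self,
    mul_div_cancel₀ _ hN]
  have : ∀ e ∈ Finset.univ.erase e₀, N e * flipLinear N s e₀ v e = N e * (s e * v e) :=
    fun e he => by rw [flipLinear_apply_of_ne N s (Finset.ne_of_mem_erase he)]
  rw [Finset.sum_congr rfl this]
  ring

lemma flipLinear_flipLinear {N : EuclideanSpace ℝ E} {s : E → ℝ} (hs : ∀ e, s e * s e = 1) {e₀ : E}
    (hN : N e₀ ≠ 0) (v : EuclideanSpace ℝ E) :
    flipLinear N s e₀ (flipLinear N s e₀ v) = v := by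
  ext e
  by_cases h : e = e₀
  · subst h
    rw [flipLinear_apply_self, inner_flipLinear s hN, inner_eq_add_sum_erase N v e]
    have : ∀ e' ∈ Finset.univ.erase e, N e' * (s e' * flipLinear N s e v e') = N e' * v e' :=
      fun e' he => by
        rw [flipLinear_apply_of_ne N s (Finset.ne_of_mem_erase he), ← mul_assoc (s e'), hs, one_mul]
    rw [Finset.sum_congr rfl this, add_sub_cancel_right, mul_div_cancel_left₀ _ hN]
  · rw [flipLinear_apply_of_ne N s h, flipLinear_apply_of_ne N s h, ← mul_assoc, hs, one_mul]

/-- The difference is concentrated in the coordinate `e₀`, where it equals the change of the pairing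
with `N` divided by `N e₀`. No derivative of the phase of the crossing edge needs to be computed. -/
lemma norm_sub_flipLinear {N : EuclideanSpace ℝ E} {s : E → ℝ} {e₀ : E}
    (hN : 0 < N e₀) {u u' : EuclideanSpace ℝ E} (hu : ∀ e ≠ e₀, u' e = s e * u e) :
    ‖u' - flipLinear N s e₀ u‖ ≤ (N e₀)⁻¹ * (|inner ℝ N u'| + |inner ℝ N u|) := by
  have h1 : u' - flipLinear N s e₀ u =
      EuclideanSpace.single e₀ ((N e₀)⁻¹ * (inner ℝ N u' - inner ℝ N u)) := by
    ext e
    by_cases h : e = e₀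
    · subst h
      have : ∀ e' ∈ Finset.univ.erase e, N e' * u' e' = N e' * (s e' * u e') :=
        fun e' he => by rw [hu e' (Finset.ne_of_mem_erase he)]
      rw [PiLp.sub_apply, flipLinear_apply_self, inner_eq_add_sum_erase N u' e,
        Finset.sum_congr rfl this]
      simp only [EuclideanSpace.single, PiLp.single_apply, if_true]
      field_simp
      ring
    · rw [PiLp.sub_apply, flipLinear_apply_of_ne N s h, hu e h]
      simp [h]
  rw [h1, PiLp.norm_single, norm_mul, norm_inv, Real.norm_of_nonneg hN.le]
  gcongr
  exact (norm_sub_le _ _)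

/-- Near every point, a continuous lift of the flip hardly increases the surface measure. -/
lemma GenericWave.exists_hausdorffMeasure_flipLift_le (hD : G.DirichletLeaf)
    (hW : G.SingleCrossing W e₀) {p : EuclideanSpace ℝ E} {a : E × Bool → ℂ}
    (h : G.GenericWave p.ofLp a) {η : ℝ≥0} (hη : 0 < η) :
    ∃ U ∈ 𝓝 p, ∀ A ⊆ U, (∀ x ∈ A, ∃ b, G.GenericWave x.ofLp b) →
      μH[(Fintype.card E : ℝ) - 1] (G.flipLift W p '' A) ≤
        ((1 + η : ℝ≥0) : ℝ≥0∞) ^ ((Fintype.card E : ℝ) - 1) *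
          μH[(Fintype.card E : ℝ) - 1] A := by
  have hrank : Module.finrank ℝ (EuclideanSpace ℝ E) = Fintype.card E := finrank_euclideanSpace
  set N := normalVec a with hN
  have hN0 : 0 < N e₀ := pow_pos (norm_pos_iff.2 (h.ne_zero _)) 2
  have hs : ∀ e, G.flipSign W e * G.flipSign W e = 1 := fun e => by
    unfold flipSign; split_ifs <;> simp
  obtain ⟨ε, hε, H⟩ := exists_hausdorffMeasure_image_le (normalVec_ne_zero h.ne_zero)
    (flipLinear N (G.flipSign W) e₀) (flipLinear_flipLinear hs hN0.ne')
    (fun v hv => by rw [inner_flipLinear _ hN0.ne', hv])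
    (by rw [hrank]; exact Fintype.card_pos) (N e₀)⁻¹ (inv_nonneg.2 hN0.le) hη
  obtain ⟨U₁, hU₁, h1⟩ := h.eventually_tangent hD hε
  have hflip := h.flip hD hW (h.isFlip_flipMap (W := W) hD)
  obtain ⟨U₂, hU₂, h2⟩ := hflip.eventually_tangent hD hε
  rw [normalVec_flipWave] at h2
  have hcont : ∀ᶠ x in 𝓝 p, G.flipLift W p x ∈ U₂ :=
    (h.continuousAt_flipLift (W := W) hD).eventually_mem (by rwa [flipLift_self])
  have hball : ∀ᶠ x in 𝓝 p, ∀ e, |x e - p e| < Real.pi := by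
    rw [Filter.eventually_all]
    intro e
    have : Filter.Tendsto (fun x : EuclideanSpace ℝ E => |x e - p e|) (𝓝 p) (𝓝 |p e - p e|) :=
      (((contDiff_eucl (n := 0) e).continuous.sub continuous_const).abs).tendsto p
    exact this.eventually (gt_mem_nhds (by simpa using Real.pi_pos))
  refine ⟨_, Filter.inter_mem hU₁ (hcont.and hball), fun A hA hgen => ?_⟩
  rw [hrank] at H
  have hsec : ∀ x ∈ A, G.secular x.ofLp 0 = 0 ∧ G.secular (G.flipLift W p x).ofLp 0 = 0 := by
    intro x hx
    obtain ⟨b, hb⟩ := hgen x hx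
    exact ⟨hb.secular_eq_zero, (hb.flip hD hW (h.isFlip_flipLift hD hb)).secular_eq_zero⟩
  have h3 : ∀ x ∈ A, ∀ y ∈ A, |inner ℝ N (x - y)| ≤ ε * ‖x - y‖ := fun x hx y hy =>
    h1 x (hA hx).1 y (hA hy).1 (hsec x hx).1 (hsec y hy).1
  have h4 : ∀ x ∈ A, ∀ y ∈ A, |inner ℝ N (G.flipLift W p x - G.flipLift W p y)| ≤
      ε * ‖G.flipLift W p x - G.flipLift W p y‖ := fun x hx y hy =>
    h2 _ (hA hx).2.1 _ (hA hy).2.1 (hsec x hx).2 (hsec y hy).2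
  refine H A (G.flipLift W p) h3 fun x hx y hy => ?_
  refine (norm_sub_flipLinear hN0 (fun e he => ?_)).trans ?_
  · rw [PiLp.sub_apply, flipLift_sub hW he ((hA hx).2.2 e), flipLift_sub hW he ((hA hy).2.2 e),
      PiLp.sub_apply]
    ring
  · gcongr
    · exact h4 x hx y hy
    · exact h3 x hx y hy

/-- The surface measure of the generic manifold. -/
lemma hausdorffMeasure_image_val (A : Set G.genericManifold) :
    μH[(Fintype.card E : ℝ) - 1] A = μH[(Fintype.card E : ℝ) - 1] (Subtype.val '' A) := by
  have : (1 : ℝ) ≤ Fintype.card E := by exact_mod_cast Fintype.card_pos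
  exact (isometry_subtype_coe.hausdorffMeasure_image (Or.inl (by linarith)) A).symm

lemma measurable_flipLift (p : EuclideanSpace ℝ E) : Measurable (G.flipLift W p) := by
  refine (MeasurableEquiv.toLp 2 (E → ℝ)).measurable.comp (measurable_pi_lambda _ fun e => ?_)
  exact (Complex.measurable_arg.comp ((measurable_flipPhase e).div_const _)).const_add _

/-- Reduction modulo `2π` may make the flip jump. It differs from its continuous lift by a vector of
the lattice `2πℤ^E`, so `A` splits into countably many measurable pieces on which the two differ by
a translation. -/
lemma exists_hausdorffMeasure_flip_le (hG : G.IsNontrivialStandard) (hW : G.SingleCrossing W e₀)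
    (p : G.genericManifold) {η : ℝ≥0} (hη : 0 < η) :
    ∃ U ∈ 𝓝 p, ∀ A ⊆ U, MeasurableSet A →
      μH[(Fintype.card E : ℝ) - 1] (flip hG hW '' A) ≤
        ((1 + η : ℝ≥0) : ℝ≥0∞) ^ ((Fintype.card E : ℝ) - 1) *
          μH[(Fintype.card E : ℝ) - 1] A := by
  have hD := hG.dirichletLeaf
  have hgen : ∀ x : G.genericManifold, ∃ b, G.GenericWave x.1.ofLp b := fun x =>
    ((mem_genericManifold_iff hG _).1 x.2).2
  obtain ⟨a, ha⟩ := hgen p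
  obtain ⟨U, hU, hUA⟩ := ha.exists_hausdorffMeasure_flipLift_le hD hW hη
  refine ⟨Subtype.val ⁻¹' U, continuous_subtype_val.continuousAt.preimage_mem_nhds hU,
    fun A hA hAm => ?_⟩
  let T : (E → ℤ) → EuclideanSpace ℝ E := fun k => WithLp.toLp 2 fun e => k e * (2 * Real.pi)
  let B : (E → ℤ) → Set G.genericManifold := fun k =>
    A ∩ {x | G.flipMap W x.1 = G.flipLift W p.1 x.1 + T k}
  have hBm : ∀ k, MeasurableSet (B k) := fun k => hAm.inter
    (measurableSet_eq_fun (measurable_flipMap.comp measurable_subtype_coe)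
      (((measurable_flipLift p.1).comp measurable_subtype_coe).add_const _))
  have hT : ∀ k k', T k = T k' → k = k' := by
    intro k k' h
    ext e
    have h1 : (k e : ℝ) * (2 * Real.pi) = k' e * (2 * Real.pi) :=
      congrFun (congrArg WithLp.ofLp h) e
    exact_mod_cast mul_right_cancel₀ Real.two_pi_pos.ne' h1
  have hBd : Pairwise (Function.onFun Disjoint B) := by
    intro k k' hkk
    refine Set.disjoint_left.2 fun x hx hx' => hkk (hT _ _ ?_)
    have h1 : G.flipMap W x.1 = _ := hx.2
    have h2 : G.flipMap W x.1 = _ := hx'.2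
    exact add_left_cancel (h1.symm.trans h2)
  have hBu : A = ⋃ k, B k := by
    refine Set.Subset.antisymm (fun x hx => ?_) (Set.iUnion_subset fun k => Set.inter_subset_left)
    obtain ⟨b, hb⟩ := hgen x
    have : ∀ e, ∃ k : ℤ, G.flipMap W x.1 e = G.flipLift W p.1 x.1 e + k * (2 * Real.pi) :=
      fun e => exists_int_of_exp_eq (by rw [hb.exp_flipMap hD, ha.exp_flipLift hD hb])
    choose k hk using this
    exact Set.mem_iUnion.2 ⟨k, hx, PiLp.ext hk⟩
  have hle : ∀ k, μH[(Fintype.card E : ℝ) - 1] (flip hG hW '' B k) ≤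
      ((1 + η : ℝ≥0) : ℝ≥0∞) ^ ((Fintype.card E : ℝ) - 1) *
          μH[(Fintype.card E : ℝ) - 1] (B k) := by
    intro k
    rw [hausdorffMeasure_image_val, hausdorffMeasure_image_val]
    have h1 : Subtype.val '' (flip hG hW '' B k) =
        IsometryEquiv.addRight (T k) '' (G.flipLift W p.1 '' (Subtype.val '' B k)) := by
      rw [Set.image_image, Set.image_image, Set.image_image]
      exact Set.image_congr fun x hx => hx.2
    rw [h1, IsometryEquiv.hausdorffMeasure_image]
    refine hUA _ ?_ ?_
    · rintro _ ⟨x, hx, rfl⟩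
      exact hA hx.1
    · rintro _ ⟨x, hx, rfl⟩
      exact hgen x
  calc μH[(Fintype.card E : ℝ) - 1] (flip hG hW '' A)
      = μH[(Fintype.card E : ℝ) - 1] (⋃ k, flip hG hW '' B k) := by
        rw [← Set.image_iUnion, ← hBu]
    _ ≤ ∑' k, μH[(Fintype.card E : ℝ) - 1] (flip hG hW '' B k) := measure_iUnion_le _
    _ ≤ ∑' k, ((1 + η : ℝ≥0) : ℝ≥0∞) ^ ((Fintype.card E : ℝ) - 1) *
          μH[(Fintype.card E : ℝ) - 1] (B k) := ENNReal.tsum_le_tsum hle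
    _ = _ := by rw [ENNReal.tsum_mul_left, ← measure_iUnion hBd hBm, ← hBu]

/-- The local comparisons give only `μ (flip A) ≤ μ A`. The flip is an involution, so the same
inequality applied to `flip A` is the opposite one, and images are preimages. -/
lemma measurePreserving_flip_hausdorffMeasure (hG : G.IsNontrivialStandard)
    (hW : G.SingleCrossing W e₀) :
    MeasurePreserving (flip hG hW) (μH[(Fintype.card E : ℝ) - 1]) (μH[(Fintype.card E : ℝ) - 1]) := by
  have hd : (0 : ℝ) ≤ (Fintype.card E : ℝ) - 1 := by
    have : (1 : ℝ) ≤ Fintype.card E := by exact_mod_cast Fintype.card_pos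
    linarith
  have hle : ∀ A : Set G.genericManifold, MeasurableSet A →
      μH[(Fintype.card E : ℝ) - 1] (flip hG hW '' A) ≤ μH[(Fintype.card E : ℝ) - 1] A := by
    refine fun A hA => measure_image_le_of_local (fun p c hc => ?_) hA
    obtain ⟨η, hη, hηc⟩ : ∃ η : ℝ≥0, 0 < η ∧ (1 + η) ^ ((Fintype.card E : ℝ) - 1) < c := by
      have h1 : Filter.Tendsto (fun η : ℝ≥0 => (1 + η) ^ ((Fintype.card E : ℝ) - 1)) (𝓝[>] 0)
          (𝓝 ((1 + 0) ^ ((Fintype.card E : ℝ) - 1))) := by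
        refine Filter.Tendsto.mono_left ?_ nhdsWithin_le_nhds
        exact Continuous.tendsto ((NNReal.continuous_rpow_const hd).comp
          (continuous_const.add continuous_id)) 0
      have h2 := h1.eventually (gt_mem_nhds (show _ < c by simpa using hc))
      obtain ⟨η, h3, h4⟩ := (h2.and self_mem_nhdsWithin).exists
      exact ⟨η, h4, h3⟩
    obtain ⟨U, hU, h⟩ := exists_hausdorffMeasure_flip_le hG hW p hη
    refine ⟨U, hU, fun B hB hBm => (h B hB hBm).trans ?_⟩
    gcongr
    rw [← ENNReal.coe_rpow_of_nonneg _ hd]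
    exact_mod_cast hηc.le
  have himg : ∀ A, flip hG hW '' A = flip hG hW ⁻¹' A :=
    congrFun (Function.Involutive.image_eq_preimage_symm (flip_flip hG hW))
  refine ⟨measurable_flip hG hW, Measure.ext fun A hA => ?_⟩
  rw [Measure.map_apply (measurable_flip hG hW) hA, ← himg]
  refine le_antisymm (hle A hA) ?_
  have h1 := hle (flip hG hW '' A) (by rw [himg]; exact measurable_flip hG hW hA)
  rwa [himg (flip hG hW '' A), Set.preimage_image_eq _
    (Function.Involutive.injective (flip_flip hG hW))] at h1

lemma measurePreserving_flip (hG : G.IsNontrivialStandard) (hW : G.SingleCrossing W e₀) :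
    MeasurePreserving (flip hG hW) G.fluxMeasure G.fluxMeasure := by
  have hD := hG.dirichletLeaf
  have hm : Measurable fun x : G.genericManifold => ENNReal.ofReal (G.normalDotLen x.1.ofLp) :=
    (measurable_normalDotLen.comp measurable_subtype_coe).ennreal_ofReal
  refine ⟨measurable_flip hG hW, Measure.ext fun A hA => ?_⟩
  rw [Measure.map_apply (measurable_flip hG hW) hA, fluxMeasure, withDensity_apply _ hA,
    withDensity_apply _ (measurable_flip hG hW hA),
    ← (measurePreserving_flip_hausdorffMeasure hG hW).setLIntegral_comp_preimage hA hm]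
  refine lintegral_congr fun x => ?_
  obtain ⟨-, a, ha⟩ := (mem_genericManifold_iff hG _).1 x.2
  have hx : (flip hG hW x).1 = G.flipMap W x.1 := rfl
  rw [hx, ha.normalDotLen_eq hD, (ha.flip hD hW (ha.isFlip_flipMap hD)).normalDotLen_eq hD,
    weight_flipWave, normalVec_flipWave]

lemma measurePreserving_flip_bgMeasure (hG : G.IsNontrivialStandard)
    (hW : G.SingleCrossing W e₀) :
    MeasurePreserving (flip hG hW) G.bgMeasure G.bgMeasure :=
  (measurePreserving_flip hG hW).smul_measure _

end QuantumGraph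


/-! ### Finiteness of the surface measure. -/

open scoped ComplexConjugate ENNReal NNReal Topology

/-- The spectrum of a normal element is stable under perturbations. -/
lemma IsStarNormal.exists_mem_spectrum_norm_sub_le {A : Type*} [CStarAlgebra A] [Nontrivial A]
    {a b : A} [IsStarNormal a] {c : ℂ} (hc : c ∈ spectrum ℂ b) :
    ∃ l ∈ spectrum ℂ a, ‖l - c‖ ≤ ‖a - b‖ := by
  by_cases hca : c ∈ spectrum ℂ a
  · exact ⟨c, hca, by simp⟩
  rw [spectrum.mem_iff, not_not] at hca
  obtain ⟨u, hu⟩ := hca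
  have hnot : ‖((u⁻¹ : Aˣ) : A)‖⁻¹ ≤ ‖a - b‖ := by
    by_contra hcon
    rw [spectrum.mem_iff] at hc
    apply hc
    have : algebraMap ℂ A c - b = u.add (a - b) (not_le.1 hcon) := by
      rw [Units.val_add, hu]; abel
    rw [this]
    exact Units.isUnit _
  have hstar : IsStarNormal (u : A) := by
    rw [hu]
    refine ⟨?_⟩
    rw [star_sub, ← algebraMap_star_comm]
    exact ((Algebra.commute_algebraMap_left _ _).sub_right (Algebra.commute_algebraMap_left _ _)).sub_left
      ((Algebra.commute_algebraMap_right _ _).sub_right ‹IsStarNormal a›.star_comm_self)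
  have hinv : IsStarNormal ((u⁻¹ : Aˣ) : A) := by
    refine ⟨?_⟩
    have h1 : star ((u⁻¹ : Aˣ) : A) = ((star u)⁻¹ : Aˣ) := by simp [← Units.coe_star_inv]
    have h2 : Commute (star u) u := Units.ext hstar.star_comm_self
    rw [h1]
    exact congrArg Units.val (h2.inv_inv).eq
  -- The resolvent of a normal element is normal, so its norm is the modulus of some `z` in its
  -- spectrum, and `z⁻¹` is the difference between `c` and a spectral value of `a`.
  obtain ⟨z, hz, hzr⟩ := spectrum.exists_nnnorm_eq_spectralRadius ((u⁻¹ : Aˣ) : A)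
  rw [IsStarNormal.spectralRadius_eq_nnnorm] at hzr
  have hzn : ‖z‖ = ‖((u⁻¹ : Aˣ) : A)‖ := by
    have : ‖z‖₊ = ‖((u⁻¹ : Aˣ) : A)‖₊ := by exact_mod_cast hzr
    exact congrArg NNReal.toReal this
  have hz' : z⁻¹ ∈ spectrum ℂ (u : A) := by
    rwa [spectrum.inv₀_mem_iff]
  rw [hu, ← spectrum.singleton_sub_eq] at hz'
  obtain ⟨c', rfl, l, hl, hlz⟩ := hz'
  refine ⟨l, hl, ?_⟩
  rw [norm_sub_rev]
  have hlz : c' - l = z⁻¹ := hlz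
  rw [hlz, norm_inv, hzn]
  exact hnot

lemma abs_le_mul_norm_exp_sub {s t : ℝ} (h : |s - t| ≤ Real.pi) :
    |s - t| ≤ Real.pi / 2 * ‖Complex.exp (-(Complex.I * (s : ℂ))) -
      Complex.exp (-(Complex.I * (t : ℂ)))‖ := by
  have h1 : Complex.exp (-(Complex.I * (s : ℂ))) - Complex.exp (-(Complex.I * (t : ℂ))) =
      Complex.exp (-(Complex.I * (s : ℂ))) *
        -(Complex.exp (Complex.I * ((s - t : ℝ) : ℂ)) - 1) := by
    rw [mul_neg, mul_sub, ← Complex.exp_add]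
    have : -(Complex.I * (s : ℂ)) + Complex.I * ((s - t : ℝ) : ℂ) = -(Complex.I * (t : ℂ)) := by
      push_cast; ring
    rw [this]; ring
  have h2 : ‖Complex.exp (-(Complex.I * (s : ℂ)))‖ = 1 := by
    have : -(Complex.I * (s : ℂ)) = ((-s : ℝ) : ℂ) * Complex.I := by push_cast; ring
    rw [this, Complex.norm_exp_ofReal_mul_I]
  rw [h1, norm_mul, h2, one_mul, norm_neg, Complex.norm_exp_I_mul_ofReal_sub_one, norm_mul]
  have h3 := Real.mul_abs_le_abs_sin (x := (s - t) / 2) (by rw [abs_div, abs_two]; linarith)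
  rw [abs_div, abs_two] at h3
  have hpi := Real.pi_pos
  rw [Real.norm_eq_abs, Real.norm_eq_abs, abs_two]
  have h4 : Real.pi / 2 * (2 * (2 / Real.pi * (|s - t| / 2))) = |s - t| := by field_simp
  calc |s - t| = Real.pi / 2 * (2 * (2 / Real.pi * (|s - t| / 2))) := h4.symm
    _ ≤ _ := by gcongr

namespace QuantumGraph

open Matrix

variable {V E : Type*} {G : QuantumGraph V E} [Fintype E] [DecidableEq V] [DecidableEq E]

/-! ### The surface measure is finite -/

/-- `S` is real and symmetric up to reversals, so its adjoint composed with it is reversed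
scattering applied twice. -/
lemma scattering_mem_unitaryGroup (hD : G.DirichletLeaf) :
    G.scattering ∈ Matrix.unitaryGroup (E × Bool) ℂ := by
  rw [Matrix.mem_unitaryGroup_iff']
  ext i j
  have h1 := scattering_involutive hD (Pi.single j 1) i
  have h2 : ∀ c, (G.scattering *ᵥ (Pi.single j 1 : E × Bool → ℂ)) c = G.scattering c j := by
    intro c; simp
  simp only [h2] at h1
  rw [Matrix.mul_apply]
  have h3 : ∀ k, star G.scattering i k * G.scattering k j =
      G.scattering (rev i) (rev k) * G.scattering (rev (rev k)) j := by
    intro k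
    rw [rev_rev, Matrix.star_apply]
    have h4 := conj_scattering (G := G) k i
    have h5 := scattering_symm G (rev k) i
    rw [rev_rev] at h5
    rw [← h5]; exact congrArg (· * _) h4
  rw [Finset.sum_congr rfl fun k _ => h3 k,
    sum_rev fun k => G.scattering (rev i) k * G.scattering (rev k) j]
  rw [Matrix.mulVec, dotProduct] at h1
  rw [h1, Matrix.one_apply, Pi.single_apply]

lemma phaseMatrix_mem_unitaryGroup (y : E → ℝ) :
    phaseMatrix y ∈ Matrix.unitaryGroup (E × Bool) ℂ := by
  rw [Matrix.mem_unitaryGroup_iff', phaseMatrix, Matrix.star_eq_conjTranspose,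
    Matrix.diagonal_conjTranspose, Matrix.diagonal_mul_diagonal, ← Matrix.diagonal_one]
  congr 1
  ext d
  exact conj_exp_I_mul _

variable (G) in
/-- The quantum map. -/
noncomputable def quantumMap (y : E → ℝ) : Matrix (E × Bool) (E × Bool) ℂ :=
  phaseMatrix y * G.scattering

open scoped Matrix.Norms.L2Operator in
lemma norm_quantumMap_sub_le [Nonempty E] (hD : G.DirichletLeaf) {y y' : E → ℝ} {δ : ℝ}
    (h : ∀ e, |y e - y' e| ≤ δ) : ‖G.quantumMap y - G.quantumMap y'‖ ≤ δ := by
  have hδ : 0 ≤ δ := by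
    obtain ⟨e⟩ := ‹Nonempty E›
    exact (abs_nonneg _).trans (h e)
  rw [quantumMap, quantumMap, ← sub_mul]
  refine (norm_mul_le _ _).trans ?_
  have h1 : ‖G.scattering‖ = 1 := CStarRing.norm_of_mem_unitary (scattering_mem_unitaryGroup hD)
  rw [h1, mul_one, phaseMatrix, phaseMatrix, Matrix.diagonal_sub, Matrix.l2_opNorm_diagonal,
    pi_norm_le_iff_of_nonneg hδ]
  intro d
  have h2 : Complex.exp (Complex.I * (y d.1 : ℂ)) - Complex.exp (Complex.I * (y' d.1 : ℂ)) =
      Complex.exp ((y' d.1 : ℂ) * Complex.I) *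
        (Complex.exp (Complex.I * ((y d.1 - y' d.1 : ℝ) : ℂ)) - 1) := by
    rw [mul_sub, ← Complex.exp_add, mul_one]
    congr 2
    · push_cast; ring
    · ring
  rw [h2, norm_mul, Complex.norm_exp_ofReal_mul_I, one_mul]
  refine Real.norm_exp_I_mul_ofReal_sub_one_le.trans (h _)

/-- Subtracting `t` from every phase multiplies the quantum map by `e^{-it}`, so its eigenvalue `1`
at `x` becomes `e^{-it}`. The secular manifold is thus seen as the eigenphases over the slice of
differences `x e - x e₀`. -/
lemma mem_spectrum_quantumMap {x : E → ℝ} (hx : G.secular x 0 = 0) (t : ℝ) :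
    Complex.exp (-(Complex.I * (t : ℂ))) ∈ spectrum ℂ (G.quantumMap fun e => x e - t) := by
  rw [spectrum.mem_iff, Matrix.isUnit_iff_isUnit_det]
  have h1 : (algebraMap ℂ (Matrix (E × Bool) (E × Bool) ℂ)) (Complex.exp (-(Complex.I * (t : ℂ)))) -
      G.quantumMap (fun e => x e - t) = Complex.exp (-(Complex.I * (t : ℂ))) • G.secMatrix x := by
    rw [secMatrix, smul_sub, Algebra.algebraMap_eq_smul_one, quantumMap, ← Matrix.smul_mul]
    congr 2
    ext i j
    simp only [phaseMatrix, Matrix.smul_apply, Matrix.diagonal_apply, smul_eq_mul]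
    split_ifs
    · rw [← Complex.exp_add]; congr 1; push_cast; ring
    · simp
  rw [h1, Matrix.det_smul, ← secular_eq_det, hx]
  simp

lemma isStarNormal_quantumMap (hD : G.DirichletLeaf) (y : E → ℝ) :
    IsStarNormal (G.quantumMap y) := by
  have h : G.quantumMap y ∈ Matrix.unitaryGroup (E × Bool) ℂ :=
    mul_mem (phaseMatrix_mem_unitaryGroup y) (scattering_mem_unitaryGroup hD)
  refine ⟨?_⟩
  rw [Commute, SemiconjBy, Matrix.mem_unitaryGroup_iff.1 h, Matrix.mem_unitaryGroup_iff'.1 h]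

open scoped Matrix.Norms.L2Operator in
lemma exists_root_quantumMap [Nonempty E] (hD : G.DirichletLeaf) {x y : E → ℝ} {t δ : ℝ}
    (hx : G.secular x 0 = 0) (h : ∀ e, |x e - t - y e| ≤ δ) :
    ∃ l ∈ (G.quantumMap y).charpoly.roots, ‖l - Complex.exp (-(Complex.I * (t : ℂ)))‖ ≤ δ := by
  have := isStarNormal_quantumMap hD y
  obtain ⟨l, hl, hlt⟩ := IsStarNormal.exists_mem_spectrum_norm_sub_le (a := G.quantumMap y)
    (mem_spectrum_quantumMap hx t)
  refine ⟨l, ?_, hlt.trans ?_⟩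
  · rw [Polynomial.mem_roots (Matrix.charpoly_monic _).ne_zero]
    exact Matrix.mem_spectrum_iff_isRoot_charpoly.1 hl
  · rw [norm_sub_rev]
    exact norm_quantumMap_sub_le hD h

lemma exists_int_grid {n : ℕ} (hn : 0 < n) {s : ℝ} (h1 : -(2 * Real.pi) < s)
    (h2 : s < 2 * Real.pi) :
    ∃ k : Fin n, |s - (4 * Real.pi / n * k - 2 * Real.pi)| ≤ 4 * Real.pi / n := by
  have hn' : (0 : ℝ) < n := by exact_mod_cast hn
  have hpi := Real.pi_pos
  set c : ℝ := 4 * Real.pi / n with hc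
  have hc0 : 0 < c := by positivity
  have hcn : c * n = 4 * Real.pi := by rw [hc]; field_simp
  have h0 : 0 ≤ (s + 2 * Real.pi) / c := div_nonneg (by linarith) hc0.le
  refine ⟨⟨⌊(s + 2 * Real.pi) / c⌋₊, ?_⟩, ?_⟩
  · rw [Nat.floor_lt h0, div_lt_iff₀ hc0]
    linarith
  · have h3 := Nat.floor_le h0
    have h4 := Nat.lt_floor_add_one ((s + 2 * Real.pi) / c)
    rw [le_div_iff₀ hc0] at h3
    rw [div_lt_iff₀ hc0] at h4
    rw [abs_le]
    constructor <;> simp only [] <;> linarith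

lemma eucl_norm_le_sum (v : EuclideanSpace ℝ E) : ‖v‖ ≤ ∑ e, |v e| := by
  conv_lhs => rw [eucl_eq_sum v]
  refine (norm_sum_le _ _).trans (Finset.sum_le_sum fun e _ => ?_)
  rw [norm_smul, EuclideanSpace.single, PiLp.norm_single]
  simp

/-- The points of the grid used to cover the secular manifold. -/
noncomputable def gridPoint (e₀ : E) {n : ℕ} (k : {e // e ≠ e₀} → Fin n) (e : E) : ℝ :=
  if h : e ≠ e₀ then 4 * Real.pi / n * (k ⟨e, h⟩ : ℕ) - 2 * Real.pi else 0

/-- The sets of the grid used to cover the secular manifold. -/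
def gridSet (e₀ : E) {n : ℕ} (k : {e // e ≠ e₀} → Fin n) (l : ℂ) (b : Bool) :
    Set (EuclideanSpace ℝ E) :=
  {x | (∀ e, x e ∈ Set.Ico 0 (2 * Real.pi)) ∧
    (∀ e, |x e - x e₀ - gridPoint e₀ k e| ≤ 4 * Real.pi / n) ∧
    ‖l - Complex.exp (-(Complex.I * (x e₀ : ℂ)))‖ ≤ 4 * Real.pi / n ∧
    (x e₀ < Real.pi ↔ b = true)}

/-- Closeness of `e^{-i x e₀}` to `l` bounds a chord, and the flag `b` keeps `x e₀` in a half
circle, where chords control arcs. The other coordinates follow from their differences with `x e₀`.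
-/
lemma ediam_gridSet_le (e₀ : E) {n : ℕ} (k : {e // e ≠ e₀} → Fin n) (l : ℂ) (b : Bool) :
    Metric.ediam (gridSet e₀ k l b) ≤
      ENNReal.ofReal (Fintype.card E * (12 * Real.pi ^ 2) / n) := by
  refine Metric.ediam_le fun x hx y hy => ?_
  rw [edist_dist]
  refine ENNReal.ofReal_le_ofReal ?_
  have hpi := Real.pi_pos
  have hpi3 := Real.pi_gt_three
  have h0 : |x e₀ - y e₀| ≤ Real.pi := by
    have h1 := hx.1 e₀
    have h2 := hy.1 e₀
    have h3 : x e₀ < Real.pi ↔ y e₀ < Real.pi := hx.2.2.2.trans hy.2.2.2.symm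
    rw [abs_le]
    by_cases h : x e₀ < Real.pi
    · have := h3.1 h
      constructor <;> linarith [h1.1, h2.1]
    · have := mt h3.2 h
      push Not at h this
      constructor <;> linarith [h1.2, h2.2]
  have h1 : |x e₀ - y e₀| ≤ 4 * Real.pi ^ 2 / n := by
    refine (abs_le_mul_norm_exp_sub h0).trans ?_
    have h2 : ‖Complex.exp (-(Complex.I * (x e₀ : ℂ))) - Complex.exp (-(Complex.I * (y e₀ : ℂ)))‖
        ≤ 4 * Real.pi / n + 4 * Real.pi / n := by
      rw [← sub_sub_sub_cancel_left _ _ l]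
      refine (norm_sub_le _ _).trans ?_
      linarith [hx.2.2.1, hy.2.2.1]
    calc Real.pi / 2 * _ ≤ Real.pi / 2 * (4 * Real.pi / n + 4 * Real.pi / n) := by gcongr
      _ = 4 * Real.pi ^ 2 / n := by ring
  have h2 : ∀ e, |(x - y) e| ≤ 12 * Real.pi ^ 2 / n := by
    intro e
    have e1 := abs_le.1 (hx.2.1 e)
    have e2 := abs_le.1 (hy.2.1 e)
    have e3 := abs_le.1 h1
    have e4 : 8 * Real.pi / n ≤ 8 * Real.pi ^ 2 / n := by gcongr; nlinarith
    have e5 : 12 * Real.pi ^ 2 / n = 8 * Real.pi ^ 2 / n + 4 * Real.pi ^ 2 / n := by ring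
    have e6 : 8 * Real.pi / n = 4 * Real.pi / n + 4 * Real.pi / n := by ring
    rw [PiLp.sub_apply, abs_le]
    constructor <;> linarith
  rw [dist_eq_norm]
  refine (eucl_norm_le_sum _).trans ((Finset.sum_le_sum fun e _ => h2 e).trans ?_)
  rw [Finset.sum_const, Finset.card_univ, nsmul_eq_mul]
  exact le_of_eq (by ring)

variable [Fintype V]

/-- There are `n^(E-1)` cells for the differences `x e - x e₀`. Over each cell `e^{-i x e₀}` is
close to one of at most `2E` eigenvalues at the grid point, so a bounded number of sets per cell, of
diameter `O(1/n)`, covers the manifold. The sums of diameters to the power `E - 1` stay bounded. -/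
theorem hausdorffMeasure_genericManifold_lt_top (hG : G.IsNontrivialStandard) :
    μH[(Fintype.card E : ℝ) - 1] G.genericManifold < ∞ := by
  have hne := hG.nonempty_edges
  have hD := hG.dirichletLeaf
  obtain ⟨e₀⟩ := id hne
  have hcard : Fintype.card {e // e ≠ e₀} = Fintype.card E - 1 := by
    simp
  have hcard1 : 1 ≤ Fintype.card E := Fintype.card_pos
  have hd : (Fintype.card E : ℝ) - 1 = ((Fintype.card {e // e ≠ e₀} : ℕ) : ℝ) := by
    rw [hcard, Nat.cast_sub hcard1, Nat.cast_one]
  set d := Fintype.card {e // e ≠ e₀} with hd'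
  set K : ℝ := Fintype.card E * (12 * Real.pi ^ 2) with hK
  let ι : ℕ → Type _ := fun n => Σ k : {e // e ≠ e₀} → Fin n,
    {l // l ∈ (G.quantumMap (gridPoint e₀ k)).charpoly.roots.toFinset} × Bool
  have hcov : ∀ᶠ n : ℕ in Filter.atTop, G.genericManifold ⊆
      ⋃ i : ι n, gridSet e₀ i.1 i.2.1.1 i.2.2 := by
    filter_upwards [Filter.eventually_gt_atTop 0] with n hn x hx
    obtain ⟨hbox, a, ha⟩ := (mem_genericManifold_iff hG x).1 hx
    have hpi := Real.pi_pos
    have hk : ∀ e : {e // e ≠ e₀}, ∃ k : Fin n,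
        |x e - x e₀ - (4 * Real.pi / n * k - 2 * Real.pi)| ≤ 4 * Real.pi / n := fun e =>
      exists_int_grid hn (by linarith [(hbox e).1, (hbox e₀).2])
        (by linarith [(hbox e).2, (hbox e₀).1])
    choose k hk using hk
    have hy : ∀ e, |x e - x e₀ - gridPoint e₀ k e| ≤ 4 * Real.pi / n := by
      intro e
      by_cases h : e = e₀
      · subst h
        simp [gridPoint]
        positivity
      · have := hk ⟨e, h⟩
        simpa [gridPoint, h] using this
    obtain ⟨l, hl, hlt⟩ := exists_root_quantumMap hD ha.secular_eq_zero hy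
    exact Set.mem_iUnion.2 ⟨⟨k, ⟨l, by simpa using hl⟩, decide (x e₀ < Real.pi)⟩, hbox, hy, hlt,
      by simp⟩
  have h0 : Filter.Tendsto (fun n : ℕ => ENNReal.ofReal (K / n)) Filter.atTop (𝓝 0) := by
    rw [← ENNReal.ofReal_zero]
    exact ENNReal.tendsto_ofReal (tendsto_const_div_atTop_nhds_zero_nat K)
  have hmain := Measure.hausdorffMeasure_le_liminf_sum ((Fintype.card E : ℝ) - 1) G.genericManifold
    (l := Filter.atTop) (fun n : ℕ => ENNReal.ofReal (K / n)) h0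
    (fun n (i : ι n) => gridSet e₀ i.1 i.2.1.1 i.2.2)
    (Filter.Eventually.of_forall fun n i => ediam_gridSet_le _ _ _ _) hcov
  refine hmain.trans_lt (lt_of_le_of_lt (Filter.liminf_le_of_frequently_le'
    (x := (2 * Fintype.card (E × Bool) : ℕ) * ENNReal.ofReal K ^ d)
    (Filter.Eventually.frequently ?_)) ?_)
  · filter_upwards [Filter.eventually_gt_atTop 0] with n hn
    have hn' : (0 : ℝ) < n := by exact_mod_cast hn
    have h1 : Fintype.card (ι n) ≤ n ^ d * (2 * Fintype.card (E × Bool)) := by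
      rw [Fintype.card_sigma]
      have h2 : ∀ k : {e // e ≠ e₀} → Fin n, Fintype.card
          ({l // l ∈ (G.quantumMap (gridPoint e₀ k)).charpoly.roots.toFinset} × Bool) ≤
          2 * Fintype.card (E × Bool) := by
        intro k
        rw [Fintype.card_prod, Fintype.card_bool, mul_comm, Fintype.card_coe]
        refine Nat.mul_le_mul_left _ ((Multiset.toFinset_card_le _).trans ?_)
        refine (Polynomial.card_roots' _).trans ?_
        rw [Matrix.charpoly_natDegree_eq_dim]
      refine (Finset.sum_le_sum fun k _ => h2 k).trans ?_
      rw [Finset.sum_const, Finset.card_univ, Fintype.card_fun, Fintype.card_fin, smul_eq_mul]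
    calc ∑ i : ι n, Metric.ediam (gridSet e₀ i.1 i.2.1.1 i.2.2) ^ ((Fintype.card E : ℝ) - 1)
        ≤ ∑ i : ι n, ENNReal.ofReal (K / n) ^ d := by
          refine Finset.sum_le_sum fun i _ => ?_
          rw [hd, ENNReal.rpow_natCast]
          gcongr
          exact ediam_gridSet_le _ _ _ _
      _ = (Fintype.card (ι n) : ℝ≥0∞) * ENNReal.ofReal (K / n) ^ d := by
          rw [Finset.sum_const, Finset.card_univ, nsmul_eq_mul]
      _ ≤ ((n ^ d * (2 * Fintype.card (E × Bool)) : ℕ) : ℝ≥0∞) * ENNReal.ofReal (K / n) ^ d := by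
          gcongr
      _ = (2 * Fintype.card (E × Bool) : ℕ) * ((n : ℝ≥0∞) * ENNReal.ofReal (K / n)) ^ d := by
          rw [mul_pow]; push_cast; ring
      _ = (2 * Fintype.card (E × Bool) : ℕ) * ENNReal.ofReal K ^ d := by
          rw [← ENNReal.ofReal_natCast n, ← ENNReal.ofReal_mul hn'.le, mul_div_cancel₀ _ hn'.ne']
  · exact ENNReal.mul_lt_top (ENNReal.natCast_lt_top _) (ENNReal.pow_lt_top ENNReal.ofReal_lt_top)

lemma GenericWave.normalDotLen_le [Nonempty E] (hD : G.DirichletLeaf) {x : E → ℝ}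
    {a : E × Bool → ℂ} (h : G.GenericWave x a) :
    G.normalDotLen x ≤ ‖(WithLp.toLp 2 G.len : EuclideanSpace ℝ E)‖ := by
  have h1 : G.weight a = inner ℝ (normalVec a) (WithLp.toLp 2 G.len) := by
    rw [inner_normalVec]; rfl
  rw [h.normalDotLen_eq hD, div_le_iff₀ (norm_pos_iff.2 (normalVec_ne_zero h.ne_zero)), h1,
    mul_comm]
  exact real_inner_le_norm _ _

theorem fluxMeasure_univ_lt_top (hG : G.IsNontrivialStandard) :
    G.fluxMeasure Set.univ < ∞ := by
  have hne := hG.nonempty_edges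
  rw [fluxMeasure, withDensity_apply _ MeasurableSet.univ]
  have h1 : ∀ x : G.genericManifold, ENNReal.ofReal (G.normalDotLen x.1.ofLp) ≤
      ENNReal.ofReal ‖(WithLp.toLp 2 G.len : EuclideanSpace ℝ E)‖ := fun x => by
    obtain ⟨-, a, ha⟩ := (mem_genericManifold_iff hG _).1 x.2
    exact ENNReal.ofReal_le_ofReal (ha.normalDotLen_le hG.dirichletLeaf)
  refine (lintegral_mono h1).trans_lt ?_
  rw [lintegral_const, Measure.restrict_apply_univ, hausdorffMeasure_image_val, Set.image_univ,
    Subtype.range_coe]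
  exact ENNReal.mul_lt_top ENNReal.ofReal_lt_top (hausdorffMeasure_genericManifold_lt_top hG)

end QuantumGraph


/-! ### Positivity of the surface measure. -/

namespace QuantumGraph

open scoped ComplexConjugate ENNReal NNReal Topology
open Matrix

variable {V E : Type*} {G : QuantumGraph V E} [Fintype E] [DecidableEq V] [DecidableEq E]

/-! ### The real form of the secular function -/

lemma conj_det_scattering : conj G.scattering.det = G.scattering.det := by
  rw [RingHom.map_det]
  congr 1
  ext i j
  exact conj_scattering G i j

lemma det_scattering_mul_self (hD : G.DirichletLeaf) :
    G.scattering.det * G.scattering.det = 1 := by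
  have h := congrArg Matrix.det (Matrix.mem_unitaryGroup_iff'.1 (scattering_mem_unitaryGroup hD))
  rw [Matrix.det_mul, Matrix.star_eq_conjTranspose, Matrix.det_conjTranspose, Matrix.det_one] at h
  exact (congrArg (· * _) conj_det_scattering).symm.trans h

/-- For `U` unitary, `(1 - U)* U = -(1 - U)`. Taking determinants costs no sign, since there are
evenly many directed edges. -/
lemma conj_secular (hD : G.DirichletLeaf) (x : E → ℝ) : conj (G.secular x 0) =
    G.scattering.det * Complex.exp (-(2 * Complex.I * ((∑ e, x e : ℝ) : ℂ))) * G.secular x 0 := by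
  have hU : star (G.quantumMap x) * G.quantumMap x = 1 :=
    Matrix.mem_unitaryGroup_iff'.1 (mul_mem (phaseMatrix_mem_unitaryGroup x)
      (scattering_mem_unitaryGroup hD))
  have h1 : star (G.secMatrix x) * G.quantumMap x = -G.secMatrix x := by
    have : G.secMatrix x = 1 - G.quantumMap x := rfl
    rw [this, star_sub, star_one, sub_mul, hU, one_mul, neg_sub]
  have h2 := congrArg Matrix.det h1
  rw [Matrix.det_mul, Matrix.det_neg, Fintype.card_prod, Fintype.card_bool, pow_mul',
    neg_one_sq, one_pow, one_mul, Matrix.star_eq_conjTranspose, Matrix.det_conjTranspose,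
    ← secular_eq_det, quantumMap, Matrix.det_mul] at h2
  have h3 : (phaseMatrix x).det = Complex.exp (2 * Complex.I * ((∑ e, x e : ℝ) : ℂ)) := by
    rw [phaseMatrix, Matrix.det_diagonal, ← Complex.exp_sum, Fintype.sum_prod_type]
    congr 1
    simp [Finset.mul_sum, ← two_mul, mul_assoc]
  have h6 := det_scattering_mul_self (G := G) hD
  have h7 : Complex.exp (2 * Complex.I * ((∑ e, x e : ℝ) : ℂ)) *
      Complex.exp (-(2 * Complex.I * ((∑ e, x e : ℝ) : ℂ))) = 1 := by
    rw [← Complex.exp_add]; simp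
  rw [h3] at h2
  have h2 : conj (G.secular x 0) * (Complex.exp (2 * Complex.I * ((∑ e, x e : ℝ) : ℂ)) *
    G.scattering.det) = G.secular x 0 := h2
  set P := Complex.exp (2 * Complex.I * ((∑ e, x e : ℝ) : ℂ))
  set Q := Complex.exp (-(2 * Complex.I * ((∑ e, x e : ℝ) : ℂ)))
  linear_combination (-conj (G.secular x 0)) * h7 - conj (G.secular x 0) * P * Q * h6 +
    G.scattering.det * Q * h2

/-- Half of the phase in `conj_secular` is removed by the exponential, and `c` absorbs `det S = ±1`.
A real function is needed so that sign changes produce zeros. -/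
lemma exists_real_secular (hD : G.DirichletLeaf) : ∃ c : ℂ, c ≠ 0 ∧ ∀ x : E → ℝ,
    (c * Complex.exp (-(Complex.I * ((∑ e, x e : ℝ) : ℂ))) * G.secular x 0).im = 0 := by
  obtain ⟨c, hc0, hc⟩ : ∃ c : ℂ, c ≠ 0 ∧ conj c * G.scattering.det = c := by
    by_cases h : 1 + G.scattering.det = 0
    · refine ⟨Complex.I, Complex.I_ne_zero, ?_⟩
      rw [eq_neg_of_add_eq_zero_right h]; simp
    · refine ⟨1 + G.scattering.det, h, ?_⟩
      rw [map_add, map_one, conj_det_scattering]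
      linear_combination det_scattering_mul_self (G := G) hD
  refine ⟨c, hc0, fun x => ?_⟩
  rw [← Complex.conj_eq_iff_im, map_mul, map_mul, conj_secular hD, ← Complex.exp_conj, map_neg,
    map_mul, Complex.conj_I, Complex.conj_ofReal]
  set s : ℂ := ((∑ e, x e : ℝ) : ℂ)
  have h7 : Complex.exp (-(-Complex.I * s)) * Complex.exp (-(2 * Complex.I * s)) =
      Complex.exp (-(Complex.I * s)) := by
    rw [← Complex.exp_add]; congr 1; ring
  linear_combination (Complex.exp (-(Complex.I * s)) * G.secular x 0) * hc +
    (conj c * G.scattering.det * G.secular x 0) * h7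

/-! ### The surface measure is positive -/

variable [Nonempty E]

/-- A fixed column of the adjugate is a kernel vector wherever the secular function vanishes, and it
is continuous in `x`. The requirements of genericity are finitely many nonvanishing conditions on it
and on the gradient, hence open. -/
lemma GenericWave.eventually_generic (hD : G.DirichletLeaf)
    (hconn : G.ConnectedOn Set.univ Set.univ) {p : EuclideanSpace ℝ E} {a : E × Bool → ℂ}
    (h : G.GenericWave p.ofLp a) :
    ∀ᶠ x in 𝓝 p, G.secular x.ofLp 0 = 0 → ∃ b, G.GenericWave x.ofLp b := by
  obtain ⟨κ, hκ0, hκ⟩ := h.exists_adjugate hD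
  obtain ⟨e₀⟩ := id ‹Nonempty E›
  set k₀ : E × Bool := (e₀, true)
  obtain ⟨-, -, hval⟩ := (exists_genericWave_iff hD hconn p.ofLp).1 ⟨a, h⟩
  have hcol : ∀ x : EuclideanSpace ℝ E, G.secular x.ofLp 0 = 0 →
      G.secMatrix x.ofLp *ᵥ (fun d => (G.secMatrix x.ofLp).adjugate d k₀) = 0 := by
    intro x hx
    rw [secular_eq_det] at hx
    have h1 := Matrix.mul_adjugate (G.secMatrix x.ofLp)
    rw [hx, zero_smul] at h1
    ext d
    exact congrFun (congrFun h1 d) k₀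
  have hp := hcol p h.secular_eq_zero
  have hadj0 : (G.secMatrix p.ofLp).adjugate k₀ k₀ ≠ 0 := by
    rw [hκ]
    exact mul_ne_zero (mul_ne_zero hκ0 (h.ne_zero _)) (by simpa using h.ne_zero k₀)
  have hgrad : G.gradSecular p.ofLp e₀ ≠ 0 := by
    rw [h.gradSecular_apply hκ]
    have h2 := norm_ne_zero_iff.2 (h.ne_zero (e₀, true))
    simp [hκ0, h.ne_zero]
  have hval' : ∀ d : E × Bool, G.origin d ∉ G.dirichlet →
      Complex.exp (-(Complex.I * (p.ofLp d.1 : ℂ))) * (G.secMatrix p.ofLp).adjugate d k₀ +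
        (G.secMatrix p.ofLp).adjugate (rev d) k₀ ≠ 0 :=
    hval _ (Function.ne_iff.2 ⟨k₀, hadj0⟩) hp
  have e1 : ∀ᶠ x : EuclideanSpace ℝ E in 𝓝 p, (G.secMatrix x.ofLp).adjugate k₀ k₀ ≠ 0 :=
    (continuous_secMatrix_adjugate k₀ k₀).continuousAt.eventually_ne hadj0
  have e2 : ∀ᶠ x : EuclideanSpace ℝ E in 𝓝 p, G.gradSecular x.ofLp e₀ ≠ 0 :=
    (continuous_gradSecular e₀).continuousAt.eventually_ne hgrad
  have e3 : ∀ᶠ x : EuclideanSpace ℝ E in 𝓝 p, ∀ d : E × Bool, G.origin d ∉ G.dirichlet →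
      Complex.exp (-(Complex.I * (x.ofLp d.1 : ℂ))) * (G.secMatrix x.ofLp).adjugate d k₀ +
        (G.secMatrix x.ofLp).adjugate (rev d) k₀ ≠ 0 := by
    rw [Filter.eventually_all]
    intro d
    by_cases hd : G.origin d ∈ G.dirichlet
    · exact Filter.Eventually.of_forall fun x hx => absurd hd hx
    · have hc : Continuous fun x : EuclideanSpace ℝ E =>
          Complex.exp (-(Complex.I * (x.ofLp d.1 : ℂ))) * (G.secMatrix x.ofLp).adjugate d k₀ +
            (G.secMatrix x.ofLp).adjugate (rev d) k₀ := by
        refine Continuous.add (Continuous.mul (Complex.continuous_exp.comp ?_)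
          (continuous_secMatrix_adjugate _ _)) (continuous_secMatrix_adjugate _ _)
        exact (continuous_const.mul (Complex.continuous_ofReal.comp
          (contDiff_eucl (n := 0) d.1).continuous)).neg
      exact (hc.continuousAt.eventually_ne (hval' d hd)).mono fun x hx _ => hx
  filter_upwards [e1, e2, e3] with x h1 h2 h3 hx
  refine (exists_genericWave_iff hD hconn x.ofLp).2 ⟨hx, fun h0 => h2 (by rw [h0]; rfl),
    fun b hb0 hb d hd => ?_⟩
  have hne : (fun d => (G.secMatrix x.ofLp).adjugate d k₀) ≠ 0 := Function.ne_iff.2 ⟨k₀, h1⟩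
  obtain ⟨z, rfl⟩ := Matrix.exists_smul_of_adjugate_ne_zero
    (fun h0 => h1 (by rw [h0]; rfl)) (hcol x hx) hne hb
  have hz : z ≠ 0 := by rintro rfl; simp at hb0
  have h4 := mul_ne_zero hz (h3 d hd)
  convert! h4 using 1
  simp only [Pi.smul_apply, smul_eq_mul]
  ring

/-- The point with prescribed coordinates. -/
noncomputable def pointWith (e₀ : E) (q : ({e // e ≠ e₀} → ℝ) × ℝ) : EuclideanSpace ℝ E :=
  WithLp.toLp 2 fun e => if h : e ≠ e₀ then q.1 ⟨e, h⟩ else q.2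

/-- Forgetting one coordinate. -/
def forget (e₀ : E) (x : EuclideanSpace ℝ E) : {e // e ≠ e₀} → ℝ := fun e => x e.1

omit [DecidableEq V] [Nonempty E] in
lemma continuous_pointWith (e₀ : E) : Continuous (pointWith e₀) := by
  refine (PiLp.continuous_toLp 2 _).comp (continuous_pi fun e => ?_)
  by_cases h : e ≠ e₀
  · simp only [h, dif_pos, ne_eq, not_false_eq_true]
    exact (continuous_apply _).comp continuous_fst
  · simp only [h, dif_neg, not_false_eq_true]
    exact continuous_snd

lemma forget_pointWith (e₀ : E) (q : ({e // e ≠ e₀} → ℝ) × ℝ) :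
    forget e₀ (pointWith e₀ q) = q.1 := by
  ext e
  simp [forget, pointWith, e.2]

lemma pointWith_forget (e₀ : E) (x : EuclideanSpace ℝ E) (t : ℝ) :
    pointWith e₀ (forget e₀ x, x e₀ + t) = x + t • EuclideanSpace.single e₀ 1 := by
  ext e
  by_cases h : e = e₀
  · subst h; simp [pointWith]
  · simp [pointWith, forget, h]

lemma lipschitz_forget (e₀ : E) : LipschitzWith 1 (forget e₀) := by
  refine LipschitzWith.of_dist_le_mul fun x y => ?_
  rw [NNReal.coe_one, one_mul, dist_pi_le_iff dist_nonneg]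
  intro e
  rw [Real.dist_eq, dist_eq_norm]
  simpa [forget] using PiLp.norm_apply_le (x - y) e.1

/-- A function of a real variable with a nonzero derivative at a zero changes sign there. -/
lemma _root_.HasDerivAt.exists_neg_mul {f : ℝ → ℝ} {f' : ℝ} (hf : HasDerivAt f f' 0) (h0 : f 0 = 0)
    (hf' : f' ≠ 0) {r : ℝ} (hr : 0 < r) : ∃ τ, 0 < τ ∧ τ < r ∧ f τ * f (-τ) < 0 := by
  have h1 := hasDerivAt_iff_tendsto_slope_zero.1 hf
  have h2 := (h1.const_mul f').eventually (lt_mem_nhds (a := 0) (mul_self_pos.2 hf'))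
  rw [eventually_nhdsWithin_iff, Metric.eventually_nhds_iff] at h2
  obtain ⟨ε, hε, h2⟩ := h2
  have hτ : 0 < min (ε / 2) (r / 2) := by positivity
  set τ := min (ε / 2) (r / 2)
  have hτε : τ < ε := (min_le_left _ _).trans_lt (by linarith)
  refine ⟨τ, hτ, (min_le_right _ _).trans_lt (by linarith), ?_⟩
  have e1 := h2 (y := τ) (by simpa [abs_of_pos hτ] using hτε) hτ.ne'
  have e2 := h2 (y := -τ) (by simpa [abs_of_pos hτ] using hτε) (neg_ne_zero.2 hτ.ne')
  simp only [zero_add, h0, sub_zero, smul_eq_mul] at e1 e2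
  have e3 := mul_pos e1 e2
  have e4 : f' * (τ⁻¹ * f τ) * (f' * ((-τ)⁻¹ * f (-τ))) =
      -((f' * τ⁻¹) ^ 2 * (f τ * f (-τ))) := by
    rw [inv_neg]; ring
  rw [e4] at e3
  by_contra hcon
  have := mul_nonneg (sq_nonneg (f' * τ⁻¹)) (not_lt.1 hcon)
  linarith

/-- The real secular function has a nonzero derivative in the direction `e₀`, so it changes sign
along that line. The sign change persists when the other coordinates move, and the intermediate
value theorem gives a zero near `p`, generic by `eventually_generic`. -/
lemma GenericWave.forget_image_mem_nhds (hD : G.DirichletLeaf)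
    (hconn : G.ConnectedOn Set.univ Set.univ) {p : EuclideanSpace ℝ E} {a : E × Bool → ℂ}
    (h : G.GenericWave p.ofLp a) (e₀ : E) :
    forget e₀ '' {x | ∃ b, G.GenericWave x.ofLp b} ∈ 𝓝 (forget e₀ p) := by
  obtain ⟨κ, hκ0, hκ⟩ := h.exists_adjugate hD
  obtain ⟨c, hc0, hc⟩ := exists_real_secular (G := G) hD
  have hgrad : G.gradSecular p.ofLp e₀ ≠ 0 := by
    rw [h.gradSecular_apply hκ]
    have h2 := norm_ne_zero_iff.2 (h.ne_zero (e₀, true))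
    simp [hκ0, h.ne_zero]
  set w : EuclideanSpace ℝ E → ℂ := fun x =>
    c * Complex.exp (-(Complex.I * ((∑ e, x e : ℝ) : ℂ))) with hw
  set F : EuclideanSpace ℝ E → ℂ := fun x => w x * G.secular x.ofLp 0 with hF
  have hw0 : ∀ x, w x ≠ 0 := fun x => mul_ne_zero hc0 (Complex.exp_ne_zero _)
  have hFim : ∀ x, (F x).im = 0 := fun x => hc x.ofLp
  have hwd : ContDiff ℝ 1 w := contDiff_const.mul (ContDiff.cexp (contDiff_const.mul
    (Complex.ofRealCLM.contDiff.comp (ContDiff.sum fun e _ => contDiff_eucl e))).neg)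
  have hFc : Continuous F := hwd.continuous.mul (contDiff_secular_eucl (n := 1)).continuous
  have hline : HasDerivAt (fun t : ℝ => p + t • EuclideanSpace.single e₀ (1 : ℝ))
      (EuclideanSpace.single e₀ 1) 0 := by
    simpa using ((hasDerivAt_id (0 : ℝ)).smul_const (EuclideanSpace.single e₀ (1 : ℝ))).const_add p
  have hp0 : p + (0 : ℝ) • EuclideanSpace.single e₀ (1 : ℝ) = p := by simp
  have hder : HasDerivAt (fun t : ℝ => F (p + t • EuclideanSpace.single e₀ (1 : ℝ)))
      (w p * G.gradSecular p.ofLp e₀) 0 := by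
    have h1 : HasFDerivAt (fun x : EuclideanSpace ℝ E => G.secular x.ofLp 0) _
        (p + (0 : ℝ) • EuclideanSpace.single e₀ (1 : ℝ)) :=
      ((contDiff_secular_eucl (n := 1)).differentiable one_ne_zero _).hasFDerivAt
    have h2 : HasFDerivAt w _ (p + (0 : ℝ) • EuclideanSpace.single e₀ (1 : ℝ)) :=
      (hwd.differentiable one_ne_zero _).hasFDerivAt
    have h3 := (h2.comp_hasDerivAt (0 : ℝ) hline).mul (h1.comp_hasDerivAt (0 : ℝ) hline)
    convert! h3 using 1
    simp only [Function.comp, hp0, h.secular_eq_zero, mul_zero, zero_add]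
    rw [gradSecular_eq_fderiv]
  have hre : HasDerivAt (fun t : ℝ => (F (p + t • EuclideanSpace.single e₀ (1 : ℝ))).re)
      (w p * G.gradSecular p.ofLp e₀).re 0 :=
    Complex.reCLM.hasFDerivAt.comp_hasDerivAt (0 : ℝ) hder
  have him : (w p * G.gradSecular p.ofLp e₀).im = 0 := by
    have h1 : HasDerivAt (fun t : ℝ => (F (p + t • EuclideanSpace.single e₀ (1 : ℝ))).im)
      (w p * G.gradSecular p.ofLp e₀).im 0 :=
      Complex.imCLM.hasFDerivAt.comp_hasDerivAt (0 : ℝ) hder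
    simp only [hFim] at h1
    exact h1.unique (hasDerivAt_const _ _)
  have hre0 : (w p * G.gradSecular p.ofLp e₀).re ≠ 0 := fun h0 =>
    mul_ne_zero (hw0 p) hgrad (Complex.ext h0 him)
  set q₀ : ({e // e ≠ e₀} → ℝ) × ℝ := (forget e₀ p, p e₀)
  have hq₀ : pointWith e₀ q₀ = p := by simpa using pointWith_forget e₀ p 0
  have hgen : ∀ᶠ q in 𝓝 q₀, G.secular (pointWith e₀ q).ofLp 0 = 0 →
      ∃ b, G.GenericWave (pointWith e₀ q).ofLp b := by
    have h1 := h.eventually_generic hD hconn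
    rw [← hq₀] at h1
    exact (continuous_pointWith e₀).continuousAt.eventually h1
  obtain ⟨r, hr, hball⟩ := Metric.eventually_nhds_iff.1 hgen
  obtain ⟨τ, hτ, hτr, hneg⟩ := hre.exists_neg_mul (by simp [hF, h.secular_eq_zero]) hre0 hr
  simp only [← pointWith_forget] at hneg
  have hcont : ∀ t : ℝ, Continuous fun y : {e // e ≠ e₀} → ℝ => (F (pointWith e₀ (y, t))).re :=
    fun t => Complex.continuous_re.comp (hFc.comp ((continuous_pointWith e₀).comp
      (continuous_id.prodMk continuous_const)))
  have h1 : ∀ᶠ y in 𝓝 (forget e₀ p), (F (pointWith e₀ (y, p e₀ + τ))).re *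
      (F (pointWith e₀ (y, p e₀ + -τ))).re < 0 :=
    (((hcont _).mul (hcont _)).tendsto _).eventually (gt_mem_nhds hneg)
  have h2 : ∀ᶠ y in 𝓝 (forget e₀ p), dist y (forget e₀ p) < r := Metric.ball_mem_nhds _ hr
  filter_upwards [h1, h2] with y hy1 hy2
  have hc : Continuous fun t : ℝ => (F (pointWith e₀ (y, t))).re :=
    Complex.continuous_re.comp (hFc.comp ((continuous_pointWith e₀).comp
      (continuous_const.prodMk continuous_id)))
  have hivt := intermediate_value_uIcc (hc.continuousOn (s := Set.uIcc (p e₀ + -τ) (p e₀ + τ)))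
  have hmem : (0 : ℝ) ∈ Set.uIcc (F (pointWith e₀ (y, p e₀ + -τ))).re
      (F (pointWith e₀ (y, p e₀ + τ))).re := by
    rw [Set.mem_uIcc]
    rcases mul_neg_iff.1 hy1 with h | h
    · exact Or.inl ⟨h.2.le, h.1.le⟩
    · exact Or.inr ⟨h.1.le, h.2.le⟩
  obtain ⟨t, ht, ht0⟩ := hivt hmem
  rw [Set.uIcc_of_le (by linarith)] at ht
  have hF0 : F (pointWith e₀ (y, t)) = 0 := Complex.ext ht0 (hFim _)
  refine ⟨pointWith e₀ (y, t), hball ?_ ((mul_eq_zero.1 hF0).resolve_left (hw0 _)),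
    forget_pointWith e₀ (y, t)⟩
  rw [Prod.dist_eq, max_lt_iff]
  refine ⟨hy2, ?_⟩
  rw [Real.dist_eq]
  exact (abs_le.2 ⟨by linarith [ht.1], by linarith [ht.2]⟩).trans_lt hτr

variable [Fintype V]

-- If the measure were zero, so would be that of the countably many lattice translates, which cover
-- all generic points of `ℝ^E`. Forgetting one coordinate is `1`-Lipschitz, and the image contains
-- an open set of positive Lebesgue measure.
omit [Nonempty E] in
theorem hausdorffMeasure_genericManifold_pos (hG : G.IsNontrivialStandard)
    {p : E → ℝ} {a : E × Bool → ℂ} (h : G.GenericWave p a) :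
    0 < μH[(Fintype.card E : ℝ) - 1] G.genericManifold := by
  have hne := hG.nonempty_edges
  have hD := hG.dirichletLeaf
  obtain ⟨e₀⟩ := id hne
  have hcard : Fintype.card {e // e ≠ e₀} = Fintype.card E - 1 := by simp
  have hcard1 : 1 ≤ Fintype.card E := Fintype.card_pos
  have hd : (Fintype.card E : ℝ) - 1 = ((Fintype.card {e // e ≠ e₀} : ℕ) : ℝ) := by
    rw [hcard, Nat.cast_sub hcard1, Nat.cast_one]
  rw [hd, pos_iff_ne_zero]
  intro h0
  let T : (E → ℤ) → EuclideanSpace ℝ E := fun k => WithLp.toLp 2 fun e => k e * (2 * Real.pi)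
  have hcov : {x : EuclideanSpace ℝ E | ∃ b, G.GenericWave x.ofLp b} ⊆
      ⋃ k : E → ℤ, IsometryEquiv.addRight (T k) '' G.genericManifold := by
    rintro x ⟨b, hb⟩
    have hexp : ∀ e, Complex.exp (Complex.I * ((toIcoMod Real.two_pi_pos 0 (x e) : ℝ) : ℂ)) =
        Complex.exp (Complex.I * (x e : ℂ)) := by
      intro e
      rw [Complex.exp_eq_exp_iff_exists_int]
      refine ⟨-toIcoDiv Real.two_pi_pos 0 (x e), ?_⟩
      have h1 := self_sub_toIcoMod Real.two_pi_pos 0 (x e)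
      rw [zsmul_eq_mul] at h1
      have h3 : toIcoMod Real.two_pi_pos 0 (x e) =
          x e - (toIcoDiv Real.two_pi_pos 0 (x e) : ℝ) * (2 * Real.pi) := by linarith
      rw [h3]
      push_cast
      ring
    refine Set.mem_iUnion.2 ⟨fun e => toIcoDiv Real.two_pi_pos 0 (x e),
      WithLp.toLp 2 fun e => toIcoMod Real.two_pi_pos 0 (x e),
      (mem_genericManifold_iff hG _).2 ⟨fun e => ?_, b, hb.of_exp_eq hexp⟩, ?_⟩
    · have := toIcoMod_mem_Ico Real.two_pi_pos 0 (x e)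
      rwa [zero_add] at this
    · ext e
      have h1 := self_sub_toIcoMod Real.two_pi_pos 0 (x e)
      rw [zsmul_eq_mul] at h1
      change toIcoMod Real.two_pi_pos 0 (x e) + _ * _ = x e
      linarith
  have h1 : μH[(Fintype.card {e // e ≠ e₀} : ℕ)]
      {x : EuclideanSpace ℝ E | ∃ b, G.GenericWave x.ofLp b} = 0 := by
    refine measure_mono_null hcov (measure_iUnion_null fun k => ?_)
    rw [IsometryEquiv.hausdorffMeasure_image, h0]
  have h2 := (lipschitz_forget e₀).hausdorffMeasure_image_le
    (d := (Fintype.card {e // e ≠ e₀} : ℕ)) (by positivity)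
    {x : EuclideanSpace ℝ E | ∃ b, G.GenericWave x.ofLp b}
  rw [h1, mul_zero, hausdorffMeasure_pi_real] at h2
  exact (Measure.measure_pos_of_mem_nhds volume
    (GenericWave.forget_image_mem_nhds (p := WithLp.toLp 2 p) hD hG.connected h e₀)).not_ge h2

omit [Nonempty E] in
theorem fluxMeasure_univ_pos (hG : G.IsNontrivialStandard)
    {p : E → ℝ} {a : E × Bool → ℂ} (h : G.GenericWave p a) :
    0 < G.fluxMeasure Set.univ := by
  have hne := hG.nonempty_edges
  have hm : Measurable fun x : G.genericManifold => ENNReal.ofReal (G.normalDotLen x.1.ofLp) :=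
    (measurable_normalDotLen.comp measurable_subtype_coe).ennreal_ofReal
  rw [fluxMeasure, withDensity_apply _ MeasurableSet.univ, Measure.restrict_univ,
    lintegral_pos_iff_support hm]
  have h1 : (Function.support fun x : G.genericManifold =>
      ENNReal.ofReal (G.normalDotLen x.1.ofLp)) = Set.univ := by
    refine Set.eq_univ_of_forall fun x => ?_
    rw [Function.mem_support]
    obtain ⟨-, a, ha⟩ := (mem_genericManifold_iff hG _).1 x.2
    rw [ne_eq, ENNReal.ofReal_eq_zero, not_le, ha.normalDotLen_eq hG.dirichletLeaf]
    exact div_pos ha.weight_pos (norm_pos_iff.2 (normalVec_ne_zero ha.ne_zero))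
  rw [h1, hausdorffMeasure_image_val, Set.image_univ, Subtype.range_coe]
  exact hausdorffMeasure_genericManifold_pos hG h

end QuantumGraph


/-! ### An explicit generic wave, and the total mass. -/

namespace QuantumGraph

open scoped ComplexConjugate
open Matrix

variable {V E : Type*} {G : QuantumGraph V E} [Fintype V] [Fintype E] [DecidableEq V]
  [DecidableEq E] {C : Finset E}

/-! ### Flows with prescribed divergence -/

/-- On a connected graph every divergence of total zero is attained. -/
lemma exists_flow (h : G.ConnectedOn Set.univ {e | e ∉ C}) (g : V → ℝ) (hg : ∑ v, g v = 0) :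
    ∃ Y : E × Bool → ℝ, (∀ d, Y (rev d) = -Y d) ∧ (∀ d, d.1 ∈ C → Y d = 0) ∧
      ∀ v, ∑ d ∈ G.incoming v, Y d = g v := by
  let flow : (E → ℝ) →ₗ[ℝ] (E × Bool → ℝ) :=
    { toFun := fun y d => if d.1 ∈ C then 0 else (if d.2 then y d.1 else -y d.1)
      map_add' := fun y y' => by
        ext d; simp only [Pi.add_apply]; split_ifs <;> ring
      map_smul' := fun c y => by
        ext d; simp only [Pi.smul_apply, smul_eq_mul, RingHom.id_apply]; split_ifs <;> ring }
  let div : (E × Bool → ℝ) →ₗ[ℝ] (V → ℝ) :=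
    { toFun := fun Y v => ∑ d ∈ G.incoming v, Y d
      map_add' := fun Y Y' => by ext v; simp [Finset.sum_add_distrib]
      map_smul' := fun c Y => by ext v; simp [Finset.mul_sum] }
  let M : Submodule ℝ (V → ℝ) := LinearMap.range (div.comp flow)
  -- Modulo attainable divergences the two ends of an edge off `C` carry the same point mass. By
  -- connectedness all point masses agree, so only the total of `g` matters.
  have hedge : ∀ e ∉ C, M.mkQ (Pi.single (G.init e) 1) = M.mkQ (Pi.single (G.term e) 1) := by
    intro e he
    rw [eq_comm, ← sub_eq_zero, ← map_sub]
    refine (Submodule.Quotient.mk_eq_zero M).2 ⟨Pi.single e 1, ?_⟩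
    ext v
    change ∑ d ∈ G.incoming v, (if d.1 ∈ C then 0 else
      (if d.2 then (Pi.single e 1 : E → ℝ) d.1 else -(Pi.single e 1 : E → ℝ) d.1)) = _
    rw [incoming, Finset.sum_filter, Fintype.sum_prod_type, Finset.sum_eq_single e]
    · by_cases h1 : v = G.init e <;> by_cases h2 : v = G.term e <;>
        simp [he, h1, h2, Pi.single_apply, eq_comm] <;> split_ifs <;> norm_num
    · intro e' _ hne
      simp [hne]
    · simp
  have hmem : g ∈ M := by
    have h0 : M.mkQ g = 0 := by
      have h1 : g = ∑ v, g v • (Pi.single v 1 : V → ℝ) := by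
        ext v; simp [Finset.sum_apply, Pi.single_apply]
      rcases isEmpty_or_nonempty V with hV | ⟨⟨v₀⟩⟩
      · rw [h1]; simp
      · have h2 : ∀ v, M.mkQ (Pi.single v 1) = M.mkQ (Pi.single v₀ 1) := fun v =>
          h.const (f := fun v => M.mkQ (Pi.single v 1)) (fun e he _ _ => hedge e he)
            (Set.mem_univ v) (Set.mem_univ v₀)
        rw [h1, map_sum]
        simp only [map_smul, h2]
        rw [← Finset.sum_smul, hg, zero_smul]
    exact (Submodule.Quotient.mk_eq_zero M).1 h0
  obtain ⟨y, hy⟩ := hmem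
  refine ⟨flow y, fun d => ?_, fun d hd => ?_, fun v => congrFun hy v⟩
  · change (if d.1 ∈ C then (0 : ℝ) else (if (!d.2) = true then y d.1 else -y d.1)) =
      -(if d.1 ∈ C then 0 else (if d.2 = true then y d.1 else -y d.1))
    by_cases h1 : d.1 ∈ C <;> by_cases h2 : d.2 = true <;> simp [h1, h2]
  · change (if d.1 ∈ C then (0 : ℝ) else (if d.2 then y d.1 else -y d.1)) = 0
    rw [if_pos hd]

/-! ### Existence of generic waves -/

/-- The imaginary parts of the amplitudes of an explicit generic wave. -/
structure WaveData (G : QuantumGraph V E) (C : Finset E) (A : E × Bool → ℝ) : Prop where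
  antisymm : ∀ d, d.1 ∉ C → A (rev d) = -A d
  symm : ∀ d, d.1 ∈ C → A (rev d) = A d
  ne_zero : ∀ d, d.1 ∈ C → A d ≠ 0
  conserved : ∀ v, G.degree v ≠ 1 → ∑ d ∈ G.incoming v, A d = 0

variable {A : E × Bool → ℝ}

lemma WaveData.sq_rev (h : G.WaveData C A) (d : E × Bool) : A (rev d) ^ 2 = A d ^ 2 := by
  by_cases hd : d.1 ∈ C
  · rw [h.symm d hd]
  · rw [h.antisymm d hd, neg_sq]

variable (G) in
/-- The explicit wave, normalized to have the value `2` at the vertices which are not leaves. -/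
noncomputable def dataWave (A : E × Bool → ℝ) (d : E × Bool) : ℂ :=
  if G.terminus d ∈ G.dirichlet then Complex.I * (√(1 + A d ^ 2) : ℝ)
  else if G.degree (G.terminus d) = 1 then (√(1 + A d ^ 2) : ℝ) else 1 + Complex.I * A d

lemma norm_sq_dataWave (d : E × Bool) : ‖G.dataWave A d‖ ^ 2 = 1 + A d ^ 2 := by
  have h0 : 0 ≤ 1 + A d ^ 2 := by positivity
  unfold dataWave
  split_ifs
  · simp [abs_of_nonneg (Real.sqrt_nonneg _), Real.sq_sqrt h0]
  · simp [abs_of_nonneg (Real.sqrt_nonneg _), Real.sq_sqrt h0]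
  · rw [Complex.sq_norm, Complex.normSq_apply]
    simp; ring

lemma dataWave_ne_zero (d : E × Bool) : G.dataWave A d ≠ 0 := by
  have := norm_sq_dataWave (G := G) (A := A) d
  rw [← norm_ne_zero_iff]
  intro h
  rw [h] at this
  nlinarith [sq_nonneg (A d)]

lemma sqrt_one_add_sq_ne_zero (t : ℝ) : √(1 + t ^ 2) ≠ 0 :=
  (Real.sqrt_pos.2 (by positivity)).ne'

/-- At an inner vertex the amplitudes `1 + i A` have common real part and conserved imaginary parts.
At a leaf the amplitude is real or, for Dirichlet, purely imaginary; only its modulus is dictated by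
the other end. -/
lemma WaveData.vertexCond (hD : G.DirichletLeaf) (h : G.WaveData C A) :
    G.VertexCond (G.dataWave A) := by
  rw [vertexCond_iff hD]
  refine fun d => ⟨fun hd => by simp [dataWave, hd], fun hd => ?_⟩
  by_cases h1 : G.degree (G.terminus d) = 1
  · rw [incoming_eq_singleton G h1, Finset.sum_singleton, h1]
    simp [dataWave, hd, h1]
  · have h2 : ∀ c ∈ G.incoming (G.terminus d), G.dataWave A c = 1 + Complex.I * A c := by
      intro c hc
      rw [mem_incoming] at hc
      rw [dataWave, hc, if_neg hd, if_neg h1]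
    rw [Finset.sum_congr rfl h2, h2 d (by simp), Finset.sum_add_distrib, ← Finset.mul_sum,
      ← Complex.ofReal_sum, h.conserved _ h1]
    simp [card_incoming]

lemma exists_edgeCond {a : E × Bool → ℂ} (h0 : ∀ d, a d ≠ 0) (h : ∀ d, ‖a (rev d)‖ = ‖a d‖) :
    ∃ x : E → ℝ, EdgeCond x a := by
  refine ⟨fun e => (a (e, true) / conj (a (e, false))).arg, ?_⟩
  have h1 : ∀ e, a (e, true) = Complex.exp (Complex.I *
      ((a (e, true) / conj (a (e, false))).arg : ℝ)) * conj (a (e, false)) := by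
    intro e
    have h2 := Complex.norm_mul_exp_arg_mul_I (a (e, true) / conj (a (e, false)))
    have h3 : ‖a (e, false)‖ = ‖a (e, true)‖ := h (e, true)
    rw [norm_div, RCLike.norm_conj, h3, div_self (norm_ne_zero_iff.2 (h0 _)), Complex.ofReal_one,
      one_mul, mul_comm] at h2
    rw [h2, div_mul_cancel₀]
    simpa using h0 (e, false)
  rintro ⟨e, b⟩
  cases b
  · have h2 := congrArg conj (h1 e)
    rw [map_mul, Complex.conj_conj] at h2
    simp only [rev_mk, Bool.not_false]
    rw [h2]
    linear_combination (-a (e, false)) * conj_exp_I_mul (a (e, true) / conj (a (e, false))).arg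
  · exact h1 e

/-- Another wave is `(p + i z) a` with `p` symmetric and `z` antisymmetric under reversal, and `k =
p - z A` depends only on the vertex. On tree edges `A` is antisymmetric, so `k` agrees at both ends
and is constant. On edges of `C` it is symmetric and nonzero, so constancy of `k` gives `z = 0`
there. The current then vanishes on `C`, hence everywhere, and `p` is constant. -/
lemma WaveData.exists_genericWave (hD : G.DirichletLeaf) (hC : G.IsCut C) (h : G.WaveData C A) :
    ∃ x, G.GenericWave x (G.dataWave A) := by
  set a := G.dataWave A with ha
  have ha0 : ∀ d, a d ≠ 0 := dataWave_ne_zero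
  have hnorm : ∀ d, ‖a (rev d)‖ = ‖a d‖ := fun d => by
    rw [← sq_eq_sq₀ (norm_nonneg _) (norm_nonneg _), norm_sq_dataWave, norm_sq_dataWave, h.sq_rev]
  obtain ⟨x, hx⟩ := exists_edgeCond ha0 hnorm
  have hav := h.vertexCond hD
  refine ⟨x, hav, hx, fun b hbv hbe => ?_, fun d hd => ?_, ha0⟩
  swap
  · rw [ha, dataWave, if_neg hd]
    split_ifs
    · simpa using sqrt_one_add_sq_ne_zero (A d)
    · simp
  obtain ⟨p, z, hb⟩ : ∃ p z : E × Bool → ℝ, ∀ d, b d = (p d + Complex.I * z d) * a d :=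
    ⟨fun d => (b d / a d).re, fun d => (b d / a d).im, fun d => by
      rw [mul_comm Complex.I, Complex.re_add_im, div_mul_cancel₀ _ (ha0 d)]⟩
  have hcur : ∀ d, conj (a d) * b d = ((‖a d‖ ^ 2 : ℝ) : ℂ) * (p d + Complex.I * z d) := by
    intro d
    rw [hb, Complex.ofReal_pow, ← Complex.conj_mul']
    ring
  have hpz : ∀ d, p (rev d) = p d ∧ z (rev d) = -z d := by
    intro d
    have h1 := hx.current hbe d
    have h2 : ((‖a d‖ ^ 2 : ℝ) : ℂ) ≠ 0 := by
      exact_mod_cast pow_ne_zero 2 (norm_ne_zero_iff.2 (ha0 d))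
    rw [hcur, hcur, hnorm, map_mul, Complex.conj_ofReal] at h1
    have h3 := mul_left_cancel₀ h2 h1
    have h4 := congrArg Complex.re h3
    have h5 := congrArg Complex.im h3
    simp at h4 h5
    exact ⟨h4.symm, by linarith⟩
  have hflow := IsFlow.of_wave (δ := 0) hD hav hx hbe (by simpa using hbv)
  have hJ : ∀ d, (conj (a d) * b d).im = ‖a d‖ ^ 2 * z d := fun d => by
    rw [hcur, Complex.im_ofReal_mul]; simp
  have hzero : ∀ d, (conj (a d) * b d).im = 0 → z d = 0 := fun d hd => by
    rw [hJ] at hd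
    exact (mul_eq_zero.1 hd).resolve_left (pow_ne_zero 2 (norm_ne_zero_iff.2 (ha0 d)))
  have hleaf : ∀ d, G.degree (G.terminus d) = 1 → z d = 0 := fun d hd => by
    refine hzero d ?_
    have := hflow.conserved (G.terminus d)
    rwa [incoming_eq_singleton G hd, Finset.sum_singleton] at this
  let k : E × Bool → ℝ := fun d => p d - z d * A d
  have hk : ∀ d d', G.terminus d = G.terminus d' → k d = k d' := by
    intro d d' hdd
    by_cases h1 : G.degree (G.terminus d) = 1
    · rw [eq_of_terminus_eq G h1 hdd.symm]
    · have hre : ∀ c, G.terminus c = G.terminus d → (b c).re = k c := by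
        intro c hc
        have h2 : a c = 1 + Complex.I * A c := by
          rw [ha, dataWave, hc, if_neg (mt (hD _) h1), if_neg h1]
        rw [hb, h2]
        simp [k]
      rw [← hre d rfl, ← hre d' hdd.symm, hbv.re_eq hD hdd]
  classical
  let K : V → ℝ := fun v => if hv : ∃ d, G.terminus d = v then k hv.choose else 0
  have hK : ∀ d, K (G.terminus d) = k d := by
    intro d
    have hv : ∃ c, G.terminus c = G.terminus d := ⟨d, rfl⟩
    simp only [K, dif_pos hv]
    exact hk _ _ hv.choose_spec
  have hKconst : ∀ u v, K u = K v := fun u v =>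
    hC.2.const (f := K) (fun e he _ _ => by
      have h1 := hK (e, true)
      have h2 := hK (e, false)
      rw [terminus_true] at h1
      rw [terminus_false] at h2
      rw [h1, h2]
      have h3 := hpz (e, true)
      have h4 := h.antisymm (e, true) he
      simp only [rev_mk, Bool.not_true] at h3 h4
      simp only [k, h3, h4]
      ring) (Set.mem_univ u) (Set.mem_univ v)
  have hz : ∀ d, z d = 0 := by
    intro d
    refine hzero d (hflow.eq_zero hC (fun e he => ?_) d)
    rw [hJ]
    have h1 := hK (e, true)
    have h2 := hK (e, false)
    have h3 := hpz (e, true)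
    have h4 := h.symm (e, true) he
    have h5 := h.ne_zero (e, true) he
    simp only [rev_mk, Bool.not_true] at h3 h4
    rw [hKconst _ (G.terminus (e, false)), h2] at h1
    simp only [k, h3, h4] at h1
    have h6 : z (e, true) * A (e, true) = 0 := by linarith
    rw [(mul_eq_zero.1 h6).resolve_right h5, mul_zero]
  rcases isEmpty_or_nonempty (E × Bool) with hE | ⟨⟨d₀⟩⟩
  · exact ⟨0, funext fun d => (hE.false d).elim⟩
  refine ⟨k d₀, funext fun d => ?_⟩
  have h1 : p d = k d₀ := by
    rw [← hK d₀, hKconst _ (G.terminus d), hK]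
    simp [k, hz]
  rw [hb, hz, h1]
  simp

lemma sum_degree : ∑ v, G.degree v = 2 * Fintype.card E := by
  simp only [← card_incoming]
  have := Finset.card_eq_sum_card_fiberwise (f := G.terminus) (s := Finset.univ)
    (t := Finset.univ) (fun _ _ => Finset.mem_coe.2 (Finset.mem_univ _))
  rw [Finset.card_univ, Fintype.card_prod, Fintype.card_bool, mul_comm] at this
  exact this.symm

lemma IsNontrivialStandard.degree_pos (hG : G.IsNontrivialStandard) (v : V) : 0 < G.degree v := by
  by_contra hcon
  have h0 : ∀ d, G.terminus d ≠ v := by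
    rintro d rfl
    exact hcon (degree_terminus_pos G d)
  obtain ⟨e⟩ := hG.nonempty_edges
  have h1 := hG.connected.const (f := fun u => u = v) (fun e' _ _ _ => by
    have h2 := h0 (e', true)
    have h3 := h0 (e', false)
    simp only [terminus_true, terminus_false] at h2 h3
    simp [h2, h3]) (Set.mem_univ v) (Set.mem_univ (G.term e))
  exact h0 (e, true) (by simpa using Eq.mp h1 rfl)

/-- An edge of `C` feeds `τ e` into both of its ends. A flow along the tree redistributes this total
`2 ∑ τ` to the divergence `D`, which is allowed to be nonzero at leaves only. -/
lemma exists_waveData (hC : G.IsCut C) (τ : E → ℝ) (hτ : ∀ e ∈ C, τ e ≠ 0) (D : V → ℝ)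
    (hD : ∑ v, D v = 2 * ∑ e ∈ C, τ e) (hD1 : ∀ v, G.degree v ≠ 1 → D v = 0) :
    ∃ A, G.WaveData C A := by
  set P : E × Bool → ℝ := fun d => if d.1 ∈ C then τ d.1 else 0 with hP
  have hPsum : ∑ v, ∑ d ∈ G.incoming v, P d = 2 * ∑ e ∈ C, τ e := by
    rw [sum_incoming, Fintype.sum_prod_type]
    simp only [hP, Fintype.sum_bool, ← two_mul, ← Finset.mul_sum]
    rw [Finset.sum_ite_mem, Finset.univ_inter]
  obtain ⟨Y, hY1, hY2, hY3⟩ := exists_flow hC.2 (fun v => D v - ∑ d ∈ G.incoming v, P d)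
    (by rw [Finset.sum_sub_distrib, hPsum, hD, sub_self])
  refine ⟨fun d => Y d + P d, fun d hd => ?_, fun d hd => ?_, fun d hd => ?_, fun v hv => ?_⟩
  · simp [hP, hd, hY1]
  · simp [hP, hd, hY1, hY2]
  · simpa [hP, hd, hY2] using hτ _ hd
  · rw [Finset.sum_add_distrib, hY3, hD1 v hv]; ring

theorem exists_genericWave (hG : G.IsNontrivialStandard) (hC : G.IsCut C) :
    ∃ x a, G.GenericWave x a := by
  suffices ∃ A, G.WaveData C A by
    obtain ⟨A, hA⟩ := this
    obtain ⟨x, hx⟩ := hA.exists_genericWave hG.dirichletLeaf hC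
    exact ⟨x, _, hx⟩
  by_cases hleaf : ∃ w, G.degree w = 1
  · obtain ⟨w, hw⟩ := hleaf
    refine exists_waveData hC (fun _ => 1) (fun _ _ => one_ne_zero)
      (fun v => if v = w then 2 * ∑ e ∈ C, 1 else 0) (by simp) fun v hv => if_neg ?_
    rintro rfl
    exact hv hw
  · push Not at hleaf
    have hdeg : ∀ v, 2 ≤ G.degree v := fun v => by
      have h1 := hG.degree_pos v
      have h2 := hleaf v
      omega
    obtain ⟨v₀, hv₀⟩ : ∃ v, G.degree v ≠ 2 := by
      by_contra! hcon
      exact hG.not_cycle hcon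
    have h1 : ∑ _v : V, 2 < ∑ v, G.degree v := Finset.sum_lt_sum (fun v _ => hdeg v)
      ⟨v₀, Finset.mem_univ _, lt_of_le_of_ne (hdeg v₀) (Ne.symm hv₀)⟩
    rw [sum_degree, Finset.sum_const, Finset.card_univ, smul_eq_mul] at h1
    have h2 := hC.card_add
    have hcard : 2 ≤ C.card := by omega
    obtain ⟨e₀, he₀⟩ : C.Nonempty := Finset.card_pos.1 (by omega)
    have h2' : (2 : ℝ) ≤ C.card := by exact_mod_cast hcard
    -- Without leaves the values on `C` must have sum zero. Since the graph is not a cycle, `C` has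
    -- at least two elements, and `1 - |C|` is then a nonzero value balancing the ones.
    refine exists_waveData hC (fun e => if e = e₀ then 1 - (C.card : ℝ) else 1) (fun e _ => ?_)
      0 ?_ fun _ _ => rfl
    · split_ifs
      · linarith
      · exact one_ne_zero
    · rw [← Finset.add_sum_erase _ _ he₀, if_pos rfl, Finset.sum_congr rfl fun e he =>
        if_neg (Finset.ne_of_mem_erase he), Finset.sum_const, Finset.card_erase_of_mem he₀,
        nsmul_eq_mul, Nat.cast_sub (by omega)]
      simp

/-- The Barra-Gaspard measure is a probability measure. -/
theorem isProbabilityMeasure_bgMeasure (hG : G.IsNontrivialStandard) (hC : G.IsCut C) :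
    IsProbabilityMeasure G.bgMeasure := by
  obtain ⟨x, a, h⟩ := exists_genericWave hG hC
  refine ⟨?_⟩
  rw [bgMeasure, Measure.smul_apply, smul_eq_mul]
  exact ENNReal.inv_mul_cancel (fluxMeasure_univ_pos hG h).ne' (fluxMeasure_univ_lt_top hG).ne

end QuantumGraph


/-! ### Combinatorics of edge separations. -/

namespace QuantumGraph

variable {V E : Type*} {G : QuantumGraph V E} {n : ℕ} {Γ : Fin n → G.Subgraph}

/-! ### Retractions onto the blocks of a separation -/

/-- Induction on the number of blocks: earlier blocks are sent to the attaching vertex `w` of block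
`b`, and each later block to the image of the single vertex by which it is attached. -/
lemma IsVertexSeparation.exists_retraction_aux (h : G.IsVertexSeparation Γ) (b : Fin n) (w : V)
    (hw : 0 < b.val → w ∈ (Γ b).verts ∧ ∃ i < b, w ∈ (Γ i).verts) (m : ℕ) (hbm : b.val ≤ m) :
    ∃ r : V → V, (∀ v ∈ (Γ b).verts, r v = v) ∧ (∀ j < b, ∀ v ∈ (Γ j).verts, r v = w) ∧
      ∀ j, j ≠ b → j.val ≤ m → ∀ u ∈ (Γ j).verts, ∀ v ∈ (Γ j).verts, r u = r v := by
  classical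
  induction m, hbm using Nat.le_induction with
  | base =>
    refine ⟨fun v => if v ∈ (Γ b).verts then v else w, fun v hv => if_pos hv, ?_, ?_⟩
    · intro j hj v hv
      simp only
      split_ifs with hvb
      · obtain ⟨u, -, hu⟩ := h.common b (by omega)
        rw [hu v ⟨hvb, j, hj, hv⟩, hu w (hw (by omega))]
      · rfl
    · intro j hjb hj
      have hj' : j < b := lt_of_le_of_ne hj hjb
      have key : ∀ v ∈ (Γ j).verts, (if v ∈ (Γ b).verts then v else w) = w := by
        intro v hv
        split_ifs with hvb
        · obtain ⟨u, -, hu⟩ := h.common b (by omega)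
          rw [hu v ⟨hvb, j, hj', hv⟩, hu w (hw (by omega))]
        · rfl
      intro u hu v hv
      simp only [key u hu, key v hv]
  | succ m hbm ih =>
    obtain ⟨r, h1, h2, h3⟩ := ih
    by_cases hm : m + 1 < n
    · obtain ⟨c, hc, hcu⟩ := h.common ⟨m + 1, hm⟩ (Nat.succ_pos _)
      have hold : ∀ j : Fin n, j.val ≤ m → ∀ v ∈ (Γ j).verts,
          (if v ∈ (Γ ⟨m + 1, hm⟩).verts then r c else r v) = r v := by
        intro j hj v hv
        split_ifs with hvm
        · rw [hcu v ⟨hvm, j, Fin.lt_def.2 (by simp only; omega), hv⟩]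
        · rfl
      refine ⟨fun v => if v ∈ (Γ ⟨m + 1, hm⟩).verts then r c else r v, fun v hv => ?_,
        fun j hj v hv => ?_, fun j hjb hj u hu v hv => ?_⟩
      · exact (hold b hbm v hv).trans (h1 v hv)
      · exact (hold j (by have := Fin.lt_def.1 hj; omega) v hv).trans (h2 j hj v hv)
      · by_cases hjm : j.val ≤ m
        · exact (hold j hjm u hu).trans ((h3 j hjb hjm u hu v hv).trans (hold j hjm v hv).symm)
        · have hj' : j = ⟨m + 1, hm⟩ := Fin.ext (by simp only; omega)
          subst hj'
          simp only [hu, hv, if_true]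
    · exact ⟨r, h1, h2, fun j hjb _ => h3 j hjb (by have := j.2; omega)⟩

/-- A retraction onto a block which contracts all the other ones. -/
lemma IsVertexSeparation.exists_retraction (h : G.IsVertexSeparation Γ) (b : Fin n) (w : V)
    (hw : 0 < b.val → w ∈ (Γ b).verts ∧ ∃ i < b, w ∈ (Γ i).verts) :
    ∃ r : V → V, (∀ v ∈ (Γ b).verts, r v = v) ∧ (∀ j < b, ∀ v ∈ (Γ j).verts, r v = w) ∧
      ∀ j, j ≠ b → ∀ u ∈ (Γ j).verts, ∀ v ∈ (Γ j).verts, r u = r v := by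
  obtain ⟨r, h1, h2, h3⟩ := h.exists_retraction_aux b w hw n b.2.le
  exact ⟨r, h1, h2, fun j hj => h3 j hj j.2.le⟩

lemma IsVertexSeparation.exists_common (h : G.IsVertexSeparation Γ) (b : Fin n) :
    ∃ w, 0 < b.val → w ∈ (Γ b).verts ∧ ∃ i < b, w ∈ (Γ i).verts := by
  by_cases hb : 0 < b.val
  · obtain ⟨w, hw, -⟩ := h.common b hb
    exact ⟨w, fun _ => hw⟩
  · obtain ⟨v⟩ := (h.connected b).nonempty
    exact ⟨v.1, fun hb' => absurd hb' hb⟩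

section Finite

variable [Fintype E] [DecidableEq V] [DecidableEq E] {C : Finset E}

/-- Both ends of a shared edge would be the unique common vertex, so the edge would be a loop there
and contribute two to a degree which is one. -/
lemma IsEdgeSeparation.edge_unique (h : G.IsEdgeSeparation Γ) {e : E} {i j : Fin n}
    (hi : e ∈ (Γ i).edges) (hj : e ∈ (Γ j).edges) : i = j := by
  wlog hij : i < j generalizing i j
  · rcases lt_trichotomy i j with h1 | h1 | h1
    · exact absurd h1 hij
    · exact h1
    · exact (this hj hi h1).symm
  exfalso
  have h1 := h.degree_common j _ ((Γ j).init_mem e hj) ⟨i, hij, (Γ i).init_mem e hi⟩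
  obtain ⟨c, -, hc⟩ := h.common j (by have := Fin.lt_def.1 hij; omega)
  have h2 : G.init e = G.term e :=
    (hc _ ⟨(Γ j).init_mem e hj, i, hij, (Γ i).init_mem e hi⟩).trans
      (hc _ ⟨(Γ j).term_mem e hj, i, hij, (Γ i).term_mem e hi⟩).symm
  obtain ⟨d, hd⟩ := Finset.card_eq_one.1 h1
  have h3 : ∀ b', (e, b') = d := fun b' => by
    rw [← Finset.mem_singleton, ← hd]
    refine Finset.mem_filter.2 ⟨Finset.mem_univ _, hj, ?_⟩
    cases b' <;> simp [h2]
  have := (h3 true).trans (h3 false).symm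
  simp at this

/-- For every block there is a set of vertices with a single crossing edge, not in `C`, which
contains the edges of the block in `C`, but no edges of the previous blocks, and does not cut the
other ones. -/
lemma IsEdgeSeparation.exists_singleCrossing [Fintype V] (hE : Nonempty E)
    (h : G.IsEdgeSeparation Γ)
    (hC : G.IsCut C) (b : Fin n) : ∃ (W : Finset V) (e₀ : E) (s : Fin n → ℤˣ),
      G.SingleCrossing W e₀ ∧ s b = -1 ∧ (∀ k < b, s k = 1) ∧
      ∀ i ∈ C, ∀ k, i ∈ (Γ k).edges → (G.term i ∈ W ↔ s k = -1) := by
  classical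
  obtain ⟨e⟩ := hE
  by_cases hb : 0 < b.val
  swap
  -- For the first block everything is flipped. No edge crosses, so the designated edge is
  -- arbitrary.
  · refine ⟨Finset.univ, e, fun _ => -1, fun e' he' => absurd (by simp) he', rfl, fun k hk => ?_,
      fun i _ k _ => by simp⟩
    have := Fin.lt_def.1 hk
    omega
  obtain ⟨w, hw, hwu⟩ := h.common b hb
  obtain ⟨r, hr1, hr2, hr3⟩ := h.exists_retraction b w fun _ => hw
  obtain ⟨d, hd⟩ := Finset.card_eq_one.1 (h.degree_common b w hw.1 hw.2)
  have hd' : ∀ c : E × Bool, c.1 ∈ (Γ b).edges ∧ G.origin c = w ↔ c = d := fun c => by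
    have := Finset.ext_iff.1 hd c
    simpa using this
  -- The side of block `b`, and of what is attached to it away from `w`, of the bridge `d.1` by
  -- which block `b` hangs at `w`.
  set W : Finset V := Finset.univ.filter fun v => r v ≠ w with hW
  have hmem : ∀ v, v ∈ W ↔ r v ≠ w := fun v => by simp [hW]
  have hblock : ∀ e ∈ (Γ b).edges, e ≠ d.1 → G.init e ∈ W ∧ G.term e ∈ W := by
    intro e he hed
    rw [hmem, hmem, hr1 _ ((Γ b).init_mem e he), hr1 _ ((Γ b).term_mem e he)]
    constructor
    · intro h1
      exact hed (congrArg Prod.fst ((hd' (e, true)).1 ⟨he, by simpa using h1⟩))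
    · intro h1
      exact hed (congrArg Prod.fst ((hd' (e, false)).1 ⟨he, by simpa using h1⟩))
  have hother : ∀ k, k ≠ b → ∀ e ∈ (Γ k).edges, (G.init e ∈ W ↔ G.term e ∈ W) := by
    intro k hk e he
    rw [hmem, hmem, hr3 k hk _ ((Γ k).init_mem e he) _ ((Γ k).term_mem e he)]
  have hcross : G.SingleCrossing W d.1 := by
    intro e he
    by_contra hed
    obtain ⟨k, hk⟩ := h.edges_cover e
    by_cases hkb : k = b
    · subst hkb
      have := hblock e hk hed
      exact he (by simp [this])
    · exact he (hother k hkb e hk)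
  -- If `d.1` were in `C`, no other edge would leave `W`, and connectedness off `C` would put both
  -- ends on one side. The far end would then be `w` too, giving a second directed edge at `w`,
  -- against degree one.
  have hdC : d.1 ∉ C := by
    intro hdC
    have h1 := hC.2.const (f := fun v => v ∈ W) (fun e he _ _ => by
      by_contra hcon
      exact he (hcross e (fun h => hcon (propext h)) ▸ hdC)) (Set.mem_univ (G.origin d))
        (Set.mem_univ (G.terminus d))
    obtain ⟨h2, h3⟩ := (hd' d).2 rfl
    have h4 : G.terminus d ∈ (Γ b).verts := by
      rcases d with ⟨e', c⟩
      cases c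
      · simpa using (Γ b).init_mem e' h2
      · simpa using (Γ b).term_mem e' h2
    have h5 : G.terminus d ∉ W := by
      have h6 : G.origin d ∉ W := by rw [hmem, h3, hr1 w hw.1]; simp
      exact fun h7 => h6 (Eq.mpr h1 h7)
    rw [hmem, hr1 _ h4, not_not] at h5
    have h6 := (hd' (rev d)).1 ⟨h2, h5⟩
    have h7 : (!d.2) = d.2 := congrArg Prod.snd h6
    simp at h7
  refine ⟨W, d.1, fun k => if k = b then -1 else if ∃ v ∈ (Γ k).verts, r v ≠ w then -1 else 1,
    hcross, by simp, fun k hk => ?_, fun i hi k hik => ?_⟩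
  · have h1 : ¬ ∃ v ∈ (Γ k).verts, r v ≠ w := by
      rintro ⟨v, hv, hvw⟩
      exact hvw (hr2 k hk v hv)
    simp [hk.ne, h1]
  · by_cases hkb : k = b
    · subst hkb
      have : G.term i ∈ W := (hblock i hik (fun h => hdC (h ▸ hi))).2
      simp [this]
    · simp only [hkb, if_false]
      rw [hmem]
      constructor
      · intro h1
        rw [if_pos ⟨_, (Γ k).term_mem i hik, h1⟩]
      · intro h1 h2
        rw [if_neg] at h1
        · exact absurd h1 (by decide)
        · rintro ⟨v, hv, hvw⟩
          exact hvw ((hr3 k hkb v hv _ ((Γ k).term_mem i hik)).trans h2)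

/-! ### The Betti numbers of the blocks -/

/-- The retraction contracts all other blocks, so the block stays connected after removal of its
edges in `C`; then the edges are counted. -/
lemma IsVertexSeparation.card_block_le [Fintype V] (h : G.IsVertexSeparation Γ) (hC : G.IsCut C)
    (b : Fin n) :
    (C ∩ (Γ b).edges).card + (Γ b).verts.card ≤ (Γ b).edges.card + 1 := by
  obtain ⟨w, hw⟩ := h.exists_common b
  obtain ⟨r, hr1, hr2, hr3⟩ := h.exists_retraction b w hw
  have hne : ((Γ b).verts : Set V).Nonempty := by
    obtain ⟨v⟩ := (h.connected b).nonempty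
    exact ⟨v.1, v.2⟩
  have hconn : G.ConnectedOn ((Γ b).verts : Set V) ((Γ b).edges \ C : Finset E) := by
    refine connectedOn_of_const hne fun P hP u hu v hv hPu => ?_
    have h1 := hC.2.const (f := fun v => P (r v)) (fun e he _ _ => by
      obtain ⟨k, hk⟩ := h.edges_cover e
      by_cases hkb : k = b
      · subst hkb
        have hi := (Γ k).init_mem e hk
        have ht := (Γ k).term_mem e hk
        simp only [hr1 _ hi, hr1 _ ht]
        exact propext (hP e (by simpa using ⟨hk, he⟩) hi ht)
      · rw [hr3 k hkb _ ((Γ k).init_mem e hk) _ ((Γ k).term_mem e hk)])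
      (Set.mem_univ u) (Set.mem_univ v)
    simp only [hr1 u hu, hr1 v hv] at h1
    exact Eq.mp h1 hPu
  have h2 := hconn.card_le
  have h3 := Finset.card_inter_add_card_sdiff (Γ b).edges C
  rw [Finset.inter_comm] at h3
  omega

/-- Each vertex is counted once in the first block containing it, and every block from the second on
has exactly one vertex that occurred before. -/
lemma IsVertexSeparation.sum_card_verts [Fintype V] (h : G.IsVertexSeparation Γ) (hn : 0 < n) :
    ∑ j, (Γ j).verts.card = Fintype.card V + n - 1 := by
  classical
  have hfirst : ∀ v, ∃ j, v ∈ (Γ j).verts ∧ ∀ i < j, v ∉ (Γ i).verts := by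
    intro v
    obtain ⟨j, hj, hmin⟩ := WellFounded.has_min (wellFounded_lt (α := Fin n))
      {j | v ∈ (Γ j).verts} (h.verts_cover v)
    exact ⟨j, hj, fun i hij hi => hmin i hi hij⟩
  choose first hf1 hf2 using hfirst
  have hfib : ∀ j v, first v = j ↔ v ∈ (Γ j).verts ∧ ¬ ∃ i < j, v ∈ (Γ i).verts := by
    intro j v
    constructor
    · rintro rfl
      exact ⟨hf1 v, fun ⟨i, hi, hv⟩ => hf2 v i hi hv⟩
    · rintro ⟨hv, hno⟩
      rcases lt_trichotomy (first v) j with h1 | h1 | h1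
      · exact absurd ⟨_, h1, hf1 v⟩ hno
      · exact h1
      · exact absurd hv (hf2 v j h1)
  have hcard : ∀ j : Fin n, (Γ j).verts.card = (Finset.univ.filter fun v => first v = j).card +
      (if j.val = 0 then 0 else 1) := by
    intro j
    have h1 : (Finset.univ.filter fun v => first v = j) =
        (Γ j).verts.filter fun v => ¬ ∃ i < j, v ∈ (Γ i).verts := by
      ext v; simp only [Finset.mem_filter, Finset.mem_univ, true_and, hfib]
    have h2 : ((Γ j).verts.filter fun v => ∃ i < j, v ∈ (Γ i).verts).card =
        if j.val = 0 then 0 else 1 := by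
      split_ifs with hj
      · rw [Finset.card_eq_zero, Finset.filter_eq_empty_iff]
        rintro v - ⟨i, hi, -⟩
        have := Fin.lt_def.1 hi
        omega
      · obtain ⟨c, hc, hcu⟩ := h.common j (by omega)
        rw [Finset.card_eq_one]
        refine ⟨c, ?_⟩
        ext v
        simp only [Finset.mem_filter, Finset.mem_singleton]
        exact ⟨fun hv => hcu v hv, fun hv => hv ▸ hc⟩
    rw [h1, ← h2, add_comm, Finset.card_filter_add_card_filter_not]
  have h3 := Finset.card_eq_sum_card_fiberwise (f := first) (s := Finset.univ)
    (t := Finset.univ) (fun _ _ => Finset.mem_coe.2 (Finset.mem_univ _))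
  rw [Finset.card_univ] at h3
  simp only [hcard, Finset.sum_add_distrib]
  rw [← h3]
  have h4 : ∑ j : Fin n, (if j.val = 0 then 0 else 1) = n - 1 := by
    obtain ⟨m, rfl⟩ : ∃ m, n = m + 1 := ⟨n - 1, by omega⟩
    rw [Fin.sum_univ_succ]
    simp
  rw [h4]
  omega

lemma IsEdgeSeparation.sum_card_inter (h : G.IsEdgeSeparation Γ) (A : Finset E) :
    ∑ j, (A ∩ (Γ j).edges).card = A.card := by
  choose β hβ using h.edges_cover
  have h1 : ∀ j, A ∩ (Γ j).edges = A.filter fun e => β e = j := by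
    intro j
    ext e
    simp only [Finset.mem_inter, Finset.mem_filter]
    exact and_congr_right fun _ => ⟨fun he => h.edge_unique (hβ e) he, fun he => he ▸ hβ e⟩
  simp only [h1]
  exact (Finset.card_eq_sum_card_fiberwise (fun _ _ => Finset.mem_coe.2 (Finset.mem_univ _))).symm

/-- The Betti number of a block is the number of its edges in `C`. -/
lemma IsEdgeSeparation.card_inter_eq_betti [Fintype V] (h : G.IsEdgeSeparation Γ)
    (hC : G.IsCut C) (b : Fin n) : (C ∩ (Γ b).edges).card = (Γ b).betti := by
  have h1 := fun j => h.toIsVertexSeparation.card_block_le hC j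
  have hn : 0 < n := b.pos
  have h2 := h.toIsVertexSeparation.sum_card_verts hn
  have h3 := h.sum_card_inter C
  have h4 := h.sum_card_inter Finset.univ
  simp only [Finset.univ_inter, Finset.card_univ] at h4
  have h5 := hC.card_add
  have h6 : ∑ j, ((C ∩ (Γ j).edges).card + (Γ j).verts.card) = ∑ j, ((Γ j).edges.card + 1) := by
    rw [Finset.sum_add_distrib, Finset.sum_add_distrib, h2, h3, h4]
    simp
    omega
  have h7 := (Finset.sum_eq_sum_iff_of_le fun j _ => h1 j).1 h6 b (Finset.mem_univ b)
  unfold Subgraph.betti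
  omega

end Finite

end QuantumGraph


namespace QuantumGraph

open scoped ComplexConjugate Topology
open Matrix

/-! ### Morse indices -/

section Morse

variable {ι : Type*} [Fintype ι] [DecidableEq ι]

lemma morseIndex_le_card (A : Matrix ι ι ℂ) : morseIndex A ≤ Fintype.card ι := by
  classical
  unfold morseIndex
  refine (Multiset.countP_le_card _ _).trans ((Polynomial.card_roots' _).trans ?_)
  rw [Matrix.charpoly_natDegree_eq_dim]

lemma star_mul_self_coe (U : Matrix.unitaryGroup ι ℂ) :
    star (U : Matrix ι ι ℂ) * (U : Matrix ι ι ℂ) = 1 := Matrix.UnitaryGroup.star_mul_self U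

lemma morseIndex_eq_card (U : Matrix.unitaryGroup ι ℂ) (l : ι → ℝ) :
    morseIndex ((U : Matrix ι ι ℂ) * Matrix.diagonal (fun i => (l i : ℂ)) *
      star (U : Matrix ι ι ℂ)) = (Finset.univ.filter fun i => l i < 0).card := by
  have h1 : ((U : Matrix ι ι ℂ) * Matrix.diagonal (fun i => (l i : ℂ)) *
      star (U : Matrix ι ι ℂ)).charpoly = ∏ i, (Polynomial.X - Polynomial.C (l i : ℂ)) := by
    rw [Matrix.charpoly_mul_comm, ← mul_assoc, star_mul_self_coe, one_mul, Matrix.charpoly_diagonal]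
  have h2 : (∏ i, (Polynomial.X - Polynomial.C (l i : ℂ))).roots =
      Finset.univ.val.map fun i => (l i : ℂ) := by
    have := Polynomial.roots_multiset_prod_X_sub_C (Finset.univ.val.map fun i => (l i : ℂ))
    rwa [Multiset.map_map] at this
  rw [morseIndex, h1, h2, Multiset.countP_map, Finset.card_def, Finset.filter_val]
  congr 1
  refine Multiset.filter_congr fun i _ => ?_
  simp

lemma exists_diagonalization {A : Matrix ι ι ℂ} (hA : A.IsHermitian) :
    ∃ (U : Matrix.unitaryGroup ι ℂ) (l : ι → ℝ), A =
      (U : Matrix ι ι ℂ) * Matrix.diagonal (fun i => (l i : ℂ)) * star (U : Matrix ι ι ℂ) :=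
  ⟨hA.eigenvectorUnitary, hA.eigenvalues, by
    conv_lhs => rw [hA.spectral_theorem, Unitary.conjStarAlgAut_apply]
    rfl⟩

/-- The quadratic form of a diagonalized matrix. -/
lemma quadratic_diagonalization (U : Matrix.unitaryGroup ι ℂ) (l : ι → ℝ) (c : ι → ℂ) :
    (star ((U : Matrix ι ι ℂ) *ᵥ c) ⬝ᵥ ((U : Matrix ι ι ℂ) * Matrix.diagonal (fun i => (l i : ℂ)) *
      star (U : Matrix ι ι ℂ)) *ᵥ ((U : Matrix ι ι ℂ) *ᵥ c)).re = ∑ i, l i * ‖c i‖ ^ 2 := by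
  rw [Matrix.mulVec_mulVec, mul_assoc, star_mul_self_coe, mul_one, ← Matrix.mulVec_mulVec,
    Matrix.star_mulVec, Matrix.dotProduct_mulVec, Matrix.vecMul_vecMul,
    ← Matrix.star_eq_conjTranspose, star_mul_self_coe, Matrix.vecMul_one, dotProduct,
    Complex.re_sum]
  refine Finset.sum_congr rfl fun i _ => ?_
  rw [Matrix.mulVec_diagonal, Pi.star_apply, RCLike.star_def, mul_left_comm, Complex.conj_mul',
    Complex.re_ofReal_mul]
  norm_cast

/-- The Morse index is at least the dimension of any negative subspace. -/
lemma card_le_morseIndex {A : Matrix ι ι ℂ} (hA : A.IsHermitian) {κ : Type*} [Fintype κ]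
    (T : (κ → ℂ) →ₗ[ℂ] (ι → ℂ)) (hT : ∀ c ≠ 0, (star (T c) ⬝ᵥ A *ᵥ T c).re < 0) :
    Fintype.card κ ≤ morseIndex A := by
  obtain ⟨U, l, rfl⟩ := exists_diagonalization hA
  rw [morseIndex_eq_card]
  let P : (κ → ℂ) →ₗ[ℂ] ({i // l i < 0} → ℂ) :=
    (LinearMap.funLeft ℂ ℂ Subtype.val) ∘ₗ (Matrix.toLin' (star (U : Matrix ι ι ℂ))) ∘ₗ T
  -- A vector without components along negative eigenvectors has a nonnegative quadratic form, so it
  -- cannot be a nonzero element of the negative subspace.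
  have hP : Function.Injective P := by
    rw [← LinearMap.ker_eq_bot, LinearMap.ker_eq_bot']
    intro c hc
    by_contra hc0
    have h1 := hT c hc0
    set w := star (U : Matrix ι ι ℂ) *ᵥ T c with hw
    have h2 : T c = (U : Matrix ι ι ℂ) *ᵥ w := by
      rw [hw, Matrix.mulVec_mulVec, Matrix.mem_unitaryGroup_iff.1 U.2, Matrix.one_mulVec]
    rw [h2, quadratic_diagonalization] at h1
    refine absurd h1 (not_lt.2 (Finset.sum_nonneg fun i _ => ?_))
    by_cases hi : l i < 0
    · have h3 : w i = 0 := congrFun hc ⟨i, hi⟩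
      simp [h3]
    · exact mul_nonneg (not_lt.1 hi) (sq_nonneg _)
  have := LinearMap.finrank_le_finrank_of_injective hP
  rw [Module.finrank_pi, Module.finrank_pi, Fintype.card_subtype] at this
  exact this

lemma norm_quadratic_le {D : Matrix ι ι ℂ} {δ : ℝ} (hD : ∀ i j, ‖D i j‖ ≤ δ) (v : ι → ℂ) :
    ‖star v ⬝ᵥ D *ᵥ v‖ ≤ δ * Fintype.card ι * ∑ i, ‖v i‖ ^ 2 := by
  have h1 : ‖star v ⬝ᵥ D *ᵥ v‖ ≤ ∑ i, ∑ j, ‖v i‖ * (δ * ‖v j‖) := by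
    refine (norm_sum_le _ _).trans (Finset.sum_le_sum fun i _ => ?_)
    rw [norm_mul, Pi.star_apply, norm_star, ← Finset.mul_sum]
    refine mul_le_mul_of_nonneg_left ((norm_sum_le _ _).trans (Finset.sum_le_sum fun j _ => ?_))
      (norm_nonneg _)
    rw [norm_mul]
    exact mul_le_mul_of_nonneg_right (hD i j) (norm_nonneg _)
  rcases isEmpty_or_nonempty ι with hι | ⟨⟨i₀⟩⟩
  · simp
  have hδ : 0 ≤ δ := (norm_nonneg _).trans (hD i₀ i₀)
  have h2 : ∑ i, ∑ j, ‖v i‖ * (δ * ‖v j‖) = δ * (∑ i, ‖v i‖) ^ 2 := by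
    rw [sq, Finset.sum_mul_sum, Finset.mul_sum]
    refine Finset.sum_congr rfl fun i _ => ?_
    rw [Finset.mul_sum]
    exact Finset.sum_congr rfl fun j _ => by ring
  have h3 : (∑ i, ‖v i‖) ^ 2 ≤ Fintype.card ι * ∑ i, ‖v i‖ ^ 2 := sq_sum_le_card_mul_sum_sq
  rw [h2] at h1
  refine h1.trans ?_
  rw [mul_assoc]
  exact mul_le_mul_of_nonneg_left h3 hδ

/-- The Morse index of a Hermitian matrix is lower semicontinuous. -/
lemma eventually_morseIndex_le {A : Matrix ι ι ℂ} (hA : A.IsHermitian) :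
    ∀ᶠ A' in 𝓝 A, A'.IsHermitian → morseIndex A ≤ morseIndex A' := by
  obtain ⟨U, l, hUl⟩ := exists_diagonalization hA
  obtain ⟨m, hm, hm0⟩ : ∃ m : ℝ, (∀ i, l i < 0 → m < -l i) ∧ 0 < m := by
    have h1 : ∀ᶠ m : ℝ in 𝓝[>] 0, ∀ i, l i < 0 → m < -l i := by
      rw [Filter.eventually_all]
      intro i
      by_cases hi : l i < 0
      · exact Filter.Eventually.mono (p := (· < -l i))
          (nhdsWithin_le_nhds (Iio_mem_nhds (neg_pos.2 hi))) fun m hm _ => hm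
      · exact Filter.Eventually.of_forall fun m hm => absurd hm hi
    exact (h1.and self_mem_nhdsWithin).exists
  -- The added one makes `δ · card ι < m` strict, so the perturbation cannot cancel the gap `m`.
  set δ : ℝ := m / (Fintype.card ι + 1) with hδ
  have hδ0 : 0 < δ := by positivity
  have hδm : δ * Fintype.card ι < m := by
    have : δ * (Fintype.card ι + 1) = m := by rw [hδ]; field_simp
    linarith
  have hnear : ∀ᶠ A' in 𝓝 A, ∀ i j, ‖(A' - A) i j‖ ≤ δ := by
    rw [Filter.eventually_all]
    intro i
    rw [Filter.eventually_all]
    intro j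
    have hc : Continuous fun A' : Matrix ι ι ℂ => ‖(A' - A) i j‖ := by
      simp only [Matrix.sub_apply]
      exact ((continuous_id.matrix_elem i j).sub continuous_const).norm
    have := hc.tendsto A
    simp only [sub_self, Matrix.zero_apply, norm_zero] at this
    exact this.eventually (ge_mem_nhds hδ0)
  filter_upwards [hnear] with A' hA' hherm
  let ext : ({i // l i < 0} → ℂ) →ₗ[ℂ] (ι → ℂ) :=
    { toFun := fun c i => if h : l i < 0 then c ⟨i, h⟩ else 0
      map_add' := fun c c' => by ext i; simp only [Pi.add_apply]; split_ifs <;> simp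
      map_smul' := fun r c => by
        ext i; simp only [Pi.smul_apply, RingHom.id_apply]; split_ifs <;> simp }
  have hext : ∀ c i (h : l i < 0), ext c i = c ⟨i, h⟩ := fun c i h => dif_pos h
  have hext' : ∀ c i, ¬ l i < 0 → ext c i = 0 := fun c i h => dif_neg h
  have h1 : morseIndex A = Fintype.card {i // l i < 0} := by
    rw [hUl, morseIndex_eq_card, Fintype.card_subtype]
  rw [h1]
  refine card_le_morseIndex hherm (Matrix.toLin' (U : Matrix ι ι ℂ) ∘ₗ ext) fun c hc => ?_
  simp only [LinearMap.comp_apply, Matrix.toLin'_apply]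
  set w := ext c
  set v := (U : Matrix ι ι ℂ) *ᵥ w with hv
  have hnorm : ∑ i, ‖v i‖ ^ 2 = ∑ i, ‖w i‖ ^ 2 := by
    have h2 := quadratic_diagonalization U (fun _ => 1) w
    simp only [Complex.ofReal_one, Matrix.diagonal_one, mul_one, one_mul] at h2
    rw [Matrix.mem_unitaryGroup_iff.1 U.2, Matrix.one_mulVec] at h2
    rw [← h2, dotProduct, Complex.re_sum]
    refine Finset.sum_congr rfl fun i _ => ?_
    rw [Pi.star_apply, RCLike.star_def, Complex.conj_mul']
    norm_cast
  have hpos : 0 < ∑ i, ‖w i‖ ^ 2 := by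
    obtain ⟨⟨i, hi⟩, hci⟩ := Function.ne_iff.1 hc
    refine Finset.sum_pos' (fun i _ => sq_nonneg _) ⟨i, Finset.mem_univ _, ?_⟩
    have h2 : w i = c ⟨i, hi⟩ := hext c i hi
    rw [h2]
    exact pow_pos (norm_pos_iff.2 hci) 2
  have hq : (star v ⬝ᵥ A *ᵥ v).re ≤ -m * ∑ i, ‖w i‖ ^ 2 := by
    rw [hUl, hv, quadratic_diagonalization, Finset.mul_sum]
    refine Finset.sum_le_sum fun i _ => ?_
    by_cases hi : l i < 0
    · exact mul_le_mul_of_nonneg_right (by linarith [hm i hi]) (sq_nonneg _)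
    · have h2 : w i = 0 := hext' c i hi
      simp [h2]
  have hsplit : star v ⬝ᵥ A' *ᵥ v = star v ⬝ᵥ A *ᵥ v + star v ⬝ᵥ (A' - A) *ᵥ v := by
    rw [← dotProduct_add, ← Matrix.add_mulVec, add_sub_cancel]
  have hle := (Complex.re_le_norm _).trans (norm_quadratic_le hA' v)
  rw [hsplit, Complex.add_re]
  rw [hnorm] at hle
  have := mul_lt_mul_of_pos_right hδm hpos
  linarith

/-- The Morse indices of a nondegenerate Hermitian matrix and of its opposite. -/
lemma morseIndex_neg {A : Matrix ι ι ℂ} (hA : A.IsHermitian) (hdet : A.det ≠ 0) :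
    morseIndex (-A) = Fintype.card ι - morseIndex A := by
  obtain ⟨U, l, rfl⟩ := exists_diagonalization hA
  have h1 : -((U : Matrix ι ι ℂ) * Matrix.diagonal (fun i => (l i : ℂ)) *
      star (U : Matrix ι ι ℂ)) = (U : Matrix ι ι ℂ) *
        Matrix.diagonal (fun i => ((-l i : ℝ) : ℂ)) * star (U : Matrix ι ι ℂ) := by
    rw [← neg_mul, ← mul_neg, Matrix.diagonal_neg]
    simp
  have h2 : ∀ i, l i ≠ 0 := by
    rw [Matrix.det_mul, Matrix.det_mul, Matrix.det_diagonal] at hdet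
    intro i hi
    refine hdet ?_
    rw [Finset.prod_eq_zero (Finset.mem_univ i) (by simp [hi])]
    simp
  rw [h1, morseIndex_eq_card, morseIndex_eq_card]
  have h3 := Finset.card_filter_add_card_filter_not (s := Finset.univ) fun i => l i < 0
  have h4 : (Finset.univ.filter fun i => -l i < 0) = Finset.univ.filter fun i => ¬ l i < 0 := by
    refine Finset.filter_congr fun i _ => ?_
    rw [neg_lt_zero, not_lt]
    exact ⟨le_of_lt, fun h => lt_of_le_of_ne h (h2 i).symm⟩
  rw [h4, ← Finset.card_univ, ← h3]
  omega

/-- The Morse index is locally constant along nondegenerate Hermitian matrices. -/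
lemma isLocallyConstant_morseIndex {X : Type*} [TopologicalSpace X] {A : X → Matrix ι ι ℂ}
    (hc : Continuous A) (hA : ∀ x, (A x).IsHermitian) (hdet : ∀ x, (A x).det ≠ 0) :
    IsLocallyConstant fun x => morseIndex (A x) := by
  rw [IsLocallyConstant.iff_eventually_eq]
  intro x
  -- Semicontinuity for `A` and for `-A` bounds the index from both sides, the two indices being
  -- complementary in the nondegenerate case.
  have h1 := (hc.tendsto x).eventually (eventually_morseIndex_le (hA x))
  have h2 := (hc.neg.tendsto x).eventually (eventually_morseIndex_le (hA x).neg)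
  filter_upwards [h1, h2] with y hy1 hy2
  have h3 := hy1 (hA y)
  have h4 : morseIndex (-A x) ≤ morseIndex (-A y) := hy2 (hA y).neg
  rw [morseIndex_neg (hA x) (hdet x), morseIndex_neg (hA y) (hdet y)] at h4
  have h5 := morseIndex_le_card (A x)
  have h6 := morseIndex_le_card (A y)
  omega

end Morse

end QuantumGraph


/-! ### Flipping single blocks, and the reflection of a local surplus. -/

namespace QuantumGraph

open scoped ComplexConjugate Topology
open Matrix

variable {V E : Type*} {G : QuantumGraph V E} [Fintype V] [Fintype E] [DecidableEq V]
  [DecidableEq E] {C : Finset E} {n : ℕ} {Γ : Fin n → G.Subgraph}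

/-! ### Symmetries of the generic manifold -/

variable (G C Γ) in
/-- The signs which some measure preserving transformation of the generic manifold imposes on the
blocks of the normalized Hessian. -/
noncomputable def signGroup : Submonoid (Fin n → ℤˣ) where
  carrier := {s | ∃ R : G.genericManifold → G.genericManifold,
    MeasurePreserving R G.bgMeasure G.bgMeasure ∧ ∀ (x) (i j : C) (k), i.1 ∈ (Γ k).edges →
      G.surplusMatrix C (R x).1.ofLp i j = ((s k : ℤ) : ℂ) * G.surplusMatrix C x.1.ofLp i j}
  one_mem' := ⟨id, MeasurePreserving.id _, fun x i j k _ => by simp⟩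
  mul_mem' := by
    rintro s t ⟨R, hR, hs⟩ ⟨T, hT, ht⟩
    refine ⟨R ∘ T, hR.comp hT, fun x i j k hi => ?_⟩
    rw [Function.comp_apply, hs _ i j k hi, ht _ i j k hi, Pi.mul_apply]
    push_cast
    ring

lemma exists_mem_signGroup (hG : G.IsNontrivialStandard) (hΓ : G.IsEdgeSeparation Γ)
    (hC : G.IsCut C) (b : Fin n) :
    ∃ s ∈ signGroup G C Γ, s b = -1 ∧ ∀ k < b, s k = 1 := by
  have hE := hG.nonempty_edges
  obtain ⟨W, e₀, s, hW, hsb, hsk, hs⟩ := hΓ.exists_singleCrossing hE hC b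
  refine ⟨s, ⟨flip hG hW, measurePreserving_flip_bgMeasure hG hW, fun x i j k hi => ?_⟩, hsb, hsk⟩
  obtain ⟨-, a, ha⟩ := (mem_genericManifold_iff hG _).1 x.2
  have h1 := ha.surplusMatrix_flip (C := C) hG.dirichletLeaf hW
    (ha.isFlip_flipMap hG.dirichletLeaf) i j
  change G.surplusMatrix C (G.flipMap W x.1).ofLp i j = _
  rw [h1]
  by_cases hk : s k = -1
  · rw [if_pos ((hs i.1 i.2 k hi).2 hk), hk]; simp
  · rw [if_neg (mt (hs i.1 i.2 k hi).1 hk), (Int.units_eq_one_or (s k)).resolve_right hk]; simp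

/-- Every block can be flipped separately. -/
lemma mulSingle_mem_signGroup (hG : G.IsNontrivialStandard) (hΓ : G.IsEdgeSeparation Γ)
    (hC : G.IsCut C) (b : Fin n) : Pi.mulSingle b (-1) ∈ signGroup G C Γ := by
  -- Descending induction: the sign vector of block `b` is trivial before `b`, and its entries after
  -- `b` can be undone by the single flips already obtained. The correction `P` is its own inverse.
  induction b using WellFoundedGT.induction with
  | _ b ih =>
    obtain ⟨s, hs, hsb, hsk⟩ := exists_mem_signGroup hG hΓ hC b
    set P := ∏ j ∈ Finset.univ.erase b, Pi.mulSingle j (s j) with hP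
    have h1 : s = Pi.mulSingle b (-1) * P := by
      have h2 := Finset.univ_prod_mulSingle s
      rw [← Finset.mul_prod_erase _ _ (Finset.mem_univ b), hsb] at h2
      exact h2.symm
    have hPm : P ∈ signGroup G C Γ := by
      refine Submonoid.prod_mem _ fun j hj => ?_
      rcases lt_trichotomy j b with hjb | hjb | hjb
      · rw [hsk j hjb, Pi.mulSingle_one]; exact Submonoid.one_mem _
      · exact absurd hjb (Finset.ne_of_mem_erase hj)
      · rcases Int.units_eq_one_or (s j) with h | h
        · rw [h, Pi.mulSingle_one]; exact Submonoid.one_mem _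
        · rw [h]; exact ih j hjb
    have hPP : P * P = 1 := by
      ext k
      simp [Int.units_mul_self]
    have h3 : Pi.mulSingle b (-1) = s * P := by
      rw [h1, mul_assoc, hPP, mul_one]
    rw [h3]
    exact Submonoid.mul_mem _ hs hPm

/-! ### The block structure of the normalized Hessian -/

lemma GenericWave.surplusMatrix_symm [Nonempty E] (hD : G.DirichletLeaf) {x : E → ℝ}
    {a : E × Bool → ℂ} (h : G.GenericWave x a) (i j : C) :
    G.surplusMatrix C x i j = G.surplusMatrix C x j i := by
  obtain ⟨q, hq⟩ := h.exists_fluxResponse hD i.1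
  obtain ⟨q', hq'⟩ := h.exists_fluxResponse hD j.1
  rw [h.surplusMatrix_apply hD i j hq', h.surplusMatrix_apply hD j i hq,
    hq.current_symm hD h.edge hq']

lemma GenericWave.conj_surplusMatrix [Nonempty E] (hD : G.DirichletLeaf) {x : E → ℝ}
    {a : E × Bool → ℂ} (h : G.GenericWave x a) (i j : C) :
    conj (G.surplusMatrix C x i j) = G.surplusMatrix C x i j := by
  obtain ⟨q, hq⟩ := h.exists_fluxResponse hD j.1
  rw [h.surplusMatrix_apply hD i j hq, Complex.conj_ofReal]

/-- The fluxes on different blocks do not interact. -/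
lemma surplusMatrix_eq_zero (hG : G.IsNontrivialStandard) (hΓ : G.IsEdgeSeparation Γ)
    (hC : G.IsCut C) (x : G.genericManifold) {i j : C} {k l : Fin n} (hi : i.1 ∈ (Γ k).edges)
    (hj : j.1 ∈ (Γ l).edges) (hkl : k ≠ l) : G.surplusMatrix C x.1.ofLp i j = 0 := by
  have hE := hG.nonempty_edges
  -- Flipping block `k` alone changes the sign of row `i` but not of row `j`; by symmetry the entry
  -- equals its own opposite.
  obtain ⟨R, -, hR⟩ := mulSingle_mem_signGroup hG hΓ hC k
  obtain ⟨-, a, ha⟩ := (mem_genericManifold_iff hG _).1 x.2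
  obtain ⟨-, a', ha'⟩ := (mem_genericManifold_iff hG _).1 (R x).2
  have h1 := hR x i j k hi
  have h2 := hR x j i l hj
  rw [ha'.surplusMatrix_symm hG.dirichletLeaf j i, ha.surplusMatrix_symm hG.dirichletLeaf j i,
    h1, Pi.mulSingle_eq_same, Pi.mulSingle_eq_of_ne hkl.symm] at h2
  push_cast at h2
  linear_combination (-1 / 2) * h2

/-- The diagonal block of the normalized Hessian. -/
noncomputable def blockMatrix (C : Finset E) (H : G.Subgraph) (x : G.genericManifold) :
    Matrix {e : C // e.1 ∈ H.edges} {e : C // e.1 ∈ H.edges} ℂ :=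
  (G.surplusMatrix C x.1.ofLp).submatrix Subtype.val Subtype.val

lemma localSurplus_eq (H : G.Subgraph) (x : G.genericManifold) :
    G.localSurplus C H x = morseIndex (blockMatrix C H x) := rfl

lemma blockMatrix_isHermitian (hG : G.IsNontrivialStandard) (H : G.Subgraph)
    (x : G.genericManifold) : (blockMatrix C H x).IsHermitian := by
  have hE := hG.nonempty_edges
  obtain ⟨-, a, ha⟩ := (mem_genericManifold_iff hG _).1 x.2
  ext i j
  rw [Matrix.conjTranspose_apply]
  change conj (G.surplusMatrix C x.1.ofLp j.1 i.1) = G.surplusMatrix C x.1.ofLp i.1 j.1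
  rw [ha.conj_surplusMatrix hG.dirichletLeaf, ha.surplusMatrix_symm hG.dirichletLeaf]

/-- A kernel vector of the block, extended by zero, lies in the kernel of the whole normalized
Hessian because the other blocks do not interact with it. The passage to real entries is made since
injectivity is stated for real vectors. -/
lemma blockMatrix_det_ne_zero (hG : G.IsNontrivialStandard) (hΓ : G.IsEdgeSeparation Γ)
    (hC : G.IsCut C) (b : Fin n) (x : G.genericManifold) : (blockMatrix C (Γ b) x).det ≠ 0 := by
  have hE := hG.nonempty_edges
  have hD := hG.dirichletLeaf
  obtain ⟨-, a, ha⟩ := (mem_genericManifold_iff hG _).1 x.2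
  set M : Matrix {e : C // e.1 ∈ (Γ b).edges} {e : C // e.1 ∈ (Γ b).edges} ℝ :=
    Matrix.of fun i j => (blockMatrix C (Γ b) x i j).re with hM
  have hMA : ∀ i j, blockMatrix C (Γ b) x i j = (M i j : ℂ) := fun i j =>
    (Complex.conj_eq_iff_re.1 (ha.conj_surplusMatrix hD i.1 j.1)).symm
  have hdet : (blockMatrix C (Γ b) x).det = (M.det : ℂ) := by
    have h1 : blockMatrix C (Γ b) x = Complex.ofRealHom.mapMatrix M := by
      ext i j; exact hMA i j
    rw [h1, ← RingHom.map_det]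
    rfl
  rw [hdet, Complex.ofReal_ne_zero]
  intro h0
  obtain ⟨η, hη0, hη⟩ := Matrix.exists_mulVec_eq_zero_iff.2 h0
  apply hη0
  let η' : C → ℝ := fun j => if h : j.1 ∈ (Γ b).edges then η ⟨j, h⟩ else 0
  have h1 : η' = 0 := by
    refine ha.surplusMatrix_injective hD hC fun i => ?_
    have h2 : ∑ j, G.surplusMatrix C x.1.ofLp i j * (η' j : ℂ) =
        ∑ j : {e : C // e.1 ∈ (Γ b).edges}, G.surplusMatrix C x.1.ofLp i j.1 * (η j : ℂ) := by
      rw [← Fintype.sum_subtype_add_sum_subtype (fun j : C => j.1 ∈ (Γ b).edges)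
        fun j => G.surplusMatrix C x.1.ofLp i j * (η' j : ℂ)]
      have h3 : ∀ j : {e : C // e.1 ∉ (Γ b).edges}, η' j.1 = 0 := fun j => dif_neg j.2
      have h4 : ∀ j : {e : C // e.1 ∈ (Γ b).edges}, η' j.1 = η j := fun j => dif_pos j.2
      simp only [h3, h4, Complex.ofReal_zero, mul_zero, Finset.sum_const_zero, add_zero]
    rw [h2]
    obtain ⟨k, hk⟩ := hΓ.edges_cover i.1
    by_cases hkb : k = b
    · subst hkb
      have h3 := congrFun hη ⟨i, hk⟩
      rw [Matrix.mulVec, dotProduct] at h3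
      have h4 : ∀ j : {e : C // e.1 ∈ (Γ k).edges}, G.surplusMatrix C x.1.ofLp i j.1 =
          (M ⟨i, hk⟩ j : ℂ) := fun j => hMA ⟨i, hk⟩ j
      simp only [h4]
      exact_mod_cast h3
    · exact Finset.sum_eq_zero fun j _ => by
        rw [surplusMatrix_eq_zero hG hΓ hC x hk j.2 hkb, zero_mul]
  ext j
  have h2 := congrFun h1 j.1
  simpa [η', j.2] using h2

/-! ### Continuity of the normalized Hessian -/

lemma continuous_lineDeriv_lineDeriv {X Y : Type*} [NormedAddCommGroup X] [NormedSpace ℝ X]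
    [NormedAddCommGroup Y] [NormedSpace ℝ Y] {f : X → Y → ℂ}
    (hf : ContDiff ℝ 2 fun p : X × Y => f p.1 p.2) (u v : Y) :
    Continuous fun x => lineDeriv ℝ (fun y => lineDeriv ℝ (f x) y v) 0 u := by
  have hd1 : ∀ x, Differentiable ℝ (f x) := fun x =>
    (hf.comp ((contDiff_const (c := x)).prodMk contDiff_id)).differentiable two_ne_zero
  have h2 : ContDiff ℝ 1 fun p : X × Y => fderiv ℝ (f p.1) p.2 v :=
    (ContDiff.fderiv (f := fun (p : X × Y) (y : Y) => f p.1 y) (g := Prod.snd)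
      (hf.comp ((contDiff_fst.comp contDiff_fst).prodMk contDiff_snd)) contDiff_snd
      (by norm_num)).clm_apply contDiff_const
  have hd2 : ∀ x, Differentiable ℝ fun y => fderiv ℝ (f x) y v := fun x =>
    (h2.comp ((contDiff_const (c := x)).prodMk contDiff_id)).differentiable one_ne_zero
  have h3 : ContDiff ℝ 0 fun x => fderiv ℝ (fun y => fderiv ℝ (f x) y v) 0 u :=
    (ContDiff.fderiv (f := fun x y => fderiv ℝ (f x) y v) (g := fun _ => (0 : Y)) h2
      contDiff_const (by norm_num)).clm_apply contDiff_const
  have h4 : ∀ x, lineDeriv ℝ (fun y => lineDeriv ℝ (f x) y v) 0 u =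
      fderiv ℝ (fun y => fderiv ℝ (f x) y v) 0 u := by
    intro x
    have h5 : (fun y => lineDeriv ℝ (f x) y v) = fun y => fderiv ℝ (f x) y v :=
      funext fun y => (hd1 x y).lineDeriv_eq_fderiv
    rw [h5]
    exact (hd2 x 0).lineDeriv_eq_fderiv
  simp only [h4]
  exact h3.continuous

lemma continuous_fluxHessian (i j : C) :
    Continuous fun x : EuclideanSpace ℝ E => G.fluxHessian C x.ofLp i j := by
  refine continuous_lineDeriv_lineDeriv (f := fun (x : EuclideanSpace ℝ E) (α : C → ℝ) =>
    G.secular x.ofLp (fluxPotential C α)) ?_ (Pi.single i 1) (Pi.single j 1)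
  refine contDiff_secular (fun e => (contDiff_eucl e).comp contDiff_fst) fun e => ?_
  unfold fluxPotential
  by_cases h : e ∈ C
  · simp only [h, dif_pos]
    exact (contDiff_apply ℝ ℝ (⟨e, h⟩ : C)).comp contDiff_snd
  · simp only [h, dif_neg, not_false_eq_true]; exact contDiff_const

lemma continuous_blockMatrix (hG : G.IsNontrivialStandard) (H : G.Subgraph) :
    Continuous (blockMatrix C H) := by
  have hE := hG.nonempty_edges
  refine continuous_matrix fun i j => ?_
  change Continuous fun x : G.genericManifold =>
    -((G.gradDotLen x.1.ofLp)⁻¹ * G.fluxHessian C x.1.ofLp i.1 j.1)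
  refine (Continuous.mul (Continuous.inv₀ (continuous_normalDotLen_num.comp continuous_subtype_val)
    fun x => ?_) ((continuous_fluxHessian i.1 j.1).comp continuous_subtype_val)).neg
  obtain ⟨-, a, ha⟩ := (mem_genericManifold_iff hG _).1 x.2
  obtain ⟨κ, hκ0, hκ⟩ := ha.exists_adjugate hG.dirichletLeaf
  have hw : (G.weight a : ℂ) ≠ 0 := by exact_mod_cast ha.weight_pos.ne'
  simp [ha.gradDotLen_eq hκ, hκ0, hw]

/-! ### The local surpluses -/

lemma card_blockIndex (hΓ : G.IsEdgeSeparation Γ) (hC : G.IsCut C) (b : Fin n) :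
    Fintype.card {e : C // e.1 ∈ (Γ b).edges} = (Γ b).betti := by
  rw [← hΓ.card_inter_eq_betti hC b, Fintype.card_subtype]
  refine Finset.card_bij (fun e _ => e.1) (fun e he => ?_) (fun e _ e' _ h => Subtype.ext h)
    fun e he => ?_
  · exact Finset.mem_inter.2 ⟨e.2, (Finset.mem_filter.1 he).2⟩
  · obtain ⟨h1, h2⟩ := Finset.mem_inter.1 he
    exact ⟨⟨e, h1⟩, by simpa using h2, rfl⟩

lemma localSurplus_le (hΓ : G.IsEdgeSeparation Γ) (hC : G.IsCut C) (b : Fin n)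
    (x : G.genericManifold) : G.localSurplus C (Γ b) x ≤ (Γ b).betti := by
  rw [← card_blockIndex hΓ hC b]
  exact morseIndex_le_card _

/-- Continuous nondegenerate Hermitian blocks have locally constant Morse index. -/
lemma measurable_localSurplus (hG : G.IsNontrivialStandard) (hΓ : G.IsEdgeSeparation Γ)
    (hC : G.IsCut C) (b : Fin n) : Measurable (G.localSurplus C (Γ b)) :=
  (isLocallyConstant_morseIndex (continuous_blockMatrix hG (Γ b)) (blockMatrix_isHermitian hG _)
    (blockMatrix_det_ne_zero hG hΓ hC b)).continuous.measurable

/-- A measure preserving transformation which reflects a single local surplus. -/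
lemma exists_reflection (hG : G.IsNontrivialStandard) (hΓ : G.IsEdgeSeparation Γ)
    (hC : G.IsCut C) (b : Fin n) : ∃ R : G.genericManifold → G.genericManifold,
      MeasurePreserving R G.bgMeasure G.bgMeasure ∧
      (∀ x, G.localSurplus C (Γ b) (R x) = (Γ b).betti - G.localSurplus C (Γ b) x) ∧
      ∀ j ≠ b, ∀ x, G.localSurplus C (Γ j) (R x) = G.localSurplus C (Γ j) x := by
  obtain ⟨R, hR, hRs⟩ := mulSingle_mem_signGroup hG hΓ hC b
  refine ⟨R, hR, fun x => ?_, fun j hj x => ?_⟩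
  · have h1 : blockMatrix C (Γ b) (R x) = -blockMatrix C (Γ b) x := by
      ext i j
      have := hRs x i.1 j.1 b i.2
      simpa [blockMatrix] using this
    rw [localSurplus_eq, h1, morseIndex_neg (blockMatrix_isHermitian hG _ x)
      (blockMatrix_det_ne_zero hG hΓ hC b x), card_blockIndex hΓ hC b]
    rfl
  · have h1 : blockMatrix C (Γ j) (R x) = blockMatrix C (Γ j) x := by
      ext i i'
      have := hRs x i.1 i'.1 j i.2
      simpa [blockMatrix, Pi.mulSingle_eq_of_ne hj] using this
    rw [localSurplus_eq, h1, localSurplus_eq]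

end QuantumGraph


namespace QuantumGraph

variable {V E : Type*} {G : QuantumGraph V E} [Fintype V] [Fintype E] [DecidableEq V]
  [DecidableEq E] {C : Finset E} {n : ℕ} {Γ : Fin n → G.Subgraph}

/-! ### The distribution of the local surpluses -/

lemma measurable_otherSurpluses (hG : G.IsNontrivialStandard) (hΓ : G.IsEdgeSeparation Γ)
    (hC : G.IsCut C) (b : Fin n) : Measurable (G.otherSurpluses C Γ b) :=
  measurable_pi_lambda _ fun j => measurable_localSurplus hG hΓ hC j.1

/-- The joint law of the local surpluses is invariant under the reflection of one of them. -/
lemma measure_localSurplus_inter (hG : G.IsNontrivialStandard) (hΓ : G.IsEdgeSeparation Γ)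
    (hC : G.IsCut C) (b : Fin n) {B : Set ({j : Fin n // j ≠ b} → ℕ)} (hB : MeasurableSet B)
    {s : ℕ} (hs : s ≤ (Γ b).betti) :
    G.bgMeasure (G.otherSurpluses C Γ b ⁻¹' B ∩ {x | G.localSurplus C (Γ b) x = s}) =
      G.bgMeasure (G.otherSurpluses C Γ b ⁻¹' B ∩
        {x | G.localSurplus C (Γ b) x = (Γ b).betti - s}) := by
  obtain ⟨R, hR, hb, ho⟩ := exists_reflection hG hΓ hC b
  have hm : MeasurableSet (G.otherSurpluses C Γ b ⁻¹' B ∩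
      {x | G.localSurplus C (Γ b) x = (Γ b).betti - s}) :=
    (measurable_otherSurpluses hG hΓ hC b hB).inter
      (measurable_localSurplus hG hΓ hC b (measurableSet_singleton _))
  rw [← hR.measure_preimage hm.nullMeasurableSet]
  refine congrArg _ (Set.ext fun x => ?_)
  have h1 : G.otherSurpluses C Γ b (R x) = G.otherSurpluses C Γ b x :=
    funext fun j => ho j.1 j.2 x
  have h2 := localSurplus_le hΓ hC b x
  have h3 := hb x
  change G.otherSurpluses C Γ b x ∈ B ∧ G.localSurplus C (Γ b) x = s ↔
    G.otherSurpluses C Γ b (R x) ∈ B ∧ G.localSurplus C (Γ b) (R x) = (Γ b).betti - s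
  rw [h1, h3]
  generalize G.localSurplus C (Γ b) x = m at h2 ⊢
  -- The truncated subtraction is harmless: both `m` and `s` are at most the Betti number.
  exact and_congr_right fun _ => by omega

/-- The surplus takes only the values `0` and `1`, and the reflection exchanges them, so the event
is cut into two parts of equal measure. -/
lemma measure_localSurplus_inter_of_betti_eq_one (hG : G.IsNontrivialStandard)
    (hΓ : G.IsEdgeSeparation Γ) (hC : G.IsCut C) (b : Fin n) (h1 : (Γ b).betti = 1)
    {B : Set ({j : Fin n // j ≠ b} → ℕ)} (hB : MeasurableSet B) {s : ℕ} (hs : s ≤ 1) :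
    G.bgMeasure (G.otherSurpluses C Γ b ⁻¹' B ∩ {x | G.localSurplus C (Γ b) x = s}) =
      G.bgMeasure (G.otherSurpluses C Γ b ⁻¹' B) / 2 := by
  have h01 : G.bgMeasure (G.otherSurpluses C Γ b ⁻¹' B ∩ {x | G.localSurplus C (Γ b) x = s}) =
      G.bgMeasure (G.otherSurpluses C Γ b ⁻¹' B \ {x | G.localSurplus C (Γ b) x = s}) := by
    rw [measure_localSurplus_inter hG hΓ hC b hB (hs.trans h1.ge), h1]
    congr 1
    ext x
    have h2 := localSurplus_le hΓ hC b x
    simp only [Set.mem_inter_iff, Set.mem_preimage, Set.mem_ofPred_eq, Set.mem_sdiff]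
    exact and_congr_right fun _ => by omega
  have hadd := measure_inter_add_sdiff (μ := G.bgMeasure) (G.otherSurpluses C Γ b ⁻¹' B)
    (measurable_localSurplus hG hΓ hC b (measurableSet_singleton s))
  change G.bgMeasure (_ ∩ {x | G.localSurplus C (Γ b) x = s}) +
    G.bgMeasure (_ \ {x | G.localSurplus C (Γ b) x = s}) = _ at hadd
  rw [← h01, ← two_mul] at hadd
  rw [← hadd, mul_comm, ENNReal.mul_div_cancel_right two_ne_zero ENNReal.ofNat_ne_top]

lemma indepFun_localSurplus (hG : G.IsNontrivialStandard) (hΓ : G.IsEdgeSeparation Γ)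
    (hC : G.IsCut C) (b : Fin n) (h1 : (Γ b).betti = 1) :
    IndepFun (G.localSurplus C (Γ b)) (G.otherSurpluses C Γ b) G.bgMeasure := by
  have hP := isProbabilityMeasure_bgMeasure hG hC
  have hm := measurable_localSurplus hG hΓ hC b
  have hsum : ∀ {B : Set ({j : Fin n // j ≠ b} → ℕ)}, MeasurableSet B → ∀ A : Set ℕ,
      G.bgMeasure (G.localSurplus C (Γ b) ⁻¹' A ∩ G.otherSurpluses C Γ b ⁻¹' B) =
        G.bgMeasure (G.otherSurpluses C Γ b ⁻¹' B) / 2 *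
          (∑ s ∈ Finset.range 2, A.indicator 1 s) := by
    classical
    intro B hB A
    have h2 : G.localSurplus C (Γ b) ⁻¹' A ∩ G.otherSurpluses C Γ b ⁻¹' B =
        ⋃ s ∈ (Finset.range 2).filter (· ∈ A),
          G.otherSurpluses C Γ b ⁻¹' B ∩ {x | G.localSurplus C (Γ b) x = s} := by
      ext x
      have h3 := localSurplus_le hΓ hC b x
      simp only [Set.mem_inter_iff, Set.mem_preimage, Set.mem_iUnion, Finset.mem_filter,
        Finset.mem_range, Set.mem_ofPred_eq]
      constructor
      · rintro ⟨hA, hx⟩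
        exact ⟨_, ⟨by omega, hA⟩, hx, rfl⟩
      · rintro ⟨s, ⟨-, hA⟩, hx, rfl⟩
        exact ⟨hA, hx⟩
    rw [h2, measure_biUnion_finset, Finset.mul_sum, Finset.sum_filter]
    · refine Finset.sum_congr rfl fun s hs => ?_
      by_cases hA : s ∈ A
      · rw [if_pos hA, Set.indicator_of_mem hA, Pi.one_apply, mul_one]
        exact measure_localSurplus_inter_of_betti_eq_one hG hΓ hC b h1 hB
          (Nat.lt_succ_iff.1 (Finset.mem_range.1 hs))
      · rw [if_neg hA, Set.indicator_of_notMem hA, mul_zero]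
    · intro s _ t _ hst
      exact Set.disjoint_left.2 fun x hx hx' => hst (hx.2.symm.trans hx'.2)
    · exact fun s _ => (measurable_otherSurpluses hG hΓ hC b hB).inter
        (hm (measurableSet_singleton s))
  rw [indepFun_iff_measure_inter_preimage_eq_mul]
  intro A B _ hB
  have hA := hsum MeasurableSet.univ A
  rw [Set.preimage_univ, Set.inter_univ, measure_univ] at hA
  rw [hsum hB A, hA, div_eq_mul_inv, one_div]
  ring

end QuantumGraph

theorem mainTheorem3 {V E : Type*} [Fintype V] [Fintype E] [DecidableEq V] [DecidableEq E]
    (G : QuantumGraph V E) (hG : G.IsNontrivialStandard)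
    {n : ℕ} (Γ : Fin n → G.Subgraph) (hΓ : G.IsEdgeSeparation Γ)
    (C : Finset E) (hC : G.IsCut C) (b : Fin n) :
    IsProbabilityMeasure G.bgMeasure ∧
    (∀ j, Measurable (G.localSurplus C (Γ j)) ∧
      ∀ x, G.localSurplus C (Γ j) x ≤ (Γ j).betti) ∧
    (∀ (t : {j : Fin n // j ≠ b} → ℕ) (s : ℕ), s ≤ (Γ b).betti →
      ProbabilityTheory.cond G.bgMeasure {x | G.otherSurpluses C Γ b x = t}
          {x | G.localSurplus C (Γ b) x = s} =
        ProbabilityTheory.cond G.bgMeasure {x | G.otherSurpluses C Γ b x = t}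
          {x | G.localSurplus C (Γ b) x = (Γ b).betti - s}) ∧
    ((Γ b).betti = 1 →
      (∀ t : {j : Fin n // j ≠ b} → ℕ, G.bgMeasure {x | G.otherSurpluses C Γ b x = t} ≠ 0 →
        ∀ s ∈ ({0, 1} : Set ℕ),
          ProbabilityTheory.cond G.bgMeasure {x | G.otherSurpluses C Γ b x = t}
            {x | G.localSurplus C (Γ b) x = s} = 1 / 2) ∧
      (∀ s ∈ ({0, 1} : Set ℕ), G.bgMeasure {x | G.localSurplus C (Γ b) x = s} = 1 / 2) ∧
      ProbabilityTheory.IndepFun (G.localSurplus C (Γ b)) (G.otherSurpluses C Γ b)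
        G.bgMeasure) := by
  have hP := QuantumGraph.isProbabilityMeasure_bgMeasure hG hC
  have ho := QuantumGraph.measurable_otherSurpluses hG hΓ hC b
  refine ⟨hP, fun j => ⟨QuantumGraph.measurable_localSurplus hG hΓ hC j,
    QuantumGraph.localSurplus_le hΓ hC j⟩, fun t s hs => ?_, fun h1 => ⟨fun t ht s hs => ?_,
    fun s hs => ?_, QuantumGraph.indepFun_localSurplus hG hΓ hC b h1⟩⟩
  · have ht : MeasurableSet {x | G.otherSurpluses C Γ b x = t} := ho (measurableSet_singleton t)
    -- Both conditional probabilities have the same normalizing factor, so no positivity of the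
    -- conditioning event is needed.
    rw [cond_apply ht, cond_apply ht]
    exact congrArg _
      (QuantumGraph.measure_localSurplus_inter hG hΓ hC b (measurableSet_singleton t) hs)
  · have hs1 : s ≤ 1 := by rcases hs with rfl | rfl <;> norm_num
    have hm : MeasurableSet {x | G.otherSurpluses C Γ b x = t} := ho (measurableSet_singleton t)
    rw [cond_apply hm]
    refine (congrArg _ (QuantumGraph.measure_localSurplus_inter_of_betti_eq_one hG hΓ hC b h1
      (measurableSet_singleton t) hs1)).trans ?_
    rw [← mul_div_assoc]
    exact congrArg (· / 2) (ENNReal.inv_mul_cancel ht (measure_ne_top _ _))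
  · have hs1 : s ≤ 1 := by rcases hs with rfl | rfl <;> norm_num
    have h2 := QuantumGraph.measure_localSurplus_inter_of_betti_eq_one hG hΓ hC b h1
      MeasurableSet.univ hs1
    rwa [Set.preimage_univ, Set.univ_inter, measure_univ] at h2
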